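/- Let $n\ge 1$, let $\alpha>0$, and let $f$ be a smooth symmetric function on the positive cone $\Gamma_+=\{x\in\mathbb R^n: x_i>0 \text{ for all } i\}$ which is strictly increasing ($\partial f/\partial \kappa_i>0$ on $\Gamma_+$ for every $i$), homogeneous of degree one, strictly positive and normalized by $f(1,\dots,1)=1$, and which is inverse concave, i.e. the function $f_*(x_1,\dots,x_n)=f(x_1^{-1},\dots,x_n^{-1})^{-1}$ is concave on $\Gamma_+$. Let $M$ be a closed (compact, connected, without boundary) smooth $n$-manifold, let $0<T\le\infty$, let $\phi:[0,T)\to\mathbb R$ be any function, and let $X:M\times[0,T)\to\mathbb H^{n+1}$ be a smooth family of immersions into hyperbolic space solving $$\frac{\partial}{\partial t}X(x,t)=\bigl(\phi(t)-f(\kappa(x,t))^{\alpha}\bigr)\,\nu(x,t),$$ where $X(\cdot,0)$ is an embedding, $\nu(\cdot,t)$ is the unit normal of $M_t=X(M,t)$, smooth in $(x,t)$, which at $t=0$ points out of the domain enclosed by $M_0$, and $\kappa(x,t)=(\kappa_1,\dots,\kappa_n)$ are the principal curvatures of $M_t$ with respect to $\nu$. (That $\kappa(x,t)\in\Gamma_+$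 is not presupposed: $f$ may be extended arbitrarily to $\mathbb R^n$. The choice of $\phi(t)$ which keeps a quermassintegral of the enclosed domain constant is a special case.) Suppose that $M_0$ is h-convex, i.e. for every point $p\in M_0$ there is a horoball of $\mathbb H^{n+1}$ which contains the domain enclosed by $M_0$ and has $p$ as a boundary point. Then $M_t$ is strictly h-convex for every $t\in(0,T)$, that is, $\kappa_i(x,t)>1$ for all $i=1,\dots,n$ and all $x\in M$. -/

import Mathlib

open Set Topology
open scoped Manifold ContDiff

noncomputable section

namespace HypFlow

/-! ## Hyperbolic space (hyperboloid model) -/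

/-- The vector space `ℝ^{n+2}`, ambient space of the hyperboloid model of `ℍ^{n+1}`. -/
abbrev Ambient (n : ℕ) : Type := EuclideanSpace ℝ (Fin (n + 2))

/-- The Lorentz form `-x₀y₀ + x₁y₁ + ⋯ + x_{n+1}y_{n+1}` on `ℝ^{n+2}`. -/
def lorentz {n : ℕ} (x y : Ambient n) : ℝ :=
  -(x 0 * y 0) + ∑ i : Fin (n + 1), x i.succ * y i.succ

/-- Hyperbolic space `ℍ^{n+1}`: the upper sheet of the hyperboloid `⟨x, x⟩ = -1`, with the
Riemannian metric induced by the Lorentz form. The tangent space at `p` consists of the `v` with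
`⟨v, p⟩ = 0`. -/
def hyperbolicSpace (n : ℕ) : Set (Ambient n) :=
  {x | lorentz x x = -1 ∧ 0 < x 0}

/-- The geodesic distance of `ℍ^{n+1}`: `cosh d(x, y) = -⟨x, y⟩`. -/
def hypDist {n : ℕ} (x y : Ambient n) : ℝ := Real.arcosh (-lorentz x y)

/-- The open geodesic ball of radius `r` around `c`. -/
def geodesicBall {n : ℕ} (c : Ambient n) (r : ℝ) : Set (Ambient n) :=
  {x | x ∈ hyperbolicSpace n ∧ hypDist x c < r}

/-- `v` is a unit tangent vector of `ℍ^{n+1}` at `p`. -/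
def IsUnitTangent {n : ℕ} (p v : Ambient n) : Prop :=
  lorentz v v = 1 ∧ lorentz v p = 0

/-- The unit speed geodesic of `ℍ^{n+1}` through `p` with initial velocity `v`. -/
def geodesic {n : ℕ} (p v : Ambient n) (s : ℝ) : Ambient n :=
  Real.cosh s • p + Real.sinh s • v

/-- The horoball with `p` on its boundary determined by the geodesic ray from `p` in direction `v`:
the union of the geodesic balls which have their centre on that ray and `p` on their boundary. -/
def horoball {n : ℕ} (p v : Ambient n) : Set (Ambient n) :=
  ⋃ s ∈ Ioi (0 : ℝ), geodesicBall (geodesic p v s) s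

/-- The boundary of a subset `Ω` of `ℍ^{n+1}` relative to `ℍ^{n+1}` (which is closed in the ambient
space). -/
def hypBoundary {n : ℕ} (Ω : Set (Ambient n)) : Set (Ambient n) :=
  closure Ω ∩ closure (hyperbolicSpace n \ Ω)

/-- Horospherical convexity of a domain `Ω ⊆ ℍ^{n+1}`: at every boundary point `p` there is a
horoball which contains `Ω` and has `p` as a boundary point. -/
def IsHConvexDomain {n : ℕ} (Ω : Set (Ambient n)) : Prop :=
  ∀ p ∈ hypBoundary Ω, ∃ v, IsUnitTangent p v ∧ Ω ⊆ horoball p v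

/-- The domain enclosed by a closed hypersurface `S ⊆ ℍ^{n+1}`: the union of the bounded connected
components of `ℍ^{n+1} \ S`. (A subset of the hyperboloid is bounded for the hyperbolic distance iff
it is bounded in the ambient space.) -/
def enclosedDomain {n : ℕ} (S : Set (Ambient n)) : Set (Ambient n) :=
  {x | x ∈ hyperbolicSpace n \ S ∧
    Bornology.IsBounded (connectedComponentIn (hyperbolicSpace n \ S) x)}

/-- The tangent vector `v` at the boundary point `p` of `Ω` points out of `Ω`. -/
def PointsOutward {n : ℕ} (Ω : Set (Ambient n)) (p v : Ambient n) : Prop :=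
  ∃ ε > 0, ∀ s ∈ Ioo (0 : ℝ) ε, geodesic p (-v) s ∈ Ω ∧ geodesic p v s ∉ Ω

/-! ## Extrinsic geometry of an immersed hypersurface -/

section Hypersurface

variable {n : ℕ} {M : Type*} [TopologicalSpace M] [ChartedSpace (EuclideanSpace ℝ (Fin n)) M]

/-- The differential at `x` of a map `Y : M → ℝ^{n+2}`, the tangent space `T_x M` being modelled on
`ℝ^n` through the preferred chart at `x`. -/
def differential (Y : M → Ambient n) (x : M) : EuclideanSpace ℝ (Fin n) →L[ℝ] Ambient n :=
  mfderiv (𝓡 n) 𝓘(ℝ, Ambient n) Y x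

/-- The partial derivative `∂ᵢ Y` at `x`, in the preferred chart at `x`. -/
def partialAt (Y : M → Ambient n) (x : M) (i : Fin n) : Ambient n :=
  differential Y x (EuclideanSpace.single i 1)

/-- `N` is a unit normal field along `Y : M → ℍ^{n+1}`. -/
def IsUnitNormal (Y N : M → Ambient n) : Prop :=
  ∀ x, IsUnitTangent (Y x) (N x) ∧ ∀ i, lorentz (N x) (partialAt Y x i) = 0

/-- The induced metric `g_{ij} = ⟨∂ᵢY, ∂ⱼY⟩`. -/
def firstFundamentalForm (Y : M → Ambient n) (x : M) : Matrix (Fin n) (Fin n) ℝ :=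
  Matrix.of fun i j => lorentz (partialAt Y x i) (partialAt Y x j)

/-- The second fundamental form `h_{ij} = ⟨D_i N, ∂ⱼY⟩` with respect to the unit normal `N`, where
`D` is the Levi-Civita connection of `ℍ^{n+1}`. In the hyperboloid model `D_i N` is the tangential
part of `∂ᵢN`, which is all of `∂ᵢN` since `⟨∂ᵢN, Y⟩ = -⟨N, ∂ᵢY⟩ = 0`. With this sign geodesic
spheres have positive curvature with respect to the outward normal. -/
def secondFundamentalForm (Y N : M → Ambient n) (x : M) : Matrix (Fin n) (Fin n) ℝ :=
  Matrix.of fun i j => lorentz (partialAt N x i) (partialAt Y x j)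

/-- The Weingarten matrix `h_i^j = h_{ik} g^{kj}`. -/
def weingarten (Y N : M → Ambient n) (x : M) : Matrix (Fin n) (Fin n) ℝ :=
  secondFundamentalForm Y N x * (firstFundamentalForm Y x)⁻¹

/-- The eigenvalues of a matrix with `n` real eigenvalues, with multiplicity, in increasing order.
-/
def eigenvalueVector (A : Matrix (Fin n) (Fin n) ℝ) : Fin n → ℝ :=
  fun i => (A.charpoly.roots.sort (· ≤ ·)).getD i 0

/-- The principal curvatures `κ₁ ≤ ⋯ ≤ κₙ` at `x`: the eigenvalues of the Weingarten matrix. -/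
def principalCurvatures (Y N : M → Ambient n) (x : M) : Fin n → ℝ :=
  eigenvalueVector (weingarten Y N x)

/-- A closed embedded hypersurface `Y : M → ℍ^{n+1}` is h-convex if the domain it encloses is. -/
def IsHConvexHypersurface (Y : M → Ambient n) : Prop :=
  IsHConvexDomain (enclosedDomain (range Y))

/-- Strict h-convexity of a hypersurface with outward unit normal `N`: all principal curvatures are
strictly bigger than `1` everywhere. -/
def IsStrictlyHConvex (Y N : M → Ambient n) : Prop :=
  ∀ x i, 1 < principalCurvatures Y N x i

end Hypersurface

/-! ## Curvature functions -/

/-- The positive cone `Γ₊ ⊆ ℝ^n`. -/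
def positiveCone (n : ℕ) : Set (Fin n → ℝ) := {x | ∀ i, 0 < x i}

/-- The dual function `f_*(x₁, …, xₙ) = f(x₁⁻¹, …, xₙ⁻¹)⁻¹`. -/
def dualFunction {n : ℕ} (f : (Fin n → ℝ) → ℝ) : (Fin n → ℝ) → ℝ :=
  fun x => (f fun i => (x i)⁻¹)⁻¹

/-- `f` is inverse concave: its dual function is concave on `Γ₊`. -/
def IsInverseConcave {n : ℕ} (f : (Fin n → ℝ) → ℝ) : Prop :=
  ConcaveOn ℝ (positiveCone n) (dualFunction f)

/-- `f` is a smooth, symmetric, strictly increasing, homogeneous of degree one, positive and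
normalized function on `Γ₊`. Its values outside `Γ₊` are irrelevant. -/
structure IsCurvatureFunction {n : ℕ} (f : (Fin n → ℝ) → ℝ) : Prop where
  smooth : ContDiffOn ℝ ∞ f (positiveCone n)
  symmetric : ∀ (σ : Equiv.Perm (Fin n)), ∀ κ ∈ positiveCone n, f (κ ∘ σ) = f κ
  increasing : ∀ κ ∈ positiveCone n, ∀ i, 0 < fderiv ℝ f κ (Pi.single i 1)
  homogeneous : ∀ κ ∈ positiveCone n, ∀ c : ℝ, 0 < c → f (c • κ) = c * f κ
  positive : ∀ κ ∈ positiveCone n, 0 < f κ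
  normalized : f (fun _ => 1) = 1

/-! ## The flow -/

/-- The time interval `[0, T)`, where `T` may be `∞`. -/
def timeInterval (T : EReal) : Set ℝ := {t | 0 ≤ t ∧ (t : EReal) < T}

/-- `X : M × [0, T) → ℍ^{n+1}` is a smooth family of immersions solving
`∂X/∂t = (φ(t) - F^α(𝒲)) ν`, where `F(𝒲) = f(κ(𝒲))` and `ν` is the smooth family of outward unit
normals. The initial map is an embedding, and `ν(·, 0)` points out of the domain enclosed by its
image; for `t > 0`, where `X(·, t)` is only required to be an immersion, `ν(·, t)` is the unit
normal obtained from it by continuity. -/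
structure IsCurvatureFlow {n : ℕ} {M : Type*} [TopologicalSpace M]
    [ChartedSpace (EuclideanSpace ℝ (Fin n)) M]
    (f : (Fin n → ℝ) → ℝ) (α : ℝ) (φ : ℝ → ℝ) (T : EReal) (X ν : ℝ → M → Ambient n) : Prop where
  smooth : ContMDiffOn (𝓘(ℝ, ℝ).prod (𝓡 n)) 𝓘(ℝ, Ambient n) ∞
    (fun q : ℝ × M => X q.1 q.2) (timeInterval T ×ˢ univ)
  mem_hyperbolicSpace : ∀ t ∈ timeInterval T, ∀ x, X t x ∈ hyperbolicSpace n
  immersion : ∀ t ∈ timeInterval T, ∀ x, Function.Injective (differential (X t) x)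
  embedding_zero : IsEmbedding (X 0)
  smooth_normal : ContMDiffOn (𝓘(ℝ, ℝ).prod (𝓡 n)) 𝓘(ℝ, Ambient n) ∞
    (fun q : ℝ × M => ν q.1 q.2) (timeInterval T ×ˢ univ)
  unit_normal : ∀ t ∈ timeInterval T, IsUnitNormal (X t) (ν t)
  outward_zero : ∀ x, PointsOutward (enclosedDomain (range (X 0))) (X 0 x) (ν 0 x)
  evolution : ∀ t ∈ timeInterval T, ∀ x,
    HasDerivWithinAt (fun s => X s x)
      ((φ t - f (principalCurvatures (X t) (ν t) x) ^ α) • ν t x) (timeInterval T) t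

end HypFlow

end

/-! The proof passes to the dual hypersurface. In the hyperboloid model the unit normal `ν` is a
point of de Sitter space, and position and normal play symmetric roles: `X` is normal to the
hypersurface traced by `ν`, whose metric is the third fundamental form `⟨dν, dν⟩`. Where the
principal curvatures are positive, a principal frame satisfies `dX = λ dν` with `λ_i = 1/κ_i`, so
the `λ_i` are the eigenvalues of the second fundamental form relative to the third. With `F = f_*`
the normal velocity becomes `σ = φ(t) - F(λ)^(-α)`. Inverse concavity of `f` says exactly that `F`
is concave, hence so is `-F^(-α)`. The goal is `λ < 1`.

The core is `IsDualFlow.contact_inequality`. Let a smooth function `m` bound all `λ_k` from above up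
to some time and touch `λ_i` at a point. There, with `G_k > 0` the partial derivatives of `-F^(-α)`,
`∂ₜm ≤ ∑ G_k (∇²m(e_k, e_k) + (λ_i - λ_k)(λ_i λ_k - 1)) + σ(1 - λ_i²) - ∑ ∂_j m ∂_j σ / λ_j`. It
combines three facts. The evolution of the second form against the third contains the second
derivative of `σ` (`evolution_identity`). Concavity bounds that second derivative by the
linearization, so no terms quadratic in the derivative of curvature survive (`dd_dd_speed_le`).
Commuting derivatives costs only the zero-order term `(λ_i - λ_k)(λ_i λ_k - 1)` (`simons_identity`).
At `λ_i = 1` the zero-order terms are at most `0`, whatever the sign of `σ`; hence `φ` may be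
arbitrary.

The concavity step avoids differentiating eigenvalues. A symmetric concave function of the
eigenvalues is at most its value on the diagonal entries (Schur and Birkhoff), hence at most its
tangent plane there; the diagonal entries are expanded with a cubic error
(`exists_eigenvalue_estimate`), which does not affect second derivatives.

Three applications finish the proof. Supporting horoballs give `κ ≥ 1` at time `0`
(`initial_pinching`). The barriers `1 + m exp(βt)` with `m → 0` preserve `κ ≥ 1`
(`exists_pinching_rate`, `pairing_le`). A strong maximum principle with barriers supported in
growing paraboloids spreads `λ < 1` from a small ball to a larger one at any later time
(`strict_of_strict`). Strictness holds initially at a point furthest from the origin, and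
connectedness of `M` carries it everywhere at every positive time. -/

noncomputable section

namespace HypFlow

/-! ## The Lorentz form -/

section LorentzForm

variable {n : ℕ}

/-- The coordinate `x₀` as a continuous linear form. -/
def timeCoord (n : ℕ) : Ambient n →L[ℝ] ℝ := EuclideanSpace.proj 0

/-- The Lorentz form as a continuous bilinear form. -/
def lorentzL (n : ℕ) : Ambient n →L[ℝ] Ambient n →L[ℝ] ℝ :=
  isBoundedBilinearMap_inner.toContinuousLinearMap
    - (2 : ℝ) • (timeCoord n).smulRight (timeCoord n)

theorem lorentz_eq_inner (x y : Ambient n) : lorentz x y = inner ℝ x y - 2 * (x 0 * y 0) := by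
  simp only [lorentz, PiLp.inner_apply, Fin.sum_univ_succ (n := n + 1), RCLike.inner_apply,
    conj_trivial]
  have : ∀ i : Fin (n + 1), y i.succ * x i.succ = x i.succ * y i.succ := fun i => mul_comm _ _
  simp only [this]
  ring

theorem lorentzL_apply (x y : Ambient n) : lorentzL n x y = lorentz x y := by
  rw [lorentz_eq_inner]
  simp [lorentzL, timeCoord]

theorem lorentz_comm (x y : Ambient n) : lorentz x y = lorentz y x := by
  rw [lorentz_eq_inner, lorentz_eq_inner, real_inner_comm]; ring

@[simp] theorem lorentz_add_left (x y z : Ambient n) :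
    lorentz (x + y) z = lorentz x z + lorentz y z := by
  simp [← lorentzL_apply]

@[simp] theorem lorentz_add_right (x y z : Ambient n) :
    lorentz x (y + z) = lorentz x y + lorentz x z := by
  simp [← lorentzL_apply]

@[simp] theorem lorentz_sub_left (x y z : Ambient n) :
    lorentz (x - y) z = lorentz x z - lorentz y z := by
  simp [← lorentzL_apply]

@[simp] theorem lorentz_sub_right (x y z : Ambient n) :
    lorentz x (y - z) = lorentz x y - lorentz x z := by
  simp [← lorentzL_apply]

@[simp] theorem lorentz_smul_left (c : ℝ) (x y : Ambient n) :
    lorentz (c • x) y = c * lorentz x y := by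
  simp [← lorentzL_apply]

@[simp] theorem lorentz_smul_right (c : ℝ) (x y : Ambient n) :
    lorentz x (c • y) = c * lorentz x y := by
  simp [← lorentzL_apply]

@[simp] theorem lorentz_neg_left (x y : Ambient n) : lorentz (-x) y = -lorentz x y := by
  simp [← lorentzL_apply]

@[simp] theorem lorentz_neg_right (x y : Ambient n) : lorentz x (-y) = -lorentz x y := by
  simp [← lorentzL_apply]

@[simp] theorem lorentz_zero_left (y : Ambient n) : lorentz 0 y = 0 := by
  simp [← lorentzL_apply]

@[simp] theorem lorentz_zero_right (y : Ambient n) : lorentz y 0 = 0 := by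
  simp [← lorentzL_apply]

theorem lorentz_sum_left {ι : Type*} (s : Finset ι) (x : ι → Ambient n) (y : Ambient n) :
    lorentz (∑ i ∈ s, x i) y = ∑ i ∈ s, lorentz (x i) y := by
  simp [← lorentzL_apply, map_sum]

theorem lorentz_sum_right {ι : Type*} (s : Finset ι) (x : Ambient n) (y : ι → Ambient n) :
    lorentz x (∑ i ∈ s, y i) = ∑ i ∈ s, lorentz x (y i) := by
  simp [← lorentzL_apply, map_sum]

theorem abs_lorentz_le (x y : Ambient n) : |lorentz x y| ≤ 3 * (‖x‖ * ‖y‖) := by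
  rw [lorentz_eq_inner]
  have h1 := abs_real_inner_le_norm x y
  have h2 : |x 0 * y 0| ≤ ‖x‖ * ‖y‖ := by
    rw [abs_mul]
    exact mul_le_mul (PiLp.norm_apply_le x 0) (PiLp.norm_apply_le y 0) (abs_nonneg _)
      (norm_nonneg _)
  calc |inner ℝ x y - 2 * (x 0 * y 0)| ≤ |inner ℝ x y| + |2 * (x 0 * y 0)| := abs_sub _ _
    _ ≤ 3 * (‖x‖ * ‖y‖) := by rw [abs_mul, abs_two]; linarith

/-- The sum of the products of the spatial coordinates satisfies the Cauchy-Schwarz inequality. -/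
theorem spatial_cauchy_schwarz (x y : Ambient n) :
    (lorentz x y + x 0 * y 0) ^ 2 ≤ (lorentz x x + x 0 * x 0) * (lorentz y y + y 0 * y 0) := by
  have := Finset.sum_mul_sq_le_sq_mul_sq Finset.univ (fun i : Fin (n + 1) => x i.succ)
    (fun i => y i.succ)
  simp only [lorentz]
  ring_nf
  ring_nf at this
  linarith

theorem spatial_nonneg (x : Ambient n) : 0 ≤ lorentz x x + x 0 * x 0 := by
  simp only [lorentz]
  have : 0 ≤ ∑ i : Fin (n + 1), x i.succ * x i.succ :=
    Finset.sum_nonneg fun i _ => mul_self_nonneg _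
  linarith

/-- A vector orthogonal to a unit timelike vector is spacelike. -/
theorem lorentz_self_pos {p x : Ambient n} (hp : lorentz p p = -1) (hx : lorentz x p = 0)
    (hx0 : x ≠ 0) : 0 < lorentz x x := by
  have hcs := spatial_cauchy_schwarz x p
  have hs := spatial_nonneg x
  rw [hp, hx] at hcs
  by_contra hcon
  push Not at hcon
  -- If `⟨x, x⟩ ≤ 0`, the squared spatial length `S` of `x` is at most `x₀²`. Cauchy-Schwarz then
  -- gives `x₀² p₀² ≤ S (p₀² - 1) ≤ x₀² p₀² - S`, so `S = 0`.
  have hsx : lorentz x x + x 0 * x 0 = 0 := by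
    nlinarith [sq_nonneg (x 0), sq_nonneg (p 0), mul_nonneg hs (sq_nonneg (p 0))]
  have hx00 : x 0 = 0 := by
    have : (x 0 * p 0) ^ 2 ≤ 0 := by rw [hsx] at hcs; nlinarith
    have h2 : x 0 * p 0 = 0 := by nlinarith [sq_nonneg (x 0 * p 0)]
    rcases mul_eq_zero.1 h2 with h | h
    · exact h
    · exfalso
      have := spatial_nonneg p
      rw [hp, h] at this
      linarith
  apply hx0
  have hsum : ∑ i : Fin (n + 1), x i.succ * x i.succ = 0 := by
    have := hsx
    simp only [lorentz] at this
    linarith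
  rw [Finset.sum_eq_zero_iff_of_nonneg fun i _ => mul_self_nonneg _] at hsum
  ext i
  refine Fin.cases hx00 (fun j => ?_) i
  simpa using hsum j (Finset.mem_univ j)

theorem lorentz_self_nonneg {p x : Ambient n} (hp : lorentz p p = -1) (hx : lorentz x p = 0) :
    0 ≤ lorentz x x := by
  by_cases h : x = 0
  · simp [h]
  · exact (lorentz_self_pos hp hx h).le

/-- Cauchy-Schwarz on the orthogonal complement of a unit timelike vector. -/
theorem lorentz_sq_le {p x y : Ambient n} (hp : lorentz p p = -1) (hx : lorentz x p = 0)
    (hy : lorentz y p = 0) : lorentz x y ^ 2 ≤ lorentz x x * lorentz y y := by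
  by_cases hy0 : y = 0
  · simp [hy0]
  have hyy := lorentz_self_pos hp hy hy0
  have h := lorentz_self_nonneg (x := lorentz y y • x - lorentz x y • y) hp (by simp [hx, hy])
  simp only [lorentz_sub_left, lorentz_sub_right, lorentz_smul_left, lorentz_smul_right,
    lorentz_comm y x] at h
  have : 0 ≤ lorentz y y * (lorentz x x * lorentz y y - lorentz x y ^ 2) := by nlinarith
  nlinarith [nonneg_of_mul_nonneg_right this hyy]

/-- A Lorentz-orthonormal frame: a timelike unit vector `Y`, a spacelike unit vector `N` and `n`
spacelike unit vectors. -/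
structure IsLorentzFrame (Y N : Ambient n) (e : Fin n → Ambient n) : Prop where
  timelike : lorentz Y Y = -1
  unit : lorentz N N = 1
  normal : lorentz N Y = 0
  tangent_left : ∀ i, lorentz (e i) Y = 0
  tangent_right : ∀ i, lorentz (e i) N = 0
  orthonormal : ∀ i j, lorentz (e i) (e j) = if i = j then 1 else 0

/-- Products with the frame vectors read off the coefficients of any combination of them. The `n +
2` vectors are therefore independent, hence a basis, and the same products give the coefficients of
`v`. -/
theorem IsLorentzFrame.eq_sum {Y N : Ambient n} {e : Fin n → Ambient n}
    (h : IsLorentzFrame Y N e) (v : Ambient n) :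
    v = -lorentz v Y • Y + lorentz v N • N + ∑ i, lorentz v (e i) • e i := by
  classical
  let b : Option (Option (Fin n)) → Ambient n := fun o => o.elim Y fun o => o.elim N e
  have hb : ∀ w : Ambient n, ∀ c : Option (Option (Fin n)) → ℝ, w = ∑ i, c i • b i →
      c none = -lorentz w Y ∧ c (some none) = lorentz w N ∧
        ∀ i, c (some (some i)) = lorentz w (e i) := by
    intro w c hw
    have hw' : w = c none • Y + (c (some none) • N + ∑ i, c (some (some i)) • e i) := by
      rw [hw, Fintype.sum_option, Fintype.sum_option]; rfl
    refine ⟨?_, ?_, fun j => ?_⟩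
    · rw [hw']
      simp [lorentz_sum_left, h.timelike, h.normal, h.tangent_left]
    · rw [hw']
      simp [lorentz_sum_left, h.unit, h.tangent_right, lorentz_comm Y N, h.normal]
    · rw [hw']
      simp [lorentz_sum_left, lorentz_comm Y (e j), lorentz_comm N (e j), h.tangent_right,
        h.tangent_left, h.orthonormal]
  have hli : LinearIndependent ℝ b := by
    rw [Fintype.linearIndependent_iff]
    intro c hc i
    obtain ⟨h1, h2, h3⟩ := hb 0 c hc.symm
    simp only [lorentz_zero_left, neg_zero] at h1 h2 h3
    rcases i with _ | _ | i
    exacts [h1, h2, h3 i]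
  let B := basisOfLinearIndependentOfCardEqFinrank hli (by simp)
  have hv : v = ∑ i, B.repr v i • b i := by
    conv_lhs => rw [← B.sum_repr v]
    simp [B]
  obtain ⟨h1, h2, h3⟩ := hb v _ hv
  conv_lhs => rw [hv, Fintype.sum_option, Fintype.sum_option]
  simp only [h1, h2, h3]
  rw [add_assoc]
  rfl

/-- Parseval's identity for a Lorentz-orthonormal frame. -/
theorem IsLorentzFrame.lorentz_eq {Y N : Ambient n} {e : Fin n → Ambient n}
    (h : IsLorentzFrame Y N e) (v w : Ambient n) :
    lorentz v w = -(lorentz v Y * lorentz w Y) + lorentz v N * lorentz w N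
      + ∑ i, lorentz v (e i) * lorentz w (e i) := by
  conv_lhs => rw [h.eq_sum w]
  simp only [lorentz_add_right, lorentz_smul_right, lorentz_sum_right]
  congr 1
  · ring
  · exact Finset.sum_congr rfl fun i _ => mul_comm _ _

end LorentzForm

/-! ## Directional derivatives of smooth functions on open sets -/

section DirectionalDerivative

variable {E F : Type*} [NormedAddCommGroup E] [NormedSpace ℝ E] [NormedAddCommGroup F]
  [NormedSpace ℝ F] {U : Set E}

/-- The derivative of `f` in the constant direction `v`. -/
def dd (v : E) (f : E → F) : E → F := fun p => fderiv ℝ f p v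

theorem contDiffOn_dd (hU : IsOpen U) {f : E → F} (hf : ContDiffOn ℝ ∞ f U) (v : E) :
    ContDiffOn ℝ ∞ (dd v f) U :=
  (hf.fderiv_of_isOpen hU (by simp)).clm_apply contDiffOn_const

theorem differentiableAt_of_smoothOn (hU : IsOpen U) {f : E → F} (hf : ContDiffOn ℝ ∞ f U) {p : E}
    (hp : p ∈ U) : DifferentiableAt ℝ f p :=
  (hf.contDiffAt (hU.mem_nhds hp)).differentiableAt (by simp)

theorem dd_congr (hU : IsOpen U) {f g : E → F} (h : EqOn f g U) (v : E) :
    EqOn (dd v f) (dd v g) U := fun p hp => by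
  have : f =ᶠ[𝓝 p] g := Filter.eventuallyEq_of_mem (hU.mem_nhds hp) h
  simp only [dd, this.fderiv_eq]

theorem dd_comm (hU : IsOpen U) {f : E → F} (hf : ContDiffOn ℝ ∞ f U) (v w : E) :
    EqOn (dd v (dd w f)) (dd w (dd v f)) U := fun p hp => by
  have hd : DifferentiableAt ℝ (fderiv ℝ f) p :=
    differentiableAt_of_smoothOn hU (hf.fderiv_of_isOpen hU (by simp)) hp
  have hs : IsSymmSndFDerivAt ℝ f p :=
    (hf.contDiffAt (hU.mem_nhds hp)).isSymmSndFDerivAt (by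
      simp only [minSmoothness_of_isRCLikeNormedField]; exact WithTop.coe_le_coe.2 le_top)
  have key : ∀ a b : E, dd a (dd b f) p = fderiv ℝ (fderiv ℝ f) p a b := fun a b => by
    change fderiv ℝ (fun q => fderiv ℝ f q b) p a = _
    rw [fderiv_clm_apply hd (differentiableAt_const b)]
    simp
  rw [key, key, hs.eq]

theorem dd_add {f g : E → F} {p : E} (hf : DifferentiableAt ℝ f p) (hg : DifferentiableAt ℝ g p)
    (v : E) : dd v (fun q => f q + g q) p = dd v f p + dd v g p := by
  simp only [dd, fderiv_fun_add hf hg, _root_.add_apply]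

theorem dd_sub {f g : E → F} {p : E} (hf : DifferentiableAt ℝ f p) (hg : DifferentiableAt ℝ g p)
    (v : E) : dd v (fun q => f q - g q) p = dd v f p - dd v g p := by
  simp only [dd, fderiv_fun_sub hf hg, _root_.sub_apply]

theorem dd_neg (f : E → F) (p v : E) : dd v (fun q => -f q) p = -dd v f p := by
  simp only [dd, fderiv_fun_neg, _root_.neg_apply]

theorem dd_const (c : F) (v p : E) : dd v (fun _ => c) p = 0 := by
  simp [dd]

theorem dd_mul {f g : E → ℝ} {p : E} (hf : DifferentiableAt ℝ f p) (hg : DifferentiableAt ℝ g p)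
    (v : E) : dd v (fun q => f q * g q) p = dd v f p * g p + f p * dd v g p := by
  simp only [dd, fderiv_fun_mul hf hg, _root_.add_apply,
    _root_.smul_apply, smul_eq_mul]
  ring

theorem dd_smul {f : E → ℝ} {g : E → F} {p : E} (hf : DifferentiableAt ℝ f p)
    (hg : DifferentiableAt ℝ g p) (v : E) :
    dd v (fun q => f q • g q) p = dd v f p • g p + f p • dd v g p := by
  simp only [dd, fderiv_fun_smul hf hg, _root_.add_apply,
    _root_.smul_apply, ContinuousLinearMap.smulRight_apply]
  rw [add_comm]

variable {n : ℕ}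

theorem dd_lorentz {f g : E → Ambient n} {p : E} (hf : DifferentiableAt ℝ f p)
    (hg : DifferentiableAt ℝ g p) (v : E) :
    dd v (fun q => lorentz (f q) (g q)) p = lorentz (dd v f p) (g p) + lorentz (f p) (dd v g p) := by
  have := ((lorentzL n).hasFDerivAt_of_bilinear hf.hasFDerivAt hg.hasFDerivAt).fderiv
  simp only [lorentzL_apply] at this
  simp only [dd, this]
  simp [ContinuousLinearMap.precompR, ContinuousLinearMap.precompL, lorentzL_apply, add_comm]

theorem contDiffOn_lorentz {f g : E → Ambient n} (hf : ContDiffOn ℝ ∞ f U)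
    (hg : ContDiffOn ℝ ∞ g U) : ContDiffOn ℝ ∞ (fun q => lorentz (f q) (g q)) U := by
  have := ((lorentzL n).isBoundedBilinearMap.contDiff (n := ∞)).comp_contDiffOn (hf.prodMk hg)
  simpa only [Function.comp_def, lorentzL_apply] using this

theorem dd_lorentz_on (hU : IsOpen U) {f g : E → Ambient n} (hf : ContDiffOn ℝ ∞ f U)
    (hg : ContDiffOn ℝ ∞ g U) (v : E) :
    EqOn (dd v (fun q => lorentz (f q) (g q)))
      (fun p => lorentz (dd v f p) (g p) + lorentz (f p) (dd v g p)) U := fun _ hp =>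
  dd_lorentz (differentiableAt_of_smoothOn hU hf hp) (differentiableAt_of_smoothOn hU hg hp) v

/-- The second directional derivative of a Lorentz product. -/
theorem dd_dd_lorentz (hU : IsOpen U) {f g : E → Ambient n} (hf : ContDiffOn ℝ ∞ f U)
    (hg : ContDiffOn ℝ ∞ g U) (v : E) {p : E} (hp : p ∈ U) :
    dd v (dd v (fun q => lorentz (f q) (g q))) p =
      lorentz (dd v (dd v f) p) (g p) + 2 * lorentz (dd v f p) (dd v g p)
        + lorentz (f p) (dd v (dd v g) p) := by
  have hf' := contDiffOn_dd hU hf v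
  have hg' := contDiffOn_dd hU hg v
  rw [dd_congr hU (dd_lorentz_on hU hf hg v) v hp,
    dd_add (differentiableAt_of_smoothOn hU (contDiffOn_lorentz hf' hg) hp)
      (differentiableAt_of_smoothOn hU (contDiffOn_lorentz hf hg') hp),
    dd_lorentz_on hU hf' hg v hp, dd_lorentz_on hU hf hg' v hp]
  ring

end DirectionalDerivative

/-! ## Pairs of dual hypersurfaces -/

section DualPair

variable {n : ℕ} {E : Type*} [NormedAddCommGroup E] [NormedSpace ℝ E]

/-- A smooth family of hypersurfaces `Y` of hyperbolic space with unit normals `N`, over an open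
set `U` of parameters `(t, z)`, moving with normal velocity `σ`. -/
structure IsNormalMotion (U : Set (ℝ × E)) (Y N : ℝ × E → Ambient n) (σ : ℝ × E → ℝ) : Prop where
  isOpen : IsOpen U
  smooth_left : ContDiffOn ℝ ∞ Y U
  smooth_right : ContDiffOn ℝ ∞ N U
  smooth_speed : ContDiffOn ℝ ∞ σ U
  timelike : ∀ p ∈ U, lorentz (Y p) (Y p) = -1
  unit : ∀ p ∈ U, lorentz (N p) (N p) = 1
  normal : ∀ p ∈ U, lorentz (N p) (Y p) = 0
  tangent : ∀ p ∈ U, ∀ v : E, lorentz (N p) (dd (0, v) Y p) = 0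
  evolution : ∀ p ∈ U, dd (1, 0) Y p = σ p • N p

variable {U : Set (ℝ × E)} {Y N : ℝ × E → Ambient n} {σ : ℝ × E → ℝ}

namespace IsNormalMotion

variable (H : IsNormalMotion U Y N σ)

include H

theorem lorentz_dd_left_self {p : ℝ × E} (hp : p ∈ U) (v : ℝ × E) :
    lorentz (dd v Y p) (Y p) = 0 := by
  have h := dd_congr H.isOpen (fun q hq => H.timelike q hq :
    EqOn (fun q => lorentz (Y q) (Y q)) (fun _ => -1) U) v hp
  rw [dd_lorentz_on H.isOpen H.smooth_left H.smooth_left v hp, dd_const] at h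
  simp only [lorentz_comm (Y p)] at h
  linarith

theorem lorentz_dd_right_self {p : ℝ × E} (hp : p ∈ U) (v : ℝ × E) :
    lorentz (dd v N p) (N p) = 0 := by
  have h := dd_congr H.isOpen (fun q hq => H.unit q hq :
    EqOn (fun q => lorentz (N q) (N q)) (fun _ => 1) U) v hp
  rw [dd_lorentz_on H.isOpen H.smooth_right H.smooth_right v hp, dd_const] at h
  simp only [lorentz_comm (N p)] at h
  linarith

theorem lorentz_dd_right_left {p : ℝ × E} (hp : p ∈ U) (v : ℝ × E) :
    lorentz (dd v N p) (Y p) = -lorentz (N p) (dd v Y p) := by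
  have h := dd_congr H.isOpen (fun q hq => H.normal q hq :
    EqOn (fun q => lorentz (N q) (Y q)) (fun _ => 0) U) v hp
  rw [dd_lorentz_on H.isOpen H.smooth_right H.smooth_left v hp, dd_const] at h
  linarith

/-- This is the duality: differentiating `⟨N, Y⟩ = 0` shows that `Y` is normal to the hypersurface
traced by `N`. Since `Y` is timelike, the third fundamental form is positive semidefinite. -/
theorem cotangent {p : ℝ × E} (hp : p ∈ U) (v : E) : lorentz (dd (0, v) N p) (Y p) = 0 := by
  rw [H.lorentz_dd_right_left hp, H.tangent p hp, neg_zero]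

theorem lorentz_dd_time {p : ℝ × E} (hp : p ∈ U) : lorentz (dd (1, 0) N p) (Y p) = -σ p := by
  rw [H.lorentz_dd_right_left hp, H.evolution p hp, lorentz_smul_right, H.unit p hp, mul_one]

theorem lorentz_dd_dd_right_left {p : ℝ × E} (hp : p ∈ U) (v : ℝ × E) (w : E) :
    lorentz (dd v (dd (0, w) N) p) (Y p) = -lorentz (dd (0, w) N p) (dd v Y p) := by
  have h := dd_congr H.isOpen (fun q hq => H.cotangent hq w :
    EqOn (fun q => lorentz (dd (0, w) N q) (Y q)) (fun _ => 0) U) v hp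
  rw [dd_lorentz_on H.isOpen (contDiffOn_dd H.isOpen H.smooth_right _) H.smooth_left v hp,
    dd_const] at h
  linarith

theorem lorentz_right_dd_dd_left {p : ℝ × E} (hp : p ∈ U) (v : ℝ × E) (w : E) :
    lorentz (N p) (dd v (dd (0, w) Y) p) = -lorentz (dd v N p) (dd (0, w) Y p) := by
  have h := dd_congr H.isOpen (fun q hq => H.tangent q hq w :
    EqOn (fun q => lorentz (N q) (dd (0, w) Y q)) (fun _ => 0) U) v hp
  rw [dd_lorentz_on H.isOpen H.smooth_right (contDiffOn_dd H.isOpen H.smooth_left _) v hp,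
    dd_const] at h
  linarith

theorem lorentz_dd_dd_left_left {p : ℝ × E} (hp : p ∈ U) (v w : ℝ × E) :
    lorentz (dd v (dd w Y) p) (Y p) = -lorentz (dd w Y p) (dd v Y p) := by
  have h := dd_congr H.isOpen (fun q hq => H.lorentz_dd_left_self hq w :
    EqOn (fun q => lorentz (dd w Y q) (Y q)) (fun _ => 0) U) v hp
  rw [dd_lorentz_on H.isOpen (contDiffOn_dd H.isOpen H.smooth_left _) H.smooth_left v hp,
    dd_const] at h
  linarith

theorem lorentz_dd_dd_right_right {p : ℝ × E} (hp : p ∈ U) (v w : ℝ × E) :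
    lorentz (dd v (dd w N) p) (N p) = -lorentz (dd w N p) (dd v N p) := by
  have h := dd_congr H.isOpen (fun q hq => H.lorentz_dd_right_self hq w :
    EqOn (fun q => lorentz (dd w N q) (N q)) (fun _ => 0) U) v hp
  rw [dd_lorentz_on H.isOpen (contDiffOn_dd H.isOpen H.smooth_right _) H.smooth_right v hp,
    dd_const] at h
  linarith

/-- The second fundamental form is symmetric. -/
theorem second_form_symm {p : ℝ × E} (hp : p ∈ U) (v w : E) :
    lorentz (dd (0, v) N p) (dd (0, w) Y p) = lorentz (dd (0, w) N p) (dd (0, v) Y p) := by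
  have h1 := H.lorentz_dd_dd_right_left hp (0, v) w
  have h2 := H.lorentz_dd_dd_right_left hp (0, w) v
  rw [dd_comm H.isOpen H.smooth_right _ _ hp, h2] at h1
  linarith

/-- The commutator formula for second derivatives of the second fundamental form, in coordinates
in which the third fundamental form is Euclidean to first order. -/
theorem simons_identity {p : ℝ × E} (hp : p ∈ U) {v w : E} {a b : ℝ}
    (hv : dd (0, v) Y p = a • dd (0, v) N p) (hw : dd (0, w) Y p = b • dd (0, w) N p)
    (hv1 : lorentz (dd (0, v) N p) (dd (0, v) N p) = 1)
    (hw1 : lorentz (dd (0, w) N p) (dd (0, w) N p) = 1)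
    (hvv : dd (0, v) (dd (0, v) N) p = -N p + a • Y p)
    (hww : dd (0, w) (dd (0, w) N) p = -N p + b • Y p)
    (hvw : dd (0, v) (dd (0, w) N) p = 0) :
    dd (0, v) (dd (0, v) fun q => lorentz (dd (0, w) N q) (dd (0, w) Y q)) p
      - b * dd (0, v) (dd (0, v) fun q => lorentz (dd (0, w) N q) (dd (0, w) N q)) p
    = dd (0, w) (dd (0, w) fun q => lorentz (dd (0, v) N q) (dd (0, v) Y q)) p
      - a * dd (0, w) (dd (0, w) fun q => lorentz (dd (0, v) N q) (dd (0, v) N q)) p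
      + (a - b) * (a * b - 1) := by
  have hU := H.isOpen
  have hN := H.smooth_right
  have hY := H.smooth_left
  have hNd := fun u => contDiffOn_dd hU hN u
  have hNdd := fun u u' => contDiffOn_dd hU (hNd u) u'
  -- Writing the second form as `-⟨∂∂N, Y⟩` moves the highest derivatives onto `N`, where coordinate
  -- derivatives commute.
  have form : ∀ u : E, EqOn (fun q => lorentz (dd (0, u) N q) (dd (0, u) Y q))
      (fun q => -lorentz (dd (0, u) (dd (0, u) N) q) (Y q)) U := fun u q hq => by
    simp only [H.lorentz_dd_dd_right_left hq, neg_neg]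
  have form2 : ∀ u u' : E,
      dd (0, u) (dd (0, u) fun q => lorentz (dd (0, u') N q) (dd (0, u') Y q)) p =
      -(lorentz (dd (0, u) (dd (0, u) (dd (0, u') (dd (0, u') N))) p) (Y p)
        + 2 * lorentz (dd (0, u) (dd (0, u') (dd (0, u') N)) p) (dd (0, u) Y p)
        + lorentz (dd (0, u') (dd (0, u') N) p) (dd (0, u) (dd (0, u) Y) p)) := fun u u' => by
    rw [dd_congr hU (dd_congr hU (form u') (0, u)) (0, u) hp]
    have : dd (0, u) (fun q => -lorentz (dd (0, u') (dd (0, u') N) q) (Y q))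
        = fun q => -dd (0, u) (fun q => lorentz (dd (0, u') (dd (0, u') N) q) (Y q)) q := by
      funext q; exact dd_neg _ _ _
    rw [this, dd_neg, dd_dd_lorentz hU (hNdd _ _) hY _ hp]
  rw [form2 v w, form2 w v, dd_dd_lorentz hU (hNd _) (hNd _) _ hp,
    dd_dd_lorentz hU (hNd _) (hNd _) _ hp]
  have hwv : dd (0, w) (dd (0, v) N) p = 0 := by rw [dd_comm hU hN _ _ hp, hvw]
  -- The fourth-order terms of the two sides agree by `c3`. Since `∂_v Y = a ∂_v N` and `∂_w Y = b
  -- ∂_w N`, the third-order terms from the second form on one side match those from the third form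
  -- on the other. What remains is `-⟨∂_w∂_w N, ∂_v∂_v Y⟩ = a(ab - 1)` against `b(ab - 1)`.
  have c1 : dd (0, v) (dd (0, w) (dd (0, w) N)) p = dd (0, w) (dd (0, w) (dd (0, v) N)) p := by
    rw [dd_comm hU (hNd (0, w)) _ _ hp]
    exact dd_congr hU (dd_comm hU hN (0, v) (0, w)) _ hp
  have c2 : dd (0, w) (dd (0, v) (dd (0, v) N)) p = dd (0, v) (dd (0, v) (dd (0, w) N)) p := by
    rw [dd_comm hU (hNd (0, v)) _ _ hp]
    exact dd_congr hU (dd_comm hU hN (0, w) (0, v)) _ hp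
  have c3 : dd (0, v) (dd (0, v) (dd (0, w) (dd (0, w) N))) p
      = dd (0, w) (dd (0, w) (dd (0, v) (dd (0, v) N))) p := by
    have e1 : EqOn (dd (0, v) (dd (0, w) (dd (0, w) N))) (dd (0, w) (dd (0, w) (dd (0, v) N))) U :=
      fun q hq => by
        rw [dd_comm hU (hNd (0, w)) _ _ hq]
        exact dd_congr hU (dd_comm hU hN (0, v) (0, w)) _ hq
    rw [dd_congr hU e1 (0, v) hp, dd_comm hU (hNdd _ _) _ _ hp]
    exact dd_congr hU (dd_comm hU (hNd (0, v)) (0, v) (0, w)) _ hp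
  have e1 := H.lorentz_right_dd_dd_left hp (0, v) v
  have e2 := H.lorentz_dd_dd_left_left hp (0, v) (0, v)
  have e5 := H.lorentz_right_dd_dd_left hp (0, w) w
  have e6 := H.lorentz_dd_dd_left_left hp (0, w) (0, w)
  rw [lorentz_comm _ (Y p)] at e2 e6
  rw [c1, c2, c3, hvw, hwv, hww, hvv]
  simp only [hv, hw, lorentz_smul_left, lorentz_smul_right, hv1, hw1, mul_one, lorentz_add_left,
    lorentz_neg_left, lorentz_zero_right] at e1 e2 e5 e6 ⊢
  rw [e1, e2, e5, e6, lorentz_comm (dd (0, w) N p), lorentz_comm (dd (0, v) N p)]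
  ring

/-- The evolution of the second fundamental form against the third, in coordinates in which the
third fundamental form is Euclidean to first order. -/
theorem evolution_identity {p : ℝ × E} (hp : p ∈ U) {e : Fin n → E} {lam : Fin n → ℝ}
    (hpos : ∀ i, 0 < lam i)
    (hort : ∀ i j, lorentz (dd (0, e i) N p) (dd (0, e j) N p) = if i = j then 1 else 0)
    (heig : ∀ i, dd (0, e i) Y p = lam i • dd (0, e i) N p)
    (hnor : ∀ i j, dd (0, e i) (dd (0, e j) N) p = if i = j then -N p + lam i • Y p else 0)
    (i : Fin n) :
    dd (1, 0) (fun q => lorentz (dd (0, e i) N q) (dd (0, e i) Y q)) p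
      - lam i * dd (1, 0) (fun q => lorentz (dd (0, e i) N q) (dd (0, e i) N q)) p
    = dd (0, e i) (dd (0, e i) σ) p + σ p * (1 - lam i ^ 2)
      - ∑ j, dd (0, e j) (fun q => lorentz (dd (0, e i) N q) (dd (0, e i) Y q)) p
          * dd (0, e j) σ p / lam j := by
  have hU := H.isOpen
  have hN := H.smooth_right
  have hY := H.smooth_left
  have hs := H.smooth_speed
  have hNd := fun u => contDiffOn_dd hU hN u
  have hYd := fun u => contDiffOn_dd hU hY u
  have frame : IsLorentzFrame (Y p) (N p) fun j => dd (0, e j) N p :=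
    ⟨H.timelike p hp, H.unit p hp, H.normal p hp, fun j => H.cotangent hp _,
      fun j => H.lorentz_dd_right_self hp _, hort⟩
  -- Differentiating `⟨∂ₜN, Y⟩ = -σ` in space determines the tangential part of `∂ₜN`: minus the
  -- gradient of `σ` taken with respect to the second form.
  have f1 : ∀ v : E, ∀ q ∈ U, lorentz (dd (1, 0) N q) (dd (0, v) Y q) = -dd (0, v) σ q := by
    intro v q hq
    have h1 := dd_congr hU (fun q hq => H.lorentz_dd_time hq :
      EqOn (fun q => lorentz (dd (1, 0) N q) (Y q)) (fun q => -σ q) U) (0, v) hq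
    have h2 := H.lorentz_dd_dd_right_left hq (1, 0) v
    rw [dd_lorentz_on hU (hNd _) hY _ hq, dd_neg] at h1
    simp only [dd_comm hU hN (0, v) (1, 0) hq] at h1
    rw [H.evolution q hq, lorentz_smul_right, H.lorentz_dd_right_self hq] at h2
    linarith
  have f2 := dd_congr hU (fun q hq => f1 (e i) q hq :
    EqOn (fun q => lorentz (dd (1, 0) N q) (dd (0, e i) Y q)) (fun q => -dd (0, e i) σ q) U)
    (0, e i) hp
  rw [dd_lorentz_on hU (hNd _) (hYd _) _ hp, dd_neg] at f2
  simp only at f2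
  rw [dd_comm hU hN (0, e i) (1, 0) hp, frame.lorentz_eq (dd (1, 0) N p)] at f2
  -- Codazzi symmetry: both sides equal `-⟨∂_i∂_i∂_j N, Y⟩`, because the second derivatives of `N`
  -- have no tangential part at `p`.
  have f3 : ∀ j, lorentz (dd (0, e i) (dd (0, e i) Y) p) (dd (0, e j) N p)
      = dd (0, e j) (fun q => lorentz (dd (0, e i) N q) (dd (0, e i) Y q)) p := by
    intro j
    have tan : ∀ k l m, lorentz (dd (0, e k) (dd (0, e l) N) p) (dd (0, e m) N p) = 0 := by
      intro k l m
      rw [hnor]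
      split_ifs
      · simp [lorentz_comm (N p), lorentz_comm (Y p), H.lorentz_dd_right_self hp,
          H.cotangent hp]
      · simp
    have g1 := dd_congr hU (fun q hq => H.lorentz_dd_dd_right_left hq (0, e i) (e j) :
      EqOn (fun q => lorentz (dd (0, e i) (dd (0, e j) N) q) (Y q))
        (fun q => -lorentz (dd (0, e j) N q) (dd (0, e i) Y q)) U) (0, e i) hp
    rw [dd_neg, dd_lorentz_on hU (contDiffOn_dd hU (hNd _) _) hY _ hp,
      dd_lorentz_on hU (hNd _) (hYd _) _ hp] at g1
    have g2 := dd_congr hU (fun q hq => H.lorentz_dd_dd_right_left hq (0, e i) (e i) :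
      EqOn (fun q => lorentz (dd (0, e i) (dd (0, e i) N) q) (Y q))
        (fun q => -lorentz (dd (0, e i) N q) (dd (0, e i) Y q)) U) (0, e j) hp
    rw [dd_neg, dd_lorentz_on hU (contDiffOn_dd hU (hNd _) _) hY _ hp] at g2
    have g3 : dd (0, e i) (dd (0, e i) (dd (0, e j) N)) p
        = dd (0, e j) (dd (0, e i) (dd (0, e i) N)) p := by
      rw [← dd_comm hU (hNd (0, e i)) _ _ hp]
      exact dd_congr hU (dd_comm hU hN (0, e i) (0, e j)) _ hp
    simp only [heig, lorentz_smul_right, tan, g3] at g1 g2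
    rw [lorentz_comm]
    linarith
  have f4 : ∀ j, lorentz (dd (1, 0) N p) (dd (0, e j) N p) = -dd (0, e j) σ p / lam j := by
    intro j
    have := f1 (e j) p hp
    rw [heig j, lorentz_smul_right] at this
    rw [← this]
    field_simp [(hpos j).ne']
  have f5 := H.lorentz_right_dd_dd_left hp (0, e i) (e i)
  have f6 := H.lorentz_dd_dd_left_left hp (0, e i) (0, e i)
  have f7 : dd (0, e i) (dd (1, 0) Y) p = dd (0, e i) σ p • N p + σ p • dd (0, e i) N p := by
    rw [dd_congr hU (fun q hq => H.evolution q hq :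
      EqOn (dd (1, 0) Y) (fun q => σ q • N q) U) _ hp]
    exact dd_smul (differentiableAt_of_smoothOn hU hs hp) (differentiableAt_of_smoothOn hU hN hp) _
  rw [dd_lorentz_on hU (hNd _) (hYd _) _ hp, dd_lorentz_on hU (hNd _) (hNd _) _ hp]
  simp only
  rw [dd_comm hU hY (1, 0) (0, e i) hp, f7]
  simp only [f3, f4, H.lorentz_dd_time hp, H.lorentz_dd_right_self hp] at f2
  have hii := hort i i
  simp only [if_true] at hii
  rw [lorentz_comm _ (N p), f5, f6, heig i] at f2
  rw [lorentz_comm (dd (0, e i) N p) (dd (1, 0) (dd (0, e i) N) p), heig i]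
  simp only [lorentz_add_right, lorentz_smul_right, lorentz_smul_left, hii,
    H.lorentz_dd_right_self hp] at f2 ⊢
  have hsum : ∑ j, dd (0, e j) (fun q => lorentz (dd (0, e i) N q) (dd (0, e i) Y q)) p
          * dd (0, e j) σ p / lam j = -∑ j, -dd (0, e j) σ p / lam j *
        dd (0, e j) (fun q => lorentz (dd (0, e i) N q) (dd (0, e i) Y q)) p := by
    rw [← Finset.sum_neg_distrib]
    exact Finset.sum_congr rfl fun j _ => by ring
  rw [hsum]
  linarith

end IsNormalMotion

end DualPair

/-! ## Symmetric concave functions of eigenvalues -/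

section Spectral

open Matrix

variable {n : ℕ}

theorem exists_orthogonal_diagonalization {A : Matrix (Fin n) (Fin n) ℝ} (hA : Aᵀ = A) :
    ∃ (U : Matrix (Fin n) (Fin n) ℝ) (d : Fin n → ℝ),
      Uᵀ * U = 1 ∧ U * Uᵀ = 1 ∧ A = U * diagonal d * Uᵀ := by
  have hH : A.IsHermitian := by rwa [IsHermitian, conjTranspose_eq_transpose_of_trivial]
  refine ⟨hH.eigenvectorUnitary, hH.eigenvalues, ?_, ?_, ?_⟩
  · have := Unitary.coe_star_mul_self hH.eigenvectorUnitary
    rwa [star_eq_conjTranspose, conjTranspose_eq_transpose_of_trivial] at this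
  · have := Unitary.coe_mul_star_self hH.eigenvectorUnitary
    rwa [Unitary.coe_star, star_eq_conjTranspose, conjTranspose_eq_transpose_of_trivial] at this
  · conv_lhs => rw [hH.spectral_theorem]
    rw [Unitary.conjStarAlgAut_apply, star_eq_conjTranspose, conjTranspose_eq_transpose_of_trivial]
    rfl

theorem entry_transpose_mul_mul (S h : Matrix (Fin n) (Fin n) ℝ) (i j : Fin n) :
    (Sᵀ * h * S) i j = (fun k => S k i) ⬝ᵥ h *ᵥ (fun k => S k j) := by
  rw [Matrix.mul_assoc, Matrix.mul_apply]
  simp only [transpose_apply, dotProduct, mulVec, Matrix.mul_apply]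

theorem col_ne_zero {S T : Matrix (Fin n) (Fin n) ℝ} (h : T * S = 1) (j : Fin n) :
    (fun k => S k j) ≠ 0 := by
  intro h0
  have := congrFun (congrFun h j) j
  rw [Matrix.mul_apply, one_apply_eq] at this
  simp only [fun k => congrFun h0 k, Pi.zero_apply, mul_zero, Finset.sum_const_zero] at this
  exact zero_ne_one this

/-- A positive definite matrix `g` has a symmetric inverse square root, which is close to the
identity if `g` is. -/
theorem exists_inverse_sqrt {g : Matrix (Fin n) (Fin n) ℝ} (hg : gᵀ = g)
    (hpos : ∀ x, x ≠ 0 → 0 < x ⬝ᵥ g *ᵥ x) :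
    ∃ R : Matrix (Fin n) (Fin n) ℝ, Rᵀ = R ∧ R * g * R = 1 ∧
      ∀ ε, (∀ i j, |g i j - (1 : Matrix (Fin n) (Fin n) ℝ) i j| ≤ ε) → n * ε ≤ 1 / 2 →
        ∀ i j, |R i j - (1 : Matrix (Fin n) (Fin n) ℝ) i j| ≤ 2 * n * n * ε := by
  obtain ⟨U, d, h1, h2, h3⟩ := exists_orthogonal_diagonalization hg
  have hd : ∀ j, d j = (fun k => U k j) ⬝ᵥ g *ᵥ (fun k => U k j) := fun j => by
    rw [← entry_transpose_mul_mul, h3]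
    have : Uᵀ * (U * diagonal d * Uᵀ) * U = (Uᵀ * U) * diagonal d * (Uᵀ * U) := by
      simp only [Matrix.mul_assoc]
    rw [this, h1]
    simp
  have hdpos : ∀ j, 0 < d j := fun j => by rw [hd]; exact hpos _ (col_ne_zero h1 j)
  -- `R = U d^(-1/2) Uᵀ`.
  refine ⟨U * diagonal (fun j => (√(d j))⁻¹) * Uᵀ, ?_, ?_, ?_⟩
  · simp [Matrix.transpose_mul, Matrix.mul_assoc]
  · conv_lhs => rw [h3]
    have : U * diagonal (fun j => (√(d j))⁻¹) * Uᵀ * (U * diagonal d * Uᵀ)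
        * (U * diagonal (fun j => (√(d j))⁻¹) * Uᵀ) = U * diagonal (fun j => (√(d j))⁻¹) * (Uᵀ * U)
        * diagonal d * (Uᵀ * U) * diagonal (fun j => (√(d j))⁻¹) * Uᵀ := by
      simp only [Matrix.mul_assoc]
    rw [this, h1, Matrix.mul_one, Matrix.mul_one, Matrix.mul_assoc U, Matrix.mul_assoc U,
      diagonal_mul_diagonal, diagonal_mul_diagonal]
    have : (fun i => (√(d i))⁻¹ * d i * (√(d i))⁻¹) = fun _ => 1 := by
      funext i
      have := Real.sqrt_pos.2 (hdpos i)
      field_simp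
      rw [Real.sq_sqrt (hdpos i).le]
    rw [this, diagonal_one, Matrix.mul_one, h2]
  · intro ε hε hn i j
    have hcol : ∀ j, ∑ k, U k j ^ 2 = 1 := fun j => by
      have := congrFun (congrFun h1 j) j
      rw [Matrix.mul_apply, one_apply_eq] at this
      simpa [sq] using this
    have hrow : ∀ i, ∑ k, U i k ^ 2 = 1 := fun i => by
      have := congrFun (congrFun h2 i) i
      rw [Matrix.mul_apply, one_apply_eq] at this
      simpa [sq] using this
    have hle : ∀ i j, |U i j| ≤ 1 := fun i j => by
      rw [← sq_le_one_iff_abs_le_one, ← hrow i]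
      exact Finset.single_le_sum (f := fun k => U i k ^ 2) (fun k _ => sq_nonneg _)
        (Finset.mem_univ j)
    have hε0 : 0 ≤ ε := (abs_nonneg _).trans (hε i j)
    -- `d_j - 1` is the quadratic form of `g - 1` on the unit column `U_j`. The factor `n` comes
    -- from `(∑ |U_kj|)² ≤ n ∑ U_kj²`.
    have hd1 : ∀ j, |d j - 1| ≤ n * ε := fun j => by
      have e1 : d j - 1 = ∑ k, ∑ l, U k j * (g k l - (1 : Matrix (Fin n) (Fin n) ℝ) k l)
          * U l j := by
        have : (1 : ℝ) = ∑ k, ∑ l, U k j * (1 : Matrix (Fin n) (Fin n) ℝ) k l * U l j := by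
          rw [← hcol j]
          refine Finset.sum_congr rfl fun k _ => ?_
          simp [one_apply, sq]
        have hd' : d j = ∑ k, U k j * ∑ l, g k l * U l j := hd j
        rw [hd', this, ← Finset.sum_sub_distrib]
        refine Finset.sum_congr rfl fun k _ => ?_
        rw [Finset.mul_sum, ← Finset.sum_sub_distrib]
        exact Finset.sum_congr rfl fun l _ => by ring
      rw [e1]
      calc |∑ k, ∑ l, U k j * (g k l - (1 : Matrix (Fin n) (Fin n) ℝ) k l) * U l j|
          ≤ ∑ k, ∑ l, |U k j| * ε * |U l j| := by
            refine (Finset.abs_sum_le_sum_abs _ _).trans (Finset.sum_le_sum fun k _ => ?_)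
            refine (Finset.abs_sum_le_sum_abs _ _).trans (Finset.sum_le_sum fun l _ => ?_)
            rw [abs_mul, abs_mul]
            gcongr
            exact hε k l
        _ = ε * (∑ k, |U k j|) ^ 2 := by
            rw [sq, Finset.sum_mul_sum, Finset.mul_sum]
            refine Finset.sum_congr rfl fun k _ => ?_
            rw [Finset.mul_sum]
            exact Finset.sum_congr rfl fun l _ => by ring
        _ ≤ ε * n := by
            gcongr
            have := sq_sum_le_card_mul_sum_sq (s := Finset.univ) (f := fun k => |U k j|)
            simpa [hcol] using this
        _ = n * ε := mul_comm _ _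
    -- Since `d ≥ 1/2`, the denominator in `1/√d - 1 = -(d - 1)/(√d (1 + √d))` is at least `1/2 ·
    -- 3/2`, so the factor `2` is ample.
    have hr : ∀ j, |(√(d j))⁻¹ - 1| ≤ 2 * (n * ε) := fun j => by
      have h4 := hd1 j
      have hlow : 1 / 2 ≤ d j := by have := (abs_le.1 h4).1; linarith
      have hs : 0 < √(d j) := Real.sqrt_pos.2 (hdpos j)
      have hs2 : 1 / 2 ≤ √(d j) := by
        apply Real.le_sqrt_of_sq_le; linarith
      have hsq := Real.sq_sqrt (hdpos j).le
      have : |(√(d j))⁻¹ - 1| = |d j - 1| / (√(d j) * (1 + √(d j))) := by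
        have e : (√(d j))⁻¹ - 1 = -(d j - 1) / (√(d j) * (1 + √(d j))) := by
          have e2 : d j - 1 = (√(d j) - 1) * (√(d j) + 1) := by nlinarith
          rw [e2]
          field_simp
          ring
        rw [e, abs_div, abs_neg, abs_of_pos (a := √(d j) * (1 + √(d j))) (by positivity)]
      rw [this, div_le_iff₀ (by positivity)]
      nlinarith [abs_nonneg (d j - 1), mul_nonneg (Nat.cast_nonneg (α := ℝ) n) hε0]
    have e2 : (U * diagonal (fun j => (√(d j))⁻¹) * Uᵀ) i j - (1 : Matrix (Fin n) (Fin n) ℝ) i j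
        = ∑ k, U i k * ((√(d k))⁻¹ - 1) * U j k := by
      rw [← h2, Matrix.mul_apply, Matrix.mul_apply, ← Finset.sum_sub_distrib]
      refine Finset.sum_congr rfl fun k _ => ?_
      rw [mul_diagonal, transpose_apply]
      ring
    rw [e2]
    calc |∑ k, U i k * ((√(d k))⁻¹ - 1) * U j k| ≤ ∑ k : Fin n, 1 * (2 * (n * ε)) * 1 := by
          refine (Finset.abs_sum_le_sum_abs _ _).trans (Finset.sum_le_sum fun k _ => ?_)
          rw [abs_mul, abs_mul]
          gcongr
          · exact hle i k
          · exact hr k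
          · exact hle j k
      _ = 2 * n * n * ε := by simp; ring

/-- Simultaneous diagonalization of a symmetric matrix and a positive definite one. -/
theorem exists_simultaneous_diagonalization {g h : Matrix (Fin n) (Fin n) ℝ} (hg : gᵀ = g)
    (hpos : ∀ x, x ≠ 0 → 0 < x ⬝ᵥ g *ᵥ x) (hh : hᵀ = h) :
    ∃ (S : Matrix (Fin n) (Fin n) ℝ) (d : Fin n → ℝ), Sᵀ * g * S = 1 ∧ Sᵀ * h * S = diagonal d := by
  obtain ⟨R, hR, hR1, -⟩ := exists_inverse_sqrt hg hpos
  obtain ⟨U, d, h1, h2, h3⟩ := exists_orthogonal_diagonalization (A := R * h * R)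
    (by simp [Matrix.transpose_mul, hR, hh, Matrix.mul_assoc])
  refine ⟨R * U, d, ?_, ?_⟩
  · have : (R * U)ᵀ * g * (R * U) = Uᵀ * (R * g * R) * U := by
      simp only [Matrix.transpose_mul, hR, Matrix.mul_assoc]
    rw [this, hR1, Matrix.mul_one, h1]
  · have : (R * U)ᵀ * h * (R * U) = Uᵀ * (R * h * R) * U := by
      simp only [Matrix.transpose_mul, hR, Matrix.mul_assoc]
    rw [this, h3]
    have : Uᵀ * (U * diagonal d * Uᵀ) * U = (Uᵀ * U) * diagonal d * (Uᵀ * U) := by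
      simp only [Matrix.mul_assoc]
    rw [this, h1]
    simp

end Spectral

/-! ### Concavity on eigenvalues: doubly stochastic averaging and a second order upper bound. -/

section ConcaveSymmetric

open Matrix

variable {n : ℕ}

/-- A differentiable concave function lies below its tangent planes. -/
theorem concaveOn_le_tangent {E : Type*} [NormedAddCommGroup E] [NormedSpace ℝ E] {s : Set E}
    {φ : E → ℝ} (hφ : ConcaveOn ℝ s φ) {x y : E} (hx : x ∈ s) (hy : y ∈ s) {φ' : E →L[ℝ] ℝ}
    (hd : HasFDerivAt φ φ' x) : φ y ≤ φ x + φ' (y - x) := by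
  have hline : HasDerivAt (fun t : ℝ => φ (x + t • (y - x))) (φ' (y - x)) 0 := by
    have h1 : HasDerivAt (fun t : ℝ => x + t • (y - x)) (y - x) 0 := by
      simpa using ((hasDerivAt_id (0 : ℝ)).smul_const (y - x)).const_add x
    have h2 : HasFDerivAt φ φ' (x + (0 : ℝ) • (y - x)) := by simpa using hd
    exact h2.comp_hasDerivAt 0 h1
  have hslope := hline.tendsto_slope_zero_right
  refine sub_le_iff_le_add'.1 (ge_of_tendsto hslope ?_)
  have : Ioo (0 : ℝ) 1 ∈ 𝓝[>] (0 : ℝ) := Ioo_mem_nhdsGT one_pos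
  filter_upwards [this] with t ht
  have hc := hφ.2 hx hy (sub_nonneg.2 ht.2.le) ht.1.le (by ring)
  have he : (1 - t) • x + t • y = x + t • (y - x) := by module
  rw [he] at hc
  simp only [smul_eq_mul, zero_add, zero_smul, add_zero] at hc ⊢
  rw [inv_mul_eq_div, le_div_iff₀ ht.1]
  linarith

/-- A symmetric concave function does not decrease under doubly stochastic averaging. -/
theorem le_of_doublyStochastic {φ : (Fin n → ℝ) → ℝ} (hφ : ConcaveOn ℝ (positiveCone n) φ)
    (hsymm : ∀ (σ : Equiv.Perm (Fin n)), ∀ x ∈ positiveCone n, φ (x ∘ σ) = φ x)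
    {D : Matrix (Fin n) (Fin n) ℝ} (hD : D ∈ doublyStochastic ℝ (Fin n)) {μ : Fin n → ℝ}
    (hμ : μ ∈ positiveCone n) : φ μ ≤ φ (D *ᵥ μ) := by
  -- Birkhoff's theorem: the inequality holds with equality for permutation matrices by symmetry,
  -- and by concavity the matrices satisfying it form a convex set.
  have hsub : convexHull ℝ {σ.permMatrix ℝ | σ : Equiv.Perm (Fin n)} ⊆
      {D | D *ᵥ μ ∈ positiveCone n ∧ φ μ ≤ φ (D *ᵥ μ)} := by
    refine convexHull_min ?_ ?_
    · rintro _ ⟨σ, rfl⟩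
      have : σ.permMatrix ℝ *ᵥ μ = μ ∘ σ := by
        funext i
        simp [Equiv.Perm.permMatrix, PEquiv.toMatrix_toPEquiv_mulVec]
      simp only [mem_ofPred_eq, this]
      exact ⟨fun i => hμ _, (hsymm σ μ hμ).ge⟩
    · intro A hA B hB a b ha hb hab
      have e : (a • A + b • B) *ᵥ μ = a • A *ᵥ μ + b • B *ᵥ μ := by
        rw [Matrix.add_mulVec, Matrix.smul_mulVec, Matrix.smul_mulVec]
      simp only [mem_ofPred_eq, e]
      refine ⟨hφ.1 hA.1 hB.1 ha hb hab, ?_⟩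
      refine le_trans ?_ (hφ.2 hA.1 hB.1 ha hb hab)
      simp only [smul_eq_mul]
      have h1 := mul_le_mul_of_nonneg_left hA.2 ha
      have h2 := mul_le_mul_of_nonneg_left hB.2 hb
      calc φ μ = a * φ μ + b * φ μ := by rw [← add_mul, hab, one_mul]
        _ ≤ _ := add_le_add h1 h2
  rw [← SetLike.mem_coe, doublyStochastic_eq_convexHull_permMatrix] at hD
  exact (hsub hD).2

theorem abs_mul_entry_le {A B : Matrix (Fin n) (Fin n) ℝ} {a b : ℝ} (hA : ∀ i j, |A i j| ≤ a)
    (hB : ∀ i j, |B i j| ≤ b) (i j : Fin n) : |(A * B) i j| ≤ n * a * b := by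
  have ha : 0 ≤ a := (abs_nonneg _).trans (hA i j)
  rw [Matrix.mul_apply]
  calc |∑ k, A i k * B k j| ≤ ∑ k : Fin n, a * b := by
        refine (Finset.abs_sum_le_sum_abs _ _).trans (Finset.sum_le_sum fun k _ => ?_)
        rw [abs_mul]
        exact mul_le_mul (hA _ _) (hB _ _) (abs_nonneg _) ha
    _ = n * a * b := by simp; ring

/-- First order expansion of the diagonal of `R * h * R`, where `R * g * R = 1`. -/
theorem abs_conjugate_entry_sub_le {R g h : Matrix (Fin n) (Fin n) ℝ} {lam : Fin n → ℝ}
    {Λ A C s : ℝ} (hlam : ∀ i, 0 ≤ lam i) (hΛ : ∀ i, lam i ≤ Λ) (hA : 0 ≤ A) (hC : 0 ≤ C)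
    (hR : R * g * R = 1) (hZ : ∀ i j, |(R - 1) i j| ≤ C * |s| ^ 2) (hs1 : |s| ≤ 1)
    (hg : ∀ i j, |g i j - (1 : Matrix (Fin n) (Fin n) ℝ) i j| ≤ A * |s| ^ 2)
    (hh : ∀ i j, |h i j - diagonal lam i j| ≤ A * |s|) (k : Fin n) :
    |(R * h * R) k k - lam k - (h k k - lam k * g k k)| ≤
      (2 * (n * C * A) + n * (n * C * (Λ + A)) * C
        + Λ * (2 * (n * C * A) + n * (n * C * (1 + A)) * C)) * |s| ^ 3 := by
  have hΛ0 : 0 ≤ Λ := (hlam k).trans (hΛ k)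
  have hs0 := abs_nonneg s
  obtain ⟨Z, hRZ⟩ : ∃ Z, R = 1 + Z := ⟨R - 1, by abel⟩
  obtain ⟨γ, hγ⟩ : ∃ γ, g = 1 + γ := ⟨g - 1, by abel⟩
  obtain ⟨χ, hχ⟩ : ∃ χ, h = diagonal lam + χ := ⟨h - diagonal lam, by abel⟩
  have hZ' : ∀ i j, |Z i j| ≤ C * |s| ^ 2 := fun i j => by simpa [hRZ] using hZ i j
  have hγA : ∀ i j, |γ i j| ≤ A * |s| ^ 2 := fun i j => by simpa [hγ] using hg i j
  have hχA : ∀ i j, |χ i j| ≤ A * |s| := fun i j => by simpa [hχ] using hh i j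
  have hgA' : ∀ i j, |g i j| ≤ 1 + A := fun i j => by
    have h4 : |(1 : Matrix (Fin n) (Fin n) ℝ) i j| ≤ 1 := by
      rw [one_apply]; split_ifs <;> simp
    rw [hγ, Matrix.add_apply]
    refine (abs_add_le _ _).trans (add_le_add h4 ((hγA i j).trans ?_))
    exact mul_le_of_le_one_right hA (pow_le_one₀ hs0 hs1)
  have hhA' : ∀ i j, |h i j| ≤ Λ + A := fun i j => by
    have h4 : |diagonal lam i j| ≤ Λ := by
      rw [diagonal_apply]
      split_ifs
      · rw [abs_of_nonneg (hlam i)]; exact hΛ i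
      · simpa using hΛ0
    rw [hχ, Matrix.add_apply]
    exact (abs_add_le _ _).trans (add_le_add h4 ((hχA i j).trans (mul_le_of_le_one_right hA hs1)))
  -- `R g R = 1` expresses `2 Z_kk` through `g_kk` up to order four. Substituting this in the
  -- expansion of `(R h R)_kk` removes the first-order contribution of `Z`; the largest remaining
  -- error is `Z χ`, of order `s² · s`.
  have e1 : g k k + 2 * Z k k + ((Z * γ) k k + (γ * Z) k k) + (Z * g * Z) k k = 1 := by
    have : R * g * R = g + (Z + Z) + (Z * γ + γ * Z) + Z * g * Z := by
      rw [hRZ, hγ]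
      noncomm_ring
    rw [this] at hR
    have := congrFun (congrFun hR k) k
    simp only [Matrix.add_apply, one_apply_eq] at this
    linarith
  have e2 : (R * h * R) k k
      = h k k + 2 * lam k * Z k k + ((Z * χ) k k + (χ * Z) k k) + (Z * h * Z) k k := by
    have : R * h * R = h + (Z * diagonal lam + diagonal lam * Z) + (Z * χ + χ * Z)
        + Z * h * Z := by
      rw [hRZ, hχ]
      noncomm_ring
    rw [this]
    simp only [Matrix.add_apply, mul_diagonal, diagonal_mul]
    ring
  have e3 : (R * h * R) k k - lam k - (h k k - lam k * g k k)
      = ((Z * χ) k k + (χ * Z) k k) + (Z * h * Z) k k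
        - lam k * (((Z * γ) k k + (γ * Z) k k) + (Z * g * Z) k k) := by
    rw [e2]
    linear_combination lam k * e1
  have b1 := abs_mul_entry_le hZ' hχA k k
  have b2 := abs_mul_entry_le hχA hZ' k k
  have b3 := abs_mul_entry_le (abs_mul_entry_le hZ' hhA') hZ' k k
  have b4 := abs_mul_entry_le hZ' hγA k k
  have b5 := abs_mul_entry_le hγA hZ' k k
  have b6 := abs_mul_entry_le (abs_mul_entry_le hZ' hgA') hZ' k k
  have hs4 : |s| ^ 4 ≤ |s| ^ 3 := pow_le_pow_of_le_one hs0 hs1 (by norm_num)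
  have c1 : |((Z * χ) k k + (χ * Z) k k) + (Z * h * Z) k k|
      ≤ (2 * (n * C * A) + n * (n * C * (Λ + A)) * C) * |s| ^ 3 := by
    refine (abs_add_le _ _).trans
      ((add_le_add ((abs_add_le _ _).trans (add_le_add b1 b2)) b3).trans ?_)
    calc _ = 2 * (n * C * A) * |s| ^ 3 + n * (n * C * (Λ + A)) * C * |s| ^ 4 := by ring
      _ ≤ 2 * (n * C * A) * |s| ^ 3 + n * (n * C * (Λ + A)) * C * |s| ^ 3 := by gcongr
      _ = _ := by ring
  have c2 : |((Z * γ) k k + (γ * Z) k k) + (Z * g * Z) k k|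
      ≤ (2 * (n * C * A) + n * (n * C * (1 + A)) * C) * |s| ^ 3 := by
    refine (abs_add_le _ _).trans
      ((add_le_add ((abs_add_le _ _).trans (add_le_add b4 b5)) b6).trans ?_)
    calc _ = (2 * (n * C * A) + n * (n * C * (1 + A)) * C) * |s| ^ 4 := by ring
      _ ≤ (2 * (n * C * A) + n * (n * C * (1 + A)) * C) * |s| ^ 3 := by gcongr
  rw [e3]
  refine (abs_sub _ _).trans ?_
  rw [abs_mul (lam k), abs_of_nonneg (hlam k), add_mul]
  refine add_le_add c1 ?_
  rw [mul_assoc Λ]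
  exact mul_le_mul (hΛ k) c2 (abs_nonneg _) hΛ0

/-- Second order upper bound for a concave symmetric function of the eigenvalues of `h` with respect
to `g`, for `g` close to the identity and `h` close to a diagonal matrix. -/
theorem exists_eigenvalue_estimate {φ : (Fin n → ℝ) → ℝ} (hφ : ConcaveOn ℝ (positiveCone n) φ)
    (hsymm : ∀ (σ : Equiv.Perm (Fin n)), ∀ x ∈ positiveCone n, φ (x ∘ σ) = φ x)
    {lam : Fin n → ℝ} (hlam : lam ∈ positiveCone n) (hd : DifferentiableAt ℝ φ lam)
    {A : ℝ} (hA : 0 ≤ A) :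
    ∃ C, 0 ≤ C ∧ ∃ δ > 0, ∀ s : ℝ, |s| < δ → ∀ g h : Matrix (Fin n) (Fin n) ℝ, gᵀ = g → hᵀ = h →
      (∀ x, x ≠ 0 → 0 < x ⬝ᵥ g *ᵥ x) → (∀ x, x ≠ 0 → 0 < x ⬝ᵥ h *ᵥ x) →
      (∀ i j, |g i j - (1 : Matrix (Fin n) (Fin n) ℝ) i j| ≤ A * s ^ 2) →
      (∀ i j, |h i j - diagonal lam i j| ≤ A * |s|) →
      ∃ (S : Matrix (Fin n) (Fin n) ℝ) (μ : Fin n → ℝ), μ ∈ positiveCone n ∧ Sᵀ * g * S = 1 ∧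
        Sᵀ * h * S = diagonal μ ∧
        φ μ ≤ φ lam + ∑ k, fderiv ℝ φ lam (Pi.single k 1) * (h k k - lam k * g k k)
          + C * |s| ^ 3 := by
  set C₁ : ℝ := 2 * n * n * A with hC₁
  set Λ : ℝ := ∑ i, lam i with hΛ
  have hΛi : ∀ i, lam i ≤ Λ := fun i =>
    Finset.single_le_sum (f := lam) (fun k _ => (hlam k).le) (Finset.mem_univ i)
  have hΛ0 : 0 ≤ Λ := Finset.sum_nonneg fun k _ => (hlam k).le
  set C₂ : ℝ := 2 * (n * C₁ * A) + n * (n * C₁ * (Λ + A)) * C₁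
    + Λ * (2 * (n * C₁ * A) + n * (n * C₁ * (1 + A)) * C₁) with hC₂
  have hC₁0 : 0 ≤ C₁ := by positivity
  have hC₂0 : 0 ≤ C₂ := by positivity
  -- `δ` ensures `|s| ≤ 1` and `n A s² ≤ 1/2`, the smallness needed for the inverse square root.
  refine ⟨∑ k, |fderiv ℝ φ lam (Pi.single k 1)| * C₂,
    Finset.sum_nonneg fun k _ => by positivity, min 1 (1 / (2 * (n * A + 1))), by positivity, ?_⟩
  intro s hs g h hg hh hgpos hhpos hgA hhA
  have hs1 : |s| ≤ 1 := (hs.trans_le (min_le_left _ _)).le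
  have hs2 : |s| ≤ 1 / (2 * (n * A + 1)) := (hs.trans_le (min_le_right _ _)).le
  have hs0 := abs_nonneg s
  have hss : s ^ 2 = |s| ^ 2 := (sq_abs s).symm
  obtain ⟨R, hR, hR1, hR2⟩ := exists_inverse_sqrt hg hgpos
  have hsmall : n * (A * s ^ 2) ≤ 1 / 2 := by
    rw [le_div_iff₀ (by positivity)] at hs2
    rw [hss]
    have h1 : |s| ^ 2 ≤ |s| := by nlinarith
    have h2 : 0 ≤ n * A := by positivity
    nlinarith [mul_le_mul_of_nonneg_left h1 h2]
  have hZ : ∀ i j, |(R - 1) i j| ≤ C₁ * |s| ^ 2 := fun i j => by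
    have := hR2 _ hgA hsmall i j
    rw [hss] at this
    rw [Matrix.sub_apply]
    calc _ ≤ _ := this
      _ = _ := by rw [hC₁]; ring
  obtain ⟨U, μ, h1, h2, h3⟩ := exists_orthogonal_diagonalization (A := R * h * R)
    (by simp [Matrix.transpose_mul, hR, hh, Matrix.mul_assoc])
  have hRU1 : (R * U)ᵀ * g * (R * U) = 1 := by
    have : (R * U)ᵀ * g * (R * U) = Uᵀ * (R * g * R) * U := by
      simp only [Matrix.transpose_mul, hR, Matrix.mul_assoc]
    rw [this, hR1, Matrix.mul_one, h1]
  have hRU2 : (R * U)ᵀ * h * (R * U) = diagonal μ := by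
    have : (R * U)ᵀ * h * (R * U) = Uᵀ * (R * h * R) * U := by
      simp only [Matrix.transpose_mul, hR, Matrix.mul_assoc]
    rw [this, h3]
    have : Uᵀ * (U * diagonal μ * Uᵀ) * U = (Uᵀ * U) * diagonal μ * (Uᵀ * U) := by
      simp only [Matrix.mul_assoc]
    rw [this, h1]
    simp
  have hμ : μ ∈ positiveCone n := fun j => by
    have := entry_transpose_mul_mul (R * U) h j j
    rw [hRU2, diagonal_apply_eq] at this
    rw [this]
    exact hhpos _ (col_ne_zero hRU1 j)
  set b : Fin n → ℝ := fun k => (R * h * R) k k with hb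
  have hbpos : b ∈ positiveCone n := fun k => by
    have := entry_transpose_mul_mul R h k k
    rw [hR] at this
    simp only [hb]
    rw [this]
    exact hhpos _ (col_ne_zero (T := R * g) hR1 k)
  refine ⟨R * U, μ, hμ, hRU1, hRU2, ?_⟩
  -- Schur's observation: the diagonal of `U diag(μ) Uᵀ` is the image of `μ` under the matrix of
  -- squares `U_ij²`, which is doubly stochastic because `U` is orthogonal.
  have hbD : b = (Matrix.of fun i j => U i j ^ 2) *ᵥ μ := by
    funext k
    simp only [hb]
    rw [h3, Matrix.mul_apply]
    simp only [mulVec, dotProduct, of_apply, mul_diagonal, transpose_apply]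
    exact Finset.sum_congr rfl fun j _ => by ring
  have hDS : (Matrix.of fun i j => U i j ^ 2) ∈ doublyStochastic ℝ (Fin n) := by
    rw [mem_doublyStochastic_iff_sum]
    refine ⟨fun i j => sq_nonneg _, fun i => ?_, fun j => ?_⟩
    · have := congrFun (congrFun h2 i) i
      rw [Matrix.mul_apply, one_apply_eq] at this
      simpa [sq] using this
    · have := congrFun (congrFun h1 j) j
      rw [Matrix.mul_apply, one_apply_eq] at this
      simpa [sq] using this
  have hle1 : φ μ ≤ φ b := by rw [hbD]; exact le_of_doublyStochastic hφ hsymm hDS hμ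
  have hle2 := concaveOn_le_tangent hφ hlam hbpos hd.hasFDerivAt
  have hlin : fderiv ℝ φ lam (b - lam)
      = ∑ k, fderiv ℝ φ lam (Pi.single k 1) * (b k - lam k) := by
    conv_lhs => rw [← Finset.univ_sum_single (b - lam)]
    rw [map_sum]
    refine Finset.sum_congr rfl fun k _ => ?_
    have : (Pi.single k ((b - lam) k) : Fin n → ℝ) = (b k - lam k) • Pi.single k 1 := by
      rw [← Pi.single_smul]; simp
    rw [this, map_smul, smul_eq_mul, mul_comm]
  have hest : ∀ k, |b k - lam k - (h k k - lam k * g k k)| ≤ C₂ * |s| ^ 3 := fun k =>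
    abs_conjugate_entry_sub_le (fun i => (hlam i).le) hΛi hA hC₁0 hR1 hZ hs1
      (fun i j => hss ▸ hgA i j) hhA k
  refine hle1.trans (hle2.trans ?_)
  rw [hlin, add_assoc, Finset.sum_mul, ← Finset.sum_add_distrib]
  gcongr with k
  have := hest k
  set G := fderiv ℝ φ lam (Pi.single k 1)
  have h4 : G * (b k - lam k - (h k k - lam k * g k k)) ≤ |G| * (C₂ * |s| ^ 3) :=
    (le_abs_self _).trans (by rw [abs_mul]; gcongr)
  nlinarith

end ConcaveSymmetric

/-! ## Derivative tests along lines -/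

section LineTests

variable {E : Type*} [NormedAddCommGroup E] [NormedSpace ℝ E] {U : Set E}

theorem hasDerivAt_line (hU : IsOpen U) {f : E → ℝ} (hf : ContDiffOn ℝ ∞ f U) {p v : E} {s : ℝ}
    (hs : p + s • v ∈ U) : HasDerivAt (fun s : ℝ => f (p + s • v)) (dd v f (p + s • v)) s := by
  have h1 : HasDerivAt (fun s : ℝ => p + s • v) v s := by
    simpa using ((hasDerivAt_id s).smul_const v).const_add p
  exact (differentiableAt_of_smoothOn hU hf hs).hasFDerivAt.comp_hasDerivAt s h1

theorem eventually_line_mem (hU : IsOpen U) {p : E} (hp : p ∈ U) (v : E) :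
    ∀ᶠ s : ℝ in 𝓝 0, p + s • v ∈ U := by
  have : Continuous fun s : ℝ => p + s • v := by fun_prop
  exact this.continuousAt.preimage_mem_nhds (by simpa using hU.mem_nhds hp)

theorem line_linear_bound (hU : IsOpen U) {f : E → ℝ} (hf : ContDiffOn ℝ ∞ f U) {p : E}
    (hp : p ∈ U) (v : E) : ∃ A, 0 ≤ A ∧ ∀ᶠ s : ℝ in 𝓝 0, |f (p + s • v) - f p| ≤ A * |s| := by
  have h := hasDerivAt_line hU hf (p := p) (v := v) (s := 0) (by simpa using hp)
  obtain ⟨A, hA, hb⟩ := h.isBigO_sub.exists_nonneg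
  refine ⟨A, hA, ?_⟩
  filter_upwards [hb.bound] with s hs
  simpa using hs

theorem line_quadratic_bound (hU : IsOpen U) {f : E → ℝ} (hf : ContDiffOn ℝ ∞ f U) {p : E}
    (hp : p ∈ U) {v : E} (h0 : dd v f p = 0) :
    ∃ A, 0 ≤ A ∧ ∀ᶠ s : ℝ in 𝓝 0, |f (p + s • v) - f p| ≤ A * s ^ 2 := by
  obtain ⟨A, hA, hb⟩ := line_linear_bound hU (contDiffOn_dd hU hf v) hp v
  refine ⟨A, hA, ?_⟩
  obtain ⟨δ, hδ, hball⟩ := Metric.eventually_nhds_iff_ball.1 (hb.and (eventually_line_mem hU hp v))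
  refine Metric.eventually_nhds_iff_ball.2 ⟨δ, hδ, fun s hs => ?_⟩
  have hsub : Metric.closedBall (0 : ℝ) |s| ⊆ Metric.ball 0 δ :=
    Metric.closedBall_subset_ball (by simpa using hs)
  have := (convex_closedBall (0 : ℝ) |s|).norm_image_sub_le_of_norm_hasDerivWithin_le
    (f := fun s : ℝ => f (p + s • v)) (f' := fun s => dd v f (p + s • v)) (C := A * |s|)
    (fun r hr => (hasDerivAt_line hU hf (hball r (hsub hr)).2).hasDerivWithinAt)
    (fun r hr => by
      have h1 := (hball r (hsub hr)).1
      rw [h0, sub_zero] at h1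
      refine h1.trans (mul_le_mul_of_nonneg_left ?_ hA)
      simpa using hr)
    (x := 0) (y := s) (by simp) (by simp)
  rw [← sq_abs]
  simpa [sq, mul_assoc] using this

/-- A function which vanishes at `p` and has a cubic lower bound along a line through `p` has
vanishing first and nonnegative second derivative in the direction of the line. -/
theorem dd_dd_nonneg_of_cubic_bound (hU : IsOpen U) {f : E → ℝ} (hf : ContDiffOn ℝ ∞ f U) {p : E}
    (hp : p ∈ U) {v : E} (h0 : f p = 0) {C : ℝ}
    (h : ∀ᶠ s : ℝ in 𝓝 0, -(C * |s| ^ 3) ≤ f (p + s • v)) :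
    dd v f p = 0 ∧ 0 ≤ dd v (dd v f) p := by
  set g : ℝ → ℝ := fun s => f (p + s • v) with hg
  have hgd : HasDerivAt g (dd v f p) 0 := by
    simpa using hasDerivAt_line hU hf (p := p) (v := v) (s := 0) (by simpa using hp)
  have hgd2 : HasDerivAt (fun s : ℝ => dd v f (p + s • v)) (dd v (dd v f) p) 0 := by
    simpa using hasDerivAt_line hU (contDiffOn_dd hU hf v) (p := p) (v := v) (s := 0)
      (by simpa using hp)
  have hg0 : g 0 = 0 := by simpa [hg] using h0
  have hfirst : dd v f p = 0 := by
    -- Near `0` the term `|C| s²` dominates the cubic error, so the modified function has a minimum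
    -- at `0`; its first derivative there is that of `g`.
    have hmin : IsLocalMin (fun s => g s + |C| * s ^ 2) 0 := by
      have h1 : ∀ᶠ s : ℝ in 𝓝 0, |s| < 1 :=
        (continuous_abs.tendsto (0 : ℝ)).eventually_lt_const (by simp)
      filter_upwards [h, h1] with s hs hs1
      simp only [hg0]
      have e1 : C * |s| ^ 3 ≤ |C| * s ^ 2 := by
        rw [← sq_abs s]
        have := pow_le_pow_of_le_one (abs_nonneg s) hs1.le (show 2 ≤ 3 by norm_num)
        calc C * |s| ^ 3 ≤ |C| * |s| ^ 3 := by gcongr; exact le_abs_self C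
          _ ≤ _ := by gcongr
      simp only [hg] at *
      nlinarith
    have hd : HasDerivAt (fun s => g s + |C| * s ^ 2) (dd v f p) 0 := by
      simpa using hgd.fun_add (((hasDerivAt_id (0 : ℝ)).pow 2).const_mul |C|)
    exact hmin.hasDerivAt_eq_zero hd
  refine ⟨hfirst, ?_⟩
  by_contra hneg
  push Not at hneg
  -- If the second derivative were `-4δ < 0`, then `g + δ s²` would have second derivative `-2δ` and
  -- a local maximum at `0`. This gives `g ≤ -δ s²`, incompatible with a cubic lower bound for small
  -- `s > 0`.
  set δ := -dd v (dd v f) p / 4 with hδ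
  have hδ0 : 0 < δ := by rw [hδ]; linarith
  have hk : ∀ᶠ s : ℝ in 𝓝 0, HasDerivAt (fun s => g s + δ * s ^ 2)
      (dd v f (p + s • v) + δ * (2 * s)) s := by
    filter_upwards [eventually_line_mem hU hp v] with s hs
    simpa using (hasDerivAt_line hU hf hs).fun_add (((hasDerivAt_id s).pow 2).const_mul δ)
  have hk1 : deriv (fun s => g s + δ * s ^ 2) 0 = 0 := by
    rw [hk.self_of_nhds.deriv]; simp [hfirst]
  have hk2 : deriv (deriv (fun s => g s + δ * s ^ 2)) 0 < 0 := by
    have : deriv (fun s => g s + δ * s ^ 2) =ᶠ[𝓝 0] fun s => dd v f (p + s • v) + δ * (2 * s) := by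
      filter_upwards [hk] with s hs using hs.deriv
    rw [this.deriv_eq]
    have h3 : HasDerivAt (fun s => dd v f (p + s • v) + δ * (2 * s))
        (dd v (dd v f) p + δ * 2) 0 := by
      simpa using hgd2.fun_add (((hasDerivAt_id (0 : ℝ)).const_mul 2).const_mul δ)
    rw [h3.deriv, hδ]
    linarith
  have hmax := isLocalMax_of_deriv_deriv_neg hk2 hk1 hk.self_of_nhds.continuousAt
  have hev : ∀ᶠ s : ℝ in 𝓝[>] 0, δ ≤ |C| * s := by
    have h4 : ∀ᶠ s : ℝ in 𝓝[>] 0, 0 < s := self_mem_nhdsWithin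
    filter_upwards [nhdsWithin_le_nhds h, nhdsWithin_le_nhds hmax, h4] with s h1 h2 h3
    simp only [hg0] at h2
    have e1 : C * |s| ^ 3 ≤ |C| * s ^ 3 := by
      rw [abs_of_pos h3]; gcongr; exact le_abs_self C
    have : δ * s ^ 2 ≤ |C| * s * s ^ 2 := by
      simp only [hg] at h2
      nlinarith
    exact le_of_mul_le_mul_right this (by positivity)
  have hlim : Filter.Tendsto (fun s : ℝ => |C| * s) (𝓝[>] 0) (𝓝 0) := by
    have : Continuous fun s : ℝ => |C| * s := by fun_prop
    simpa using (this.tendsto 0).mono_left nhdsWithin_le_nhds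
  exact absurd (ge_of_tendsto hlim hev) (not_le.2 hδ0)

/-- A function which vanishes at `p` and is nonnegative on the backward half line has nonpositive
derivative. -/
theorem dd_nonpos_of_backward_nonneg (hU : IsOpen U) {f : E → ℝ} (hf : ContDiffOn ℝ ∞ f U) {p : E}
    (hp : p ∈ U) {v : E} (h0 : f p = 0) (h : ∀ᶠ s : ℝ in 𝓝[<] 0, 0 ≤ f (p + s • v)) :
    dd v f p ≤ 0 := by
  have hgd : HasDerivAt (fun s : ℝ => f (p + s • v)) (dd v f p) 0 := by
    simpa using hasDerivAt_line hU hf (p := p) (v := v) (s := 0) (by simpa using hp)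
  refine le_of_tendsto hgd.tendsto_slope_zero_left ?_
  filter_upwards [h, self_mem_nhdsWithin] with s hs hs0
  simp only [zero_add, zero_smul, add_zero, h0, sub_zero, smul_eq_mul]
  exact mul_nonpos_of_nonpos_of_nonneg (inv_nonpos.2 (le_of_lt hs0)) hs

end LineTests

/-- The convex function `x^(-α)` lies above its tangents. After scaling by `x` this is `exp u ≥ 1 +
u` combined with `log r ≤ r - 1`. -/
theorem rpow_neg_tangent_le {α x y : ℝ} (hα : 0 < α) (hx : 0 < x) (hy : 0 < y) :
    x ^ (-α) - α * x ^ (-α - 1) * (y - x) ≤ y ^ (-α) := by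
  have ht : 0 < y / x := div_pos hy hx
  have h1 : 1 - α * (y / x - 1) ≤ (y / x) ^ (-α) := by
    rw [Real.rpow_def_of_pos ht]
    have h2 := Real.add_one_le_exp (Real.log (y / x) * -α)
    have h3 := Real.log_le_sub_one_of_pos ht
    nlinarith
  have h4 : y ^ (-α) = x ^ (-α) * (y / x) ^ (-α) := by
    rw [← Real.mul_rpow hx.le ht.le, mul_div_cancel₀ _ hx.ne']
  rw [h4, Real.rpow_sub_one hx.ne']
  have h5 := mul_le_mul_of_nonneg_left h1 (Real.rpow_pos_of_pos hx (-α)).le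
  calc x ^ (-α) - α * (x ^ (-α) / x) * (y - x) = x ^ (-α) * (1 - α * (y / x - 1)) := by
        field_simp
    _ ≤ _ := h5

/-! ## The contact inequality -/

section Contact

variable {n : ℕ} {E : Type*} [NormedAddCommGroup E] [NormedSpace ℝ E]

/-- The functions of the inverse principal curvatures under consideration. -/
structure IsDualCurvatureFunction (F : (Fin n → ℝ) → ℝ) : Prop where
  concave : ConcaveOn ℝ (positiveCone n) F
  symmetric : ∀ (σ : Equiv.Perm (Fin n)), ∀ x ∈ positiveCone n, F (x ∘ σ) = F x
  positive : ∀ x ∈ positiveCone n, 0 < F x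
  smooth : ContDiffOn ℝ ∞ F (positiveCone n)
  increasing : ∀ x ∈ positiveCone n, ∀ i, 0 < fderiv ℝ F x (Pi.single i 1)

theorem isOpen_positiveCone : IsOpen (positiveCone n) := by
  have : positiveCone n = Set.pi univ fun _ => Ioi 0 := by
    ext x; simp [positiveCone]
  rw [this]
  exact isOpen_set_pi finite_univ fun _ _ => isOpen_Ioi

/-- The coefficients of the linearization of `-F ^ (-α)`. -/
def linearizedCoeff (F : (Fin n → ℝ) → ℝ) (α : ℝ) (lam : Fin n → ℝ) (k : Fin n) : ℝ :=
  α * F lam ^ (-α - 1) * fderiv ℝ F lam (Pi.single k 1)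

/-- `L` is orthonormal for the third fundamental form at `q` and diagonalizes the second fundamental
form, with eigenvalues `μ`. -/
structure IsPrincipalFrame (Y N : ℝ × E → Ambient n) (q : ℝ × E) (L : Fin n → E) (μ : Fin n → ℝ) :
    Prop where
  orthonormal : ∀ i j, lorentz (dd (0, L i) N q) (dd (0, L j) N q) = if i = j then 1 else 0
  diagonal : ∀ i j, lorentz (dd (0, L i) N q) (dd (0, L j) Y q) = if i = j then μ i else 0

/-- A normal motion whose speed is `Φ(t) - F(λ) ^ (-α)`, where `λ` are the inverse principal
curvatures, wherever these are positive. -/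
structure IsDualFlow (F : (Fin n → ℝ) → ℝ) (α : ℝ) (Φ : ℝ → ℝ) (U : Set (ℝ × E))
    (Y N : ℝ × E → Ambient n) (σ : ℝ × E → ℝ) : Prop extends IsNormalMotion U Y N σ where
  speed : ∀ q ∈ U, ∀ (L : Fin n → E), ∀ μ ∈ positiveCone n, IsPrincipalFrame Y N q L μ →
    σ q = Φ q.1 - F μ ^ (-α)

variable {F : (Fin n → ℝ) → ℝ} {α : ℝ} {Φ : ℝ → ℝ} {U : Set (ℝ × E)}
    {Y N : ℝ × E → Ambient n} {σ : ℝ × E → ℝ}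

theorem IsNormalMotion.isLorentzFrame (H : IsNormalMotion U Y N σ) {p : ℝ × E} (hp : p ∈ U)
    {L : Fin n → E} {μ : Fin n → ℝ} (hL : IsPrincipalFrame Y N p L μ) :
    IsLorentzFrame (Y p) (N p) fun j => dd (0, L j) N p :=
  ⟨H.timelike p hp, H.unit p hp, H.normal p hp, fun _ => H.cotangent hp _,
    fun _ => H.lorentz_dd_right_self hp _, hL.orthonormal⟩

/-- The Weingarten relation read from the dual side: a spatial derivative of `Y` has no component
along `Y` or `N`, and the frame diagonalizes what is left. -/
theorem IsNormalMotion.dd_left_eq (H : IsNormalMotion U Y N σ) {p : ℝ × E} (hp : p ∈ U)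
    {L : Fin n → E} {μ : Fin n → ℝ} (hL : IsPrincipalFrame Y N p L μ) (i : Fin n) :
    dd (0, L i) Y p = μ i • dd (0, L i) N p := by
  rw [(H.isLorentzFrame hp hL).eq_sum (dd (0, L i) Y p), H.lorentz_dd_left_self hp,
    lorentz_comm _ (N p), H.tangent p hp]
  simp only [lorentz_comm (dd (0, L i) Y p), hL.diagonal]
  rw [Finset.sum_eq_single i] <;> simp +contextual [eq_comm]

theorem sum_dir (f : ℝ × E → Ambient n) (q : ℝ × E) (e : Fin n → E) (c : Fin n → ℝ) :
    dd (0, ∑ i, c i • e i) f q = ∑ i, c i • dd (0, e i) f q := by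
  have : ((0 : ℝ), ∑ i, c i • e i) = ∑ i, c i • ((0 : ℝ), e i) := by
    ext
    · simp [Prod.fst_sum]
    · simp [Prod.snd_sum]
  rw [this]
  simp only [dd, map_sum, map_smul]

theorem lorentz_sum_sum (a b : Fin n → Ambient n) (c d : Fin n → ℝ) :
    lorentz (∑ i, c i • a i) (∑ j, d j • b j)
      = c ⬝ᵥ Matrix.mulVec (Matrix.of fun i j => lorentz (a i) (b j)) d := by
  rw [lorentz_sum_left]
  simp only [dotProduct, Matrix.mulVec, Matrix.of_apply]
  refine Finset.sum_congr rfl fun i _ => ?_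
  rw [lorentz_smul_left, lorentz_sum_right]
  congr 1
  exact Finset.sum_congr rfl fun j _ => by rw [lorentz_smul_right, mul_comm]

theorem dd_linear_combination {E : Type*} [NormedAddCommGroup E] [NormedSpace ℝ E]
    (a l : Fin n → ℝ) {P Q : Fin n → E → ℝ} {f : E → ℝ} {q : E}
    (hP : ∀ k, DifferentiableAt ℝ (P k) q) (hQ : ∀ k, DifferentiableAt ℝ (Q k) q)
    (hf : DifferentiableAt ℝ f q) (c : ℝ) (v : E) :
    dd v (fun q => (∑ k, a k * (P k q - l k * Q k q)) - (f q - c)) q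
      = (∑ k, a k * (dd v (P k) q - l k * dd v (Q k) q)) - dd v f q := by
  have h1 := (HasFDerivAt.fun_sum (u := Finset.univ) fun k _ => ((hP k).hasFDerivAt.fun_sub
    ((hQ k).hasFDerivAt.const_mul (l k))).const_mul (a k)).fun_sub (hf.hasFDerivAt.sub_const c)
  simp only [dd, h1.fderiv]
  simp

/-- The inequality for the second derivative of the speed in a principal direction which encodes the
concavity of `F`. -/
theorem IsDualFlow.dd_dd_speed_le (H : IsDualFlow F α Φ U Y N σ) (hF : IsDualCurvatureFunction F)
    (hα : 0 < α) {p : ℝ × E} (hp : p ∈ U) {e : Fin n → E} (he : LinearIndependent ℝ e)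
    {lam : Fin n → ℝ} (hlam : lam ∈ positiveCone n) (hL : IsPrincipalFrame Y N p e lam)
    (hnor : ∀ i j, dd (0, e i) (dd (0, e j) N) p = if i = j then -N p + lam i • Y p else 0)
    (hpos : ∀ q ∈ U, q.1 = p.1 → ∀ v ≠ 0, 0 < lorentz (dd (0, v) N q) (dd (0, v) Y q))
    (i : Fin n) :
    dd (0, e i) (dd (0, e i) σ) p ≤ ∑ k, linearizedCoeff F α lam k *
      (dd (0, e i) (dd (0, e i) fun q => lorentz (dd (0, e k) N q) (dd (0, e k) Y q)) p
      - lam k * dd (0, e i) (dd (0, e i) fun q => lorentz (dd (0, e k) N q) (dd (0, e k) N q)) p)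
      := by
  have hU := H.isOpen
  have hNd := fun u => contDiffOn_dd hU H.smooth_right u
  have hYd := fun u => contDiffOn_dd hU H.smooth_left u
  set gm : ℝ × E → Matrix (Fin n) (Fin n) ℝ := fun q => Matrix.of fun k l =>
    lorentz (dd (0, e k) N q) (dd (0, e l) N q) with hgm
  set hm : ℝ × E → Matrix (Fin n) (Fin n) ℝ := fun q => Matrix.of fun k l =>
    lorentz (dd (0, e k) N q) (dd (0, e l) Y q) with hhm
  have hgs : ∀ k l, ContDiffOn ℝ ∞ (fun q => gm q k l) U := fun k l =>
    contDiffOn_lorentz (hNd _) (hNd _)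
  have hhs : ∀ k l, ContDiffOn ℝ ∞ (fun q => hm q k l) U := fun k l =>
    contDiffOn_lorentz (hNd _) (hYd _)
  have tan : ∀ k l m, lorentz (dd (0, e k) (dd (0, e l) N) p) (dd (0, e m) N p) = 0 := by
    intro k l m
    rw [hnor]
    split_ifs
    · simp [lorentz_comm (N p), lorentz_comm (Y p), H.lorentz_dd_right_self hp, H.cotangent hp]
    · simp
  have hg1 : ∀ k l, dd (0, e i) (fun q => gm q k l) p = 0 := fun k l => by
    have := dd_lorentz_on hU (hNd (0, e k)) (hNd (0, e l)) (0, e i) hp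
    simp only [hgm, Matrix.of_apply]
    rw [this]
    simp only
    rw [tan, lorentz_comm, tan, add_zero]
  choose Ag hAg0 hAg using fun k l => line_quadratic_bound hU (hgs k l) hp (hg1 k l)
  choose Ah hAh0 hAh using fun k l => line_linear_bound hU (hhs k l) hp (0, e i)
  set A : ℝ := (∑ k, ∑ l, Ag k l) + ∑ k, ∑ l, Ah k l with hA
  have hsum : ∀ (B : Fin n → Fin n → ℝ), (∀ k l, 0 ≤ B k l) → ∀ k l, B k l ≤ ∑ k, ∑ l, B k l :=
    fun B hB k l => (Finset.single_le_sum (f := fun l => B k l) (fun l _ => hB k l)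
      (Finset.mem_univ l)).trans (Finset.single_le_sum (f := fun k => ∑ l, B k l)
        (fun k _ => Finset.sum_nonneg fun l _ => hB k l) (Finset.mem_univ k))
  have hAg' : 0 ≤ ∑ k, ∑ l, Ag k l := Finset.sum_nonneg fun k _ => Finset.sum_nonneg fun l _ => hAg0 k l
  have hAh' : 0 ≤ ∑ k, ∑ l, Ah k l := Finset.sum_nonneg fun k _ => Finset.sum_nonneg fun l _ => hAh0 k l
  obtain ⟨C, hC0, δ, hδ, hest⟩ := exists_eigenvalue_estimate hF.concave hF.symmetric hlam
    ((hF.smooth.contDiffAt (isOpen_positiveCone.mem_nhds hlam)).differentiableAt (by simp))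
    (A := A) (by positivity)
  have hgp : ∀ k l, gm p k l = (1 : Matrix (Fin n) (Fin n) ℝ) k l := fun k l => by
    simp only [hgm, Matrix.of_apply, hL.orthonormal, Matrix.one_apply]
  have hhp : ∀ k l, hm p k l = Matrix.diagonal lam k l := fun k l => by
    simp only [hhm, Matrix.of_apply, hL.diagonal, Matrix.diagonal_apply]
  have hvec : ∀ (c : Fin n → ℝ), c ≠ 0 → ∑ k, c k • e k ≠ 0 := fun c hc h0 =>
    hc (funext fun k => Fintype.linearIndependent_iff.1 he c h0 k)
  set c₀ : ℝ := α * F lam ^ (-α - 1) with hc₀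
  have hFl := hF.positive lam hlam
  have hc₀0 : 0 < c₀ := mul_pos hα (Real.rpow_pos_of_pos hFl _)
  -- Along a spatial line the time is fixed, so `Φ` cancels in `σ q - σ p`. The eigenvalue estimate
  -- and the tangent inequality for `x^(-α)` then bound this increment by the linearization
  -- evaluated on `h_kk - λ_k g_kk`, up to a cubic error. Both sides are smooth in `q` although the
  -- eigenvalues need not be.
  have key : ∀ᶠ s : ℝ in 𝓝 0, -(c₀ * C * |s| ^ 3) ≤
      (fun q => (∑ k, linearizedCoeff F α lam k * (hm q k k - lam k * gm q k k)) - (σ q - σ p))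
        (p + s • ((0 : ℝ), e i)) := by
    have hsmall : ∀ᶠ s : ℝ in 𝓝 0, |s| < δ :=
      (continuous_abs.tendsto (0 : ℝ)).eventually_lt_const (by simpa using hδ)
    filter_upwards [hsmall, Filter.eventually_all.2 fun k => Filter.eventually_all.2 (hAg k),
      Filter.eventually_all.2 fun k => Filter.eventually_all.2 (hAh k),
      eventually_line_mem hU hp (0, e i)] with s hs h1 h2 hq
    set q := p + s • ((0 : ℝ), e i) with hqdef
    have hq1 : q.1 = p.1 := by simp [hqdef]
    have quadg : ∀ c : Fin n → ℝ, c ⬝ᵥ Matrix.mulVec (gm q) c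
        = lorentz (dd (0, ∑ k, c k • e k) N q) (dd (0, ∑ k, c k • e k) N q) := fun c => by
      rw [sum_dir, lorentz_sum_sum]
    have quadh : ∀ c : Fin n → ℝ, c ⬝ᵥ Matrix.mulVec (hm q) c
        = lorentz (dd (0, ∑ k, c k • e k) N q) (dd (0, ∑ k, c k • e k) Y q) := fun c => by
      rw [sum_dir, sum_dir, lorentz_sum_sum]
    obtain ⟨S, μ, hμ, hS1, hS2, hle⟩ := hest s hs (gm q) (hm q)
      (by ext k l; simp [hgm, lorentz_comm])
      (by ext k l; simp only [hhm, Matrix.transpose_apply, Matrix.of_apply];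
          exact H.second_form_symm hq _ _)
      (fun c hc => by
        rw [quadg]
        refine lorentz_self_pos (H.timelike q hq) (H.cotangent hq _) fun h0 => ?_
        have := hpos q hq hq1 _ (hvec c hc)
        rw [h0, lorentz_zero_left] at this
        exact lt_irrefl _ this)
      (fun c hc => by rw [quadh]; exact hpos q hq hq1 _ (hvec c hc))
      (fun k l => by
        rw [← hgp]
        refine (h1 k l).trans (mul_le_mul_of_nonneg_right ?_ (sq_nonneg s))
        have := hsum Ag hAg0 k l
        linarith)
      (fun k l => by
        rw [← hhp]
        refine (h2 k l).trans (mul_le_mul_of_nonneg_right ?_ (abs_nonneg s))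
        have := hsum Ah hAh0 k l
        linarith)
    have hframe : IsPrincipalFrame Y N q (fun k => ∑ l, S l k • e l) μ := by
      constructor
      · intro k l
        rw [sum_dir, sum_dir, lorentz_sum_sum]
        have := entry_transpose_mul_mul S (gm q) k l
        rw [hS1, Matrix.one_apply] at this
        exact this.symm
      · intro k l
        rw [sum_dir, sum_dir, lorentz_sum_sum]
        have := entry_transpose_mul_mul S (hm q) k l
        rw [hS2, Matrix.diagonal_apply] at this
        exact this.symm
    have hσq := H.speed q hq _ μ hμ hframe
    have hσp := H.speed p hp e lam hlam hL
    rw [hq1] at hσq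
    have hFμ := hF.positive μ hμ
    have htan := rpow_neg_tangent_le hα hFl hFμ
    have hlin : ∑ k, linearizedCoeff F α lam k * (hm q k k - lam k * gm q k k)
        = c₀ * ∑ k, fderiv ℝ F lam (Pi.single k 1) * (hm q k k - lam k * gm q k k) := by
      rw [Finset.mul_sum]
      exact Finset.sum_congr rfl fun k _ => by rw [linearizedCoeff]; ring
    change _ ≤ (∑ k, linearizedCoeff F α lam k * (hm q k k - lam k * gm q k k)) - (σ q - σ p)
    rw [hlin, hσq, hσp]
    have := mul_le_mul_of_nonneg_left (sub_nonneg.2 hle) hc₀0.le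
    rw [mul_zero] at this
    rw [← hc₀] at htan
    nlinarith
  have hlins : ∀ k, ContDiffOn ℝ ∞ (fun q => linearizedCoeff F α lam k *
      (hm q k k - lam k * gm q k k)) U := fun k =>
    contDiffOn_const.mul ((hhs k k).sub (contDiffOn_const.mul (hgs k k)))
  have hres := (dd_dd_nonneg_of_cubic_bound hU ((ContDiffOn.sum fun k _ => hlins k).sub
    (H.smooth_speed.sub contDiffOn_const)) hp (by simp [hgp, hhp]) key).2
  have hdiff := fun {f : ℝ × E → ℝ} (hf : ContDiffOn ℝ ∞ f U) {q : ℝ × E} (hq : q ∈ U) =>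
    differentiableAt_of_smoothOn hU hf hq
  have d1 := dd_congr hU (fun q hq => dd_linear_combination (linearizedCoeff F α lam) lam
    (P := fun k q => hm q k k) (Q := fun k q => gm q k k) (fun k => hdiff (hhs k k) hq)
    (fun k => hdiff (hgs k k) hq) (hdiff H.smooth_speed hq) (σ p) (0, e i)) (0, e i) hp
  have d2 := dd_linear_combination (linearizedCoeff F α lam) lam
    (P := fun k => dd (0, e i) fun q => hm q k k) (Q := fun k => dd (0, e i) fun q => gm q k k)
    (fun k => hdiff (contDiffOn_dd hU (hhs k k) _) hp)
    (fun k => hdiff (contDiffOn_dd hU (hgs k k) _) hp)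
    (hdiff (contDiffOn_dd hU H.smooth_speed (0, e i)) hp) 0 (0, e i)
  simp only [sub_zero] at d2
  rw [d1, d2] at hres
  exact sub_nonneg.1 hres

theorem linearizedCoeff_pos (hF : IsDualCurvatureFunction F) (hα : 0 < α) {lam : Fin n → ℝ}
    (hlam : lam ∈ positiveCone n) (k : Fin n) : 0 < linearizedCoeff F α lam k :=
  mul_pos (mul_pos hα (Real.rpow_pos_of_pos (hF.positive lam hlam) _)) (hF.increasing lam hlam k)

/-- The differential inequality satisfied by an upper barrier `m` for the inverse principal
curvatures at a point of first contact, in coordinates in which the third fundamental form is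
Euclidean to first order. -/
theorem IsDualFlow.contact_inequality_normal (H : IsDualFlow F α Φ U Y N σ)
    (hF : IsDualCurvatureFunction F) (hα : 0 < α) {p : ℝ × E} (hp : p ∈ U) {e : Fin n → E}
    (he : LinearIndependent ℝ e) {lam : Fin n → ℝ} (hlam : lam ∈ positiveCone n)
    (hL : IsPrincipalFrame Y N p e lam)
    (hnor : ∀ i j, dd (0, e i) (dd (0, e j) N) p = if i = j then -N p + lam i • Y p else 0)
    (hpos : ∀ q ∈ U, q.1 = p.1 → ∀ v ≠ 0, 0 < lorentz (dd (0, v) N q) (dd (0, v) Y q))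
    {m : ℝ × E → ℝ} (hm : ContDiffOn ℝ ∞ m U)
    (hcontact : ∀ q ∈ U, q.1 ≤ p.1 → ∀ v, lorentz (dd (0, v) N q) (dd (0, v) Y q)
      ≤ m q * lorentz (dd (0, v) N q) (dd (0, v) N q))
    {i : Fin n} (hmi : m p = lam i) :
    dd (1, 0) m p ≤ ∑ k, linearizedCoeff F α lam k *
        (dd (0, e k) (dd (0, e k) m) p + (lam i - lam k) * (lam i * lam k - 1))
      + σ p * (1 - lam i ^ 2) - ∑ j, dd (0, e j) m p * dd (0, e j) σ p / lam j := by
  have hU := H.isOpen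
  have hNd := fun u => contDiffOn_dd hU H.smooth_right u
  have hYd := fun u => contDiffOn_dd hU H.smooth_left u
  set g : ℝ × E → ℝ := fun q => lorentz (dd (0, e i) N q) (dd (0, e i) N q) with hg
  set h : ℝ × E → ℝ := fun q => lorentz (dd (0, e i) N q) (dd (0, e i) Y q) with hh
  have hgs : ContDiffOn ℝ ∞ g U := contDiffOn_lorentz (hNd _) (hNd _)
  have hhs : ContDiffOn ℝ ∞ h U := contDiffOn_lorentz (hNd _) (hYd _)
  have hdiff := fun {f : ℝ × E → ℝ} (hf : ContDiffOn ℝ ∞ f U) {q : ℝ × E} (hq : q ∈ U) =>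
    differentiableAt_of_smoothOn hU hf hq
  have hgp : g p = 1 := by simp [hg, hL.orthonormal]
  have hhp : h p = lam i := by simp [hh, hL.diagonal]
  have tan : ∀ k l m, lorentz (dd (0, e k) (dd (0, e l) N) p) (dd (0, e m) N p) = 0 := by
    intro k l m
    rw [hnor]
    split_ifs
    · simp [lorentz_comm (N p), lorentz_comm (Y p), H.lorentz_dd_right_self hp, H.cotangent hp]
    · simp
  have hg1 : ∀ k, dd (0, e k) g p = 0 := fun k => by
    have := dd_lorentz_on hU (hNd (0, e i)) (hNd (0, e i)) (0, e k) hp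
    simp only [hg]
    rw [this]
    simp only
    rw [tan, lorentz_comm, tan, add_zero]
  -- `m g_ii - h_ii`, in the fixed coordinate direction `e_i`, vanishes at `p` and is nonnegative at
  -- all times up to that of `p`. The spatial second derivative test and the one-sided time test
  -- turn this into conditions on `m`.
  have hΨs : ContDiffOn ℝ ∞ (fun q => m q * g q - h q) U := (hm.mul hgs).sub hhs
  have hΨ0 : (fun q => m q * g q - h q) p = 0 := by simp [hgp, hhp, hmi]
  have hΨd : ∀ v, EqOn (dd v fun q => m q * g q - h q)
      (fun q => (dd v m q * g q + m q * dd v g q) - dd v h q) U := fun v q hq => by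
    rw [dd_sub ((hdiff hm hq).fun_mul (hdiff hgs hq)) (hdiff hhs hq),
      dd_mul (hdiff hm hq) (hdiff hgs hq)]
  have htest : ∀ k, dd (0, e k) (fun q => m q * g q - h q) p = 0 ∧
      0 ≤ dd (0, e k) (dd (0, e k) fun q => m q * g q - h q) p := fun k => by
    refine dd_dd_nonneg_of_cubic_bound hU hΨs hp hΨ0 (C := 0) ?_
    filter_upwards [eventually_line_mem hU hp (0, e k)] with s hs
    have := hcontact _ hs (by simp) (e i)
    simp only [zero_mul, neg_zero, sub_nonneg]
    exact this
  have hm1 : ∀ k, dd (0, e k) m p = dd (0, e k) h p := fun k => by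
    have := (htest k).1
    rw [hΨd _ hp] at this
    simp only [hgp, hg1] at this
    linarith
  have hm2 : ∀ k, dd (0, e k) (dd (0, e k) h) p - lam i * dd (0, e k) (dd (0, e k) g) p
      ≤ dd (0, e k) (dd (0, e k) m) p := fun k => by
    have := (htest k).2
    have hmd := hdiff (contDiffOn_dd hU hm (0, e k)) hp
    have hgd := hdiff (contDiffOn_dd hU hgs (0, e k)) hp
    have hhd := hdiff (contDiffOn_dd hU hhs (0, e k)) hp
    rw [dd_congr hU (hΨd _) _ hp,
      dd_sub ((hmd.fun_mul (hdiff hgs hp)).fun_add ((hdiff hm hp).fun_mul hgd)) hhd,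
      dd_add (hmd.fun_mul (hdiff hgs hp)) ((hdiff hm hp).fun_mul hgd),
      dd_mul hmd (hdiff hgs hp), dd_mul (hdiff hm hp) hgd, hg1, hgp, hmi] at this
    linarith
  have hmt : dd (1, 0) m p ≤ dd (1, 0) h p - lam i * dd (1, 0) g p := by
    have hback := dd_nonpos_of_backward_nonneg hU hΨs hp (v := (1, 0)) hΨ0 (by
      filter_upwards [nhdsWithin_le_nhds (eventually_line_mem hU hp (1, 0)),
        self_mem_nhdsWithin] with s hs hs0
      have := hcontact _ hs (by simpa using le_of_lt hs0) (e i)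
      simp only [sub_nonneg]
      exact this)
    rw [hΨd _ hp] at hback
    simp only [hgp, hmi] at hback
    linarith
  have heig := fun k => H.toIsNormalMotion.dd_left_eq hp hL k
  have hevol := H.toIsNormalMotion.evolution_identity hp hlam hL.orthonormal heig hnor i
  have hspeed := H.dd_dd_speed_le hF hα hp he hlam hL hnor hpos i
  -- For `k ≠ i` the commutator formula replaces `∂_i∂_i h_kk` by `∂_k∂_k h_ii`, which the contact
  -- bounds by `∂_k∂_k m`. For `k = i` nothing has to be commuted.
  have hterm : ∑ k, linearizedCoeff F α lam k *
      (dd (0, e i) (dd (0, e i) fun q => lorentz (dd (0, e k) N q) (dd (0, e k) Y q)) p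
      - lam k * dd (0, e i) (dd (0, e i) fun q => lorentz (dd (0, e k) N q) (dd (0, e k) N q)) p)
      ≤ ∑ k, linearizedCoeff F α lam k *
        (dd (0, e k) (dd (0, e k) m) p + (lam i - lam k) * (lam i * lam k - 1)) := by
    refine Finset.sum_le_sum fun k _ => mul_le_mul_of_nonneg_left ?_
      (linearizedCoeff_pos hF hα hlam k).le
    by_cases hik : i = k
    · subst hik
      have := hm2 i
      simp only [sub_self, zero_mul, add_zero]
      exact this
    · have hs := H.toIsNormalMotion.simons_identity hp (heig i) (heig k)
        (by simpa using hL.orthonormal i i) (by simpa using hL.orthonormal k k)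
        (by simpa using hnor i i) (by simpa using hnor k k) (by simpa [hik] using hnor i k)
      rw [hs]
      have := hm2 k
      linarith
  simp only [hm1]
  rw [← hh, ← hg] at hevol
  linarith

end Contact

/-! ## Reparametrization -/

section Reparametrization

variable {n : ℕ} {E C W : Type*} [NormedAddCommGroup E] [NormedSpace ℝ E] [NormedAddCommGroup C]
  [NormedSpace ℝ C] [NormedAddCommGroup W] [NormedSpace ℝ W]

theorem hasFDerivAt_prodMap_id {P : C → E} {q : ℝ × C} (hP : DifferentiableAt ℝ P q.2) :
    HasFDerivAt (fun q : ℝ × C => (q.1, P q.2))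
      ((ContinuousLinearMap.fst ℝ ℝ C).prod
        ((fderiv ℝ P q.2).comp (ContinuousLinearMap.snd ℝ ℝ C))) q :=
  hasFDerivAt_fst.prodMk (hP.hasFDerivAt.comp q hasFDerivAt_snd)

theorem dd_comp_prodMap {f : ℝ × E → W} {P : C → E} {q : ℝ × C} (hP : DifferentiableAt ℝ P q.2)
    (hf : DifferentiableAt ℝ f (q.1, P q.2)) (τ : ℝ) (w : C) :
    dd (τ, w) (fun q : ℝ × C => f (q.1, P q.2)) q = dd (τ, fderiv ℝ P q.2 w) f (q.1, P q.2) := by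
  have := (hf.hasFDerivAt.comp q (hasFDerivAt_prodMap_id hP)).fderiv
  simp only [dd]
  rw [show (fun q : ℝ × C => f (q.1, P q.2)) = f ∘ fun q : ℝ × C => (q.1, P q.2) from rfl, this]
  simp

variable {F : (Fin n → ℝ) → ℝ} {α : ℝ} {Φ : ℝ → ℝ} {U : Set (ℝ × E)}
    {Y N : ℝ × E → Ambient n} {σ : ℝ × E → ℝ}

theorem contDiffOn_comp_prodMap {f : ℝ × E → W} (hf : ContDiffOn ℝ ∞ f U) {P : C → E}
    (hP : ContDiff ℝ ∞ P) {V : Set (ℝ × C)} (hVU : ∀ q ∈ V, (q.1, P q.2) ∈ U) :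
    ContDiffOn ℝ ∞ (fun q : ℝ × C => f (q.1, P q.2)) V :=
  hf.comp (contDiff_fst.prodMk (hP.comp contDiff_snd)).contDiffOn hVU

/-- Normality, the evolution equation and the speed law are expressed by values and directional
derivatives, so they pull back along any smooth time-independent map of the space variable.
Injectivity of its derivative plays no role. -/
theorem IsDualFlow.comp (H : IsDualFlow F α Φ U Y N σ) {P : C → E} (hP : ContDiff ℝ ∞ P)
    {V : Set (ℝ × C)} (hV : IsOpen V) (hVU : ∀ q ∈ V, (q.1, P q.2) ∈ U) :
    IsDualFlow F α Φ V (fun q => Y (q.1, P q.2)) (fun q => N (q.1, P q.2))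
      (fun q => σ (q.1, P q.2)) := by
  have hPd : ∀ z, DifferentiableAt ℝ P z := fun z => (hP.differentiable (by simp)) z
  have hY : ∀ q ∈ V, ∀ v : ℝ × C, dd v (fun q : ℝ × C => Y (q.1, P q.2)) q
      = dd (v.1, fderiv ℝ P q.2 v.2) Y (q.1, P q.2) := fun q hq v =>
    dd_comp_prodMap (hPd _) (differentiableAt_of_smoothOn H.isOpen H.smooth_left (hVU q hq)) _ _
  have hN : ∀ q ∈ V, ∀ v : ℝ × C, dd v (fun q : ℝ × C => N (q.1, P q.2)) q
      = dd (v.1, fderiv ℝ P q.2 v.2) N (q.1, P q.2) := fun q hq v =>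
    dd_comp_prodMap (hPd _) (differentiableAt_of_smoothOn H.isOpen H.smooth_right (hVU q hq)) _ _
  refine ⟨⟨hV, contDiffOn_comp_prodMap H.smooth_left hP hVU,
    contDiffOn_comp_prodMap H.smooth_right hP hVU, contDiffOn_comp_prodMap H.smooth_speed hP hVU,
    fun q hq => H.timelike _ (hVU q hq), fun q hq => H.unit _ (hVU q hq),
    fun q hq => H.normal _ (hVU q hq), fun q hq v => ?_, fun q hq => ?_⟩, ?_⟩
  · rw [hY q hq]; exact H.tangent _ (hVU q hq) _
  · rw [hY q hq, map_zero]; exact H.evolution _ (hVU q hq)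
  · intro q hq L μ hμ hL
    refine H.speed _ (hVU q hq) (fun i => fderiv ℝ P q.2 (L i)) μ hμ ⟨fun i j => ?_, fun i j => ?_⟩
    · have := hL.orthonormal i j
      rwa [hN q hq, hN q hq] at this
    · have := hL.diagonal i j
      rwa [hN q hq, hY q hq] at this

/-- The quadratic map with prescribed value and derivatives at the origin. -/
def quadraticMap (x : E) (L : C →L[ℝ] E) (B : C →L[ℝ] C →L[ℝ] E) (z : C) : E :=
  x + L z + (2⁻¹ : ℝ) • B z z

theorem contDiff_quadraticMap (x : E) (L : C →L[ℝ] E) (B : C →L[ℝ] C →L[ℝ] E) :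
    ContDiff ℝ ∞ (quadraticMap x L B) :=
  (contDiff_const.add L.contDiff).add
    (contDiff_const.smul (B.contDiff.clm_apply contDiff_id))

theorem fderiv_quadraticMap (x : E) (L : C →L[ℝ] E) {B : C →L[ℝ] C →L[ℝ] E}
    (hB : ∀ u w, B u w = B w u) (z w : C) :
    fderiv ℝ (quadraticMap x L B) z w = L w + B z w := by
  have h1 : HasFDerivAt (fun z => B z z) (B z + B.flip z) z := by
    have := B.hasFDerivAt.clm_apply (hasFDerivAt_id z)
    refine this.congr_fderiv ?_
    ext u
    simp
  have h2 : HasFDerivAt (quadraticMap x L B) (L + (2⁻¹ : ℝ) • (B z + B.flip z)) z :=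
    (L.hasFDerivAt.const_add x).add (h1.const_smul (2⁻¹ : ℝ))
  rw [h2.fderiv]
  simp only [add_apply, smul_apply, ContinuousLinearMap.flip_apply, hB w z]
  rw [← two_smul ℝ (B z w), smul_smul]
  norm_num

/-- At the origin the quadratic part contributes only the first-order term `∂_{B(u, w)} f`. This is
the freedom used to remove Christoffel symbols. -/
theorem dd_dd_comp_quadraticMap (hU : IsOpen U) {f : ℝ × E → W} (hf : ContDiffOn ℝ ∞ f U)
    {p : ℝ × E} (hp : p ∈ U) (L : C →L[ℝ] E) {B : C →L[ℝ] C →L[ℝ] E}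
    (hB : ∀ u w, B u w = B w u) (u w : C) :
    dd (0, u) (dd (0, w) fun q : ℝ × C => f (q.1, quadraticMap p.2 L B q.2)) (p.1, 0)
      = dd (0, L u) (dd (0, L w) f) p + dd (0, B u w) f p := by
  set P := quadraticMap p.2 L B with hPdef
  have hP := contDiff_quadraticMap p.2 L B
  have hPd : ∀ z, DifferentiableAt ℝ P z := fun z => (hP.differentiable (by simp)) z
  have hP0 : P 0 = p.2 := by simp [hPdef, quadraticMap]
  have hVopen : IsOpen {q : ℝ × C | (q.1, P q.2) ∈ U} :=
    hU.preimage (continuous_fst.prodMk (hP.continuous.comp continuous_snd))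
  have hmem : ((p.1, 0) : ℝ × C) ∈ {q : ℝ × C | (q.1, P q.2) ∈ U} := by
    simpa [hP0] using hp
  have e1 : EqOn (dd (0, w) fun q : ℝ × C => f (q.1, P q.2))
      (fun q => fderiv ℝ f (q.1, P q.2) (0, L w + B q.2 w)) {q | (q.1, P q.2) ∈ U} :=
    fun q hq => by
      rw [dd_comp_prodMap (hPd _) (differentiableAt_of_smoothOn hU hf hq), hPdef,
        fderiv_quadraticMap _ _ hB]
      rfl
  rw [dd_congr hVopen e1 _ hmem]
  have hfd : DifferentiableAt ℝ (fderiv ℝ f) p :=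
    differentiableAt_of_smoothOn hU (hf.fderiv_of_isOpen hU (by simp)) hp
  have hpt : (((p.1, 0) : ℝ × C).1, P ((p.1, 0) : ℝ × C).2) = p := by simp [hP0]
  have h1 : HasFDerivAt (fun q : ℝ × C => fderiv ℝ f (q.1, P q.2))
      ((fderiv ℝ (fderiv ℝ f) p).comp ((ContinuousLinearMap.fst ℝ ℝ C).prod
        ((fderiv ℝ P 0).comp (ContinuousLinearMap.snd ℝ ℝ C)))) (p.1, 0) := by
    have h0 : HasFDerivAt (fderiv ℝ f) (fderiv ℝ (fderiv ℝ f) p)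
        (((p.1, 0) : ℝ × C).1, P ((p.1, 0) : ℝ × C).2) := by rw [hpt]; exact hfd.hasFDerivAt
    exact h0.comp (p.1, (0 : C)) (hasFDerivAt_prodMap_id (q := (p.1, (0 : C))) (hPd _))
  have h2 : HasFDerivAt (fun q : ℝ × C => ((0 : ℝ), L w + B q.2 w))
      ((0 : ℝ × C →L[ℝ] ℝ).prod ((B.flip w).comp (ContinuousLinearMap.snd ℝ ℝ C))) (p.1, 0) := by
    refine (hasFDerivAt_const (0 : ℝ) _).prodMk ?_
    have : HasFDerivAt (fun q : ℝ × C => L w + (B.flip w) q.2) _ (p.1, 0) :=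
      ((B.flip w).hasFDerivAt.comp (p.1, (0 : C)) hasFDerivAt_snd).const_add (L w)
    simpa only [ContinuousLinearMap.flip_apply] using this
  have h3 := (h1.clm_apply h2).fderiv
  have h4 : dd (0, L u) (dd (0, L w) f) p = fderiv ℝ (fderiv ℝ f) p (0, L u) (0, L w) := by
    change fderiv ℝ (fun q => fderiv ℝ f q (0, L w)) p (0, L u) = _
    rw [fderiv_clm_apply hfd (differentiableAt_const _)]
    simp
  rw [h4]
  simp only [dd]
  rw [h3]
  simp [hPdef, fderiv_quadraticMap _ _ hB, add_comm]
  rw [← hPdef, hP0]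

end Reparametrization

/-! ### The contact inequality in arbitrary coordinates. -/

section GeneralContact

variable {n : ℕ} {F : (Fin n → ℝ) → ℝ} {α : ℝ} {Φ : ℝ → ℝ}
    {E : Type*} [NormedAddCommGroup E] [NormedSpace ℝ E] {U : Set (ℝ × E)}
    {Y N : ℝ × E → Ambient n} {σ : ℝ × E → ℝ}

theorem IsPrincipalFrame.linearIndependent {p : ℝ × E} {L : Fin n → E} {μ : Fin n → ℝ}
    (hL : IsPrincipalFrame Y N p L μ) : LinearIndependent ℝ L := by
  rw [Fintype.linearIndependent_iff]
  intro c hc i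
  have h := congrArg (fun v => lorentz v (dd (0, L i) N p)) (sum_dir N p L c)
  simp only [hc, lorentz_sum_left, lorentz_smul_left, hL.orthonormal] at h
  simpa [dd, show ((0 : ℝ), (0 : E)) = 0 from rfl] using h.symm

/-- The linear map with prescribed values on the standard basis. -/
def frameMap (L : Fin n → E) : EuclideanSpace ℝ (Fin n) →L[ℝ] E :=
  ∑ i, (EuclideanSpace.proj i : EuclideanSpace ℝ (Fin n) →L[ℝ] ℝ).smulRight (L i)

@[simp] theorem frameMap_apply (L : Fin n → E) (z : EuclideanSpace ℝ (Fin n)) :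
    frameMap L z = ∑ i, z i • L i := by
  simp [frameMap]

theorem frameMap_single (L : Fin n → E) (i : Fin n) :
    frameMap L (EuclideanSpace.single i 1) = L i := by
  rw [frameMap_apply, Finset.sum_eq_single i] <;> simp +contextual

/-- The bilinear map with prescribed values on the standard basis. -/
def frameBilin (Q : Fin n → Fin n → E) :
    EuclideanSpace ℝ (Fin n) →L[ℝ] EuclideanSpace ℝ (Fin n) →L[ℝ] E :=
  frameMap fun i => frameMap (Q i)

theorem frameBilin_single (Q : Fin n → Fin n → E) (i j : Fin n) :
    frameBilin Q (EuclideanSpace.single i 1) (EuclideanSpace.single j 1) = Q i j := by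
  rw [frameBilin, frameMap_single, frameMap_single]

theorem frameBilin_symm {Q : Fin n → Fin n → E} (hQ : ∀ i j, Q i j = Q j i)
    (u w : EuclideanSpace ℝ (Fin n)) : frameBilin Q u w = frameBilin Q w u := by
  simp only [frameBilin, frameMap_apply, _root_.sum_apply, _root_.smul_apply, Finset.smul_sum]
  rw [Finset.sum_comm]
  refine Finset.sum_congr rfl fun i _ => Finset.sum_congr rfl fun j _ => ?_
  rw [smul_comm, hQ]

/-- The differential inequality satisfied by an upper barrier `m` for the inverse principal
curvatures at a point of first contact. -/
theorem IsDualFlow.contact_inequality (H : IsDualFlow F α Φ U Y N σ)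
    (hF : IsDualCurvatureFunction F) (hα : 0 < α) {p : ℝ × E} (hp : p ∈ U) {L : Fin n → E}
    {lam : Fin n → ℝ} (hlam : lam ∈ positiveCone n) (hL : IsPrincipalFrame Y N p L lam)
    (hpos : ∀ q ∈ U, q.1 = p.1 → ∀ v ≠ 0, 0 < lorentz (dd (0, v) N q) (dd (0, v) Y q))
    {m : ℝ × E → ℝ} (hm : ContDiffOn ℝ ∞ m U)
    (hcontact : ∀ q ∈ U, q.1 ≤ p.1 → ∀ v, lorentz (dd (0, v) N q) (dd (0, v) Y q)
      ≤ m q * lorentz (dd (0, v) N q) (dd (0, v) N q))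
    {i : Fin n} (hmi : m p = lam i) :
    dd (1, 0) m p ≤ ∑ k, linearizedCoeff F α lam k *
        (dd (0, L k) (dd (0, L k) m) p
          - ∑ j, lorentz (dd (0, L k) (dd (0, L k) N) p) (dd (0, L j) N p) * dd (0, L j) m p
          + (lam i - lam k) * (lam i * lam k - 1))
      + σ p * (1 - lam i ^ 2) - ∑ j, dd (0, L j) m p * dd (0, L j) σ p / lam j := by
  have hU := H.isOpen
  -- `Q` consists of minus the Christoffel terms of the third fundamental form at `p`. In the
  -- coordinates given by `P` the second derivatives of `N` lose their tangential part at the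
  -- origin, which is the normalization of the previous inequality.
  set Q : Fin n → Fin n → E := fun k l =>
    -∑ j, lorentz (dd (0, L k) (dd (0, L l) N) p) (dd (0, L j) N p) • L j with hQ
  have hQs : ∀ k l, Q k l = Q l k := fun k l => by
    simp only [hQ, dd_comm hU H.smooth_right (0, L k) (0, L l) hp]
  set B := frameBilin Q with hBdef
  have hB := frameBilin_symm hQs
  set T := frameMap L with hT
  set P := quadraticMap p.2 T B with hPdef
  have hP : ContDiff ℝ ∞ P := contDiff_quadraticMap p.2 T B
  have hPd : ∀ z, DifferentiableAt ℝ P z := fun z => (hP.differentiable (by simp)) z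
  have hP0 : P 0 = p.2 := by simp [hPdef, quadraticMap]
  have hP' : ∀ z w, fderiv ℝ P z w = T w + B z w := fun z w => fderiv_quadraticMap _ _ hB z w
  have hTinj : Function.Injective T := by
    rw [injective_iff_map_eq_zero]
    intro z hz
    rw [hT, frameMap_apply] at hz
    ext k
    exact Fintype.linearIndependent_iff.1 hL.linearIndependent _ hz k
  -- Where `P` has injective derivative, nonzero directions stay nonzero, so positivity of the
  -- second form pulls back.
  set V : Set (ℝ × EuclideanSpace ℝ (Fin n)) :=
    {q | (q.1, P q.2) ∈ U} ∩ {q | Function.Injective (fderiv ℝ P q.2)} with hVdef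
  have hV : IsOpen V := by
    refine (hU.preimage (continuous_fst.prodMk (hP.continuous.comp continuous_snd))).inter ?_
    exact ContinuousLinearMap.isOpen_injective.preimage
      ((hP.continuous_fderiv (by simp)).comp continuous_snd)
  have hVU : ∀ q ∈ V, (q.1, P q.2) ∈ U := fun q hq => hq.1
  have hpV : ((p.1, 0) : ℝ × EuclideanSpace ℝ (Fin n)) ∈ V := by
    refine ⟨by simpa [hP0] using hp, ?_⟩
    have : ⇑(fderiv ℝ P 0) = T := by ext1 w; simp [hP']
    simp only [mem_ofPred_eq, this]
    exact hTinj
  have hcomp := H.comp hP hV hVU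
  have d1 : ∀ {W : Type} [NormedAddCommGroup W] [NormedSpace ℝ W] {f : ℝ × E → W},
      ContDiffOn ℝ ∞ f U → ∀ q ∈ V, ∀ v : ℝ × EuclideanSpace ℝ (Fin n),
      dd v (fun q : ℝ × EuclideanSpace ℝ (Fin n) => f (q.1, P q.2)) q
      = dd (v.1, fderiv ℝ P q.2 v.2) f (q.1, P q.2) := fun hf q hq v =>
    dd_comp_prodMap (hPd _) (differentiableAt_of_smoothOn hU hf (hVU q hq)) _ _
  have d0 : ∀ {W : Type} [NormedAddCommGroup W] [NormedSpace ℝ W] {f : ℝ × E → W},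
      ContDiffOn ℝ ∞ f U → ∀ j,
      dd (0, EuclideanSpace.single j 1)
        (fun q : ℝ × EuclideanSpace ℝ (Fin n) => f (q.1, P q.2)) (p.1, 0) = dd (0, L j) f p :=
    fun hf j => by
      rw [d1 hf _ hpV]
      simp [hP', hP0, hT, frameMap_single, -frameMap_apply]
  have d2 : ∀ {W : Type} [NormedAddCommGroup W] [NormedSpace ℝ W] {f : ℝ × E → W},
      ContDiffOn ℝ ∞ f U → ∀ k l,
      dd (0, EuclideanSpace.single k 1) (dd (0, EuclideanSpace.single l 1)
        (fun q : ℝ × EuclideanSpace ℝ (Fin n) => f (q.1, P q.2))) (p.1, 0)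
      = dd (0, L k) (dd (0, L l) f) p + dd (0, Q k l) f p := fun hf k l => by
    rw [dd_dd_comp_quadraticMap hU hf hp T hB]
    rw [hT, frameMap_single, frameMap_single, frameBilin_single]
  have hdQ : ∀ {W : Type} [NormedAddCommGroup W] [NormedSpace ℝ W] (f : ℝ × E → W) (k l),
      dd (0, Q k l) f p
        = -∑ j, lorentz (dd (0, L k) (dd (0, L l) N) p) (dd (0, L j) N p) • dd (0, L j) f p := by
    intro W _ _ f k l
    have : ((0 : ℝ), Q k l) = -∑ j, lorentz (dd (0, L k) (dd (0, L l) N) p) (dd (0, L j) N p)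
        • ((0 : ℝ), L j) := by
      ext
      · simp [Prod.fst_sum]
      · simp [Prod.snd_sum, hQ]
    simp only [dd, this, map_neg, map_sum, map_smul]
  have hframe : IsPrincipalFrame (fun q : ℝ × EuclideanSpace ℝ (Fin n) => Y (q.1, P q.2))
      (fun q => N (q.1, P q.2)) (p.1, 0) (fun j => EuclideanSpace.single j 1) lam := by
    constructor
    · intro k l
      rw [d0 H.smooth_right, d0 H.smooth_right]; exact hL.orthonormal k l
    · intro k l
      rw [d0 H.smooth_right, d0 H.smooth_left]; exact hL.diagonal k l
  have hnor : ∀ k l, dd (0, EuclideanSpace.single k 1) (dd (0, EuclideanSpace.single l 1)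
        (fun q : ℝ × EuclideanSpace ℝ (Fin n) => N (q.1, P q.2))) (p.1, 0)
        = if k = l then -N (p.1, P 0) + lam k • Y (p.1, P 0) else 0 := fun k l => by
    rw [d2 H.smooth_right, hdQ, hP0]
    have hfr := H.toIsNormalMotion.isLorentzFrame hp hL
    have hs := hfr.eq_sum (dd (0, L k) (dd (0, L l) N) p)
    rw [H.lorentz_dd_dd_right_left hp, H.lorentz_dd_dd_right_right hp, hL.diagonal,
      hL.orthonormal] at hs
    rw [← sub_eq_add_neg, sub_eq_iff_eq_add]
    refine hs.trans ?_
    congr 1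
    simp only [eq_comm (a := l)]
    split_ifs with hkl
    · subst hkl
      change - -lam k • Y p + -1 • N p = -N p + lam k • Y p
      rw [neg_neg, neg_one_smul, add_comm]
    · simp
  have hli : LinearIndependent ℝ fun j : Fin n => EuclideanSpace.single j (1 : ℝ) := by
    rw [Fintype.linearIndependent_iff]
    intro c hc j
    have := congrArg (fun z : EuclideanSpace ℝ (Fin n) => z j) hc
    simpa [Finset.sum_apply, Pi.single_apply] using this
  have hmain := hcomp.contact_inequality_normal hF hα hpV hli hlam hframe hnor
    (fun q hq hq1 v hv => by
      rw [d1 H.smooth_right q hq, d1 H.smooth_left q hq]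
      exact hpos _ (hVU q hq) hq1 _ fun h0 => hv (hq.2 (by rw [h0, map_zero])))
    (contDiffOn_comp_prodMap hm hP hVU)
    (fun q hq hq1 v => by
      rw [d1 H.smooth_right q hq, d1 H.smooth_left q hq]
      exact hcontact _ (hVU q hq) hq1 _)
    (i := i) (by simpa [hP0] using hmi)
  rw [d1 hm _ hpV] at hmain
  simp only [d0 hm, d0 H.smooth_speed, d2 hm, hdQ, map_zero, hP0, smul_eq_mul] at hmain
  simpa only [← sub_eq_add_neg] using hmain

end GeneralContact

/-! ### Existence of principal frames and eigenvalue comparison. -/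

section PrincipalFrames

variable {n : ℕ} {U : Set (ℝ × EuclideanSpace ℝ (Fin n))}
    {Y N : ℝ × EuclideanSpace ℝ (Fin n) → Ambient n} {σ : ℝ × EuclideanSpace ℝ (Fin n) → ℝ}

/-- Simultaneous diagonalization of the second and third forms. The third is positive definite
because `dN(v) = 0` would make the second form vanish on `v`. -/
theorem IsNormalMotion.exists_principalFrame (H : IsNormalMotion U Y N σ)
    {p : ℝ × EuclideanSpace ℝ (Fin n)} (hp : p ∈ U)
    (hpos : ∀ v ≠ 0, 0 < lorentz (dd (0, v) N p) (dd (0, v) Y p)) :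
    ∃ L, ∃ lam ∈ positiveCone n, IsPrincipalFrame Y N p L lam := by
  set e : Fin n → EuclideanSpace ℝ (Fin n) := fun i => EuclideanSpace.single i 1 with he
  have hvec : ∀ (c : Fin n → ℝ), c ≠ 0 → ∑ k, c k • e k ≠ 0 := fun c hc h0 => by
    apply hc
    funext j
    have := congrArg (fun z : EuclideanSpace ℝ (Fin n) => z j) h0
    simpa [he, Finset.sum_apply, Pi.single_apply] using this
  set gm : Matrix (Fin n) (Fin n) ℝ := Matrix.of fun k l =>
    lorentz (dd (0, e k) N p) (dd (0, e l) N p) with hgm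
  set hm : Matrix (Fin n) (Fin n) ℝ := Matrix.of fun k l =>
    lorentz (dd (0, e k) N p) (dd (0, e l) Y p) with hhm
  have quadg : ∀ c : Fin n → ℝ, c ⬝ᵥ Matrix.mulVec gm c
      = lorentz (dd (0, ∑ k, c k • e k) N p) (dd (0, ∑ k, c k • e k) N p) := fun c => by
    rw [sum_dir, lorentz_sum_sum]
  have quadh : ∀ c : Fin n → ℝ, c ⬝ᵥ Matrix.mulVec hm c
      = lorentz (dd (0, ∑ k, c k • e k) N p) (dd (0, ∑ k, c k • e k) Y p) := fun c => by
    rw [sum_dir, sum_dir, lorentz_sum_sum]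
  obtain ⟨S, d, hS1, hS2⟩ := exists_simultaneous_diagonalization (g := gm) (h := hm)
    (by ext k l; simp [hgm, lorentz_comm])
    (fun c hc => by
      rw [quadg]
      refine lorentz_self_pos (H.timelike p hp) (H.cotangent hp _) fun h0 => ?_
      have := hpos _ (hvec c hc)
      rw [h0, lorentz_zero_left] at this
      exact lt_irrefl _ this)
    (by ext k l; simp only [hhm, Matrix.transpose_apply, Matrix.of_apply];
        exact H.second_form_symm hp _ _)
  refine ⟨fun k => ∑ l, S l k • e l, d, fun j => ?_, ⟨fun k l => ?_, fun k l => ?_⟩⟩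
  · have := entry_transpose_mul_mul S hm j j
    rw [hS2, Matrix.diagonal_apply_eq] at this
    rw [this, quadh]
    exact hpos _ (hvec _ (col_ne_zero hS1 j))
  · rw [sum_dir, sum_dir, lorentz_sum_sum]
    have := entry_transpose_mul_mul S gm k l
    rw [hS1, Matrix.one_apply] at this
    exact this.symm
  · rw [sum_dir, sum_dir, lorentz_sum_sum]
    have := entry_transpose_mul_mul S hm k l
    rw [hS2, Matrix.diagonal_apply] at this
    exact this.symm

theorem IsPrincipalFrame.exists_coeff {p : ℝ × EuclideanSpace ℝ (Fin n)}
    {L : Fin n → EuclideanSpace ℝ (Fin n)} {lam : Fin n → ℝ} (hL : IsPrincipalFrame Y N p L lam)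
    (v : EuclideanSpace ℝ (Fin n)) : ∃ c : Fin n → ℝ, v = ∑ i, c i • L i ∧
      lorentz (dd (0, v) N p) (dd (0, v) N p) = ∑ i, c i ^ 2 ∧
      lorentz (dd (0, v) N p) (dd (0, v) Y p) = ∑ i, lam i * c i ^ 2 := by
  let b := Module.Basis.mk hL.linearIndependent
    (hL.linearIndependent.span_eq_top_of_card_eq_finrank' (by simp)).ge
  have hv : v = ∑ i, b.repr v i • L i := by
    conv_lhs => rw [← b.sum_repr v]
    simp [b]
  refine ⟨fun i => b.repr v i, hv, ?_, ?_⟩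
  · conv_lhs => rw [hv]
    rw [sum_dir, lorentz_sum_left]
    simp only [lorentz_sum_right, lorentz_smul_left, lorentz_smul_right, hL.orthonormal]
    simp [sq]
  · conv_lhs => rw [hv]
    rw [sum_dir, sum_dir, lorentz_sum_left]
    simp only [lorentz_sum_right, lorentz_smul_left, lorentz_smul_right, hL.diagonal]
    simp only [mul_ite, mul_zero, Finset.sum_ite_eq, Finset.mem_univ, if_true]
    exact Finset.sum_congr rfl fun i _ => by ring

theorem IsPrincipalFrame.le_of_le {p : ℝ × EuclideanSpace ℝ (Fin n)}
    {L : Fin n → EuclideanSpace ℝ (Fin n)} {lam : Fin n → ℝ} (hL : IsPrincipalFrame Y N p L lam)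
    {m : ℝ} (hle : ∀ v, lorentz (dd (0, v) N p) (dd (0, v) Y p)
      ≤ m * lorentz (dd (0, v) N p) (dd (0, v) N p)) (k : Fin n) : lam k ≤ m := by
  have := hle (L k)
  rw [hL.diagonal, hL.orthonormal] at this
  simpa using this

/-- Used to find the touching eigenvalue: were all `λ_i < m`, expanding `v₀` in the frame would make
the bound strict. -/
theorem IsPrincipalFrame.exists_eq {p : ℝ × EuclideanSpace ℝ (Fin n)}
    {L : Fin n → EuclideanSpace ℝ (Fin n)} {lam : Fin n → ℝ} (hL : IsPrincipalFrame Y N p L lam)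
    {m : ℝ} (hle : ∀ v, lorentz (dd (0, v) N p) (dd (0, v) Y p)
      ≤ m * lorentz (dd (0, v) N p) (dd (0, v) N p)) {v₀ : EuclideanSpace ℝ (Fin n)} (hv₀ : v₀ ≠ 0)
    (heq : m * lorentz (dd (0, v₀) N p) (dd (0, v₀) N p)
      ≤ lorentz (dd (0, v₀) N p) (dd (0, v₀) Y p)) : ∃ i, lam i = m := by
  obtain ⟨c, hc, h1, h2⟩ := hL.exists_coeff v₀
  rw [h1, h2, Finset.mul_sum] at heq
  by_contra hne
  push Not at hne
  have hlt : ∀ i, lam i < m := fun i => lt_of_le_of_ne (hL.le_of_le hle i) (hne i)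
  have hex : ∃ i, c i ≠ 0 := by
    by_contra h0
    push Not at h0
    exact hv₀ (by rw [hc]; simp [h0])
  obtain ⟨i, hi⟩ := hex
  refine absurd heq (not_le.2 (Finset.sum_lt_sum (fun j _ => ?_) ⟨i, Finset.mem_univ i, ?_⟩))
  · exact mul_le_mul_of_nonneg_right (hlt j).le (sq_nonneg _)
  · exact mul_lt_mul_of_pos_right (hlt i) (by positivity)

end PrincipalFrames

/-! ## Principal curvatures in a principal frame -/

section Eigenvalues

variable {n : ℕ}

/-- Conjugation does not change the characteristic polynomial, so its sorted roots are `d`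
rearranged. There are `n` of them, so the default value in `eigenvalueVector` is never reached. -/
theorem exists_perm_eigenvalueVector {A P Q : Matrix (Fin n) (Fin n) ℝ} {d : Fin n → ℝ}
    (hPQ : P * Q = 1) (hA : A = P * Matrix.diagonal d * Q) :
    ∃ σ : Equiv.Perm (Fin n), eigenvalueVector A = d ∘ σ := by
  have hQP : Q * P = 1 := mul_eq_one_comm.1 hPQ
  have hchar : A.charpoly = ∏ i, (Polynomial.X - Polynomial.C (d i)) := by
    let u : (Matrix (Fin n) (Fin n) ℝ)ˣ := ⟨P, Q, hPQ, hQP⟩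
    have hu : A = u.val * Matrix.diagonal d * u.val⁻¹ := by
      rw [Matrix.inv_eq_right_inv (show u.val * Q = 1 from hPQ)]
      exact hA
    rw [hu, Matrix.charpoly_units_conj, Matrix.charpoly_diagonal]
  have hroots : A.charpoly.roots = Multiset.map d Finset.univ.val := by
    rw [hchar]
    have := Polynomial.roots_multiset_prod_X_sub_C (Multiset.map d Finset.univ.val)
    rwa [Multiset.map_map] at this
  have hsort : A.charpoly.roots.sort (· ≤ ·) = List.ofFn (d ∘ Tuple.sort d) := by
    have h1 : (List.ofFn (d ∘ Tuple.sort d) : Multiset ℝ) = A.charpoly.roots := by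
      rw [hroots, Multiset.coe_eq_coe.2 (Equiv.Perm.ofFn_comp_perm (Tuple.sort d) d)]
      rw [List.ofFn_eq_map]
      rfl
    rw [← h1]
    exact List.mergeSort_eq_self _ (Tuple.monotone_sort d).sortedLE_ofFn.pairwise
  refine ⟨Tuple.sort d, ?_⟩
  funext i
  simp [eigenvalueVector, hsort]

end Eigenvalues

/-! ### The Weingarten matrix in a principal frame. -/

section Differential

variable {n : ℕ} {M : Type*} [TopologicalSpace M] [ChartedSpace (EuclideanSpace ℝ (Fin n)) M]

theorem differential_eq_sum (Y : M → Ambient n) (x : M) (v : EuclideanSpace ℝ (Fin n)) :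
    differential Y x v = ∑ k, v k • partialAt Y x k := by
  have hv : v = ∑ k, v k • EuclideanSpace.single k (1 : ℝ) := by
    ext j
    simp [Finset.sum_apply, Pi.single_apply]
  conv_lhs => rw [hv]
  rw [map_sum]
  simp only [map_smul]
  rfl

/-- The principal curvatures are the inverses of the eigenvalues of the second fundamental form
with respect to the third. -/
theorem exists_perm_principalCurvatures {Y N : M → Ambient n} {x : M}
    {L : Fin n → EuclideanSpace ℝ (Fin n)} {μ : Fin n → ℝ} (hμ : μ ∈ positiveCone n)
    (hort : ∀ i j, lorentz (differential N x (L i)) (differential N x (L j))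
      = if i = j then 1 else 0)
    (heig : ∀ i, differential Y x (L i) = μ i • differential N x (L i)) :
    ∃ σ : Equiv.Perm (Fin n), principalCurvatures Y N x = (fun i => (μ i)⁻¹) ∘ σ := by
  set S : Matrix (Fin n) (Fin n) ℝ := Matrix.of fun k i => L i k with hS
  set g := firstFundamentalForm Y x with hg
  set h := secondFundamentalForm Y N x with hh
  have hgS : S.transpose * g * S = Matrix.diagonal fun i => μ i ^ 2 := by
    ext i j
    rw [entry_transpose_mul_mul]
    have := lorentz_sum_sum (partialAt Y x) (partialAt Y x) (L i) (L j)
    rw [← differential_eq_sum, ← differential_eq_sum, heig, heig, lorentz_smul_left,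
      lorentz_smul_right, hort] at this
    refine this.symm.trans ?_
    rw [Matrix.diagonal_apply]
    split_ifs with hij
    · subst hij; ring
    · ring
  have hhS : S.transpose * h * S = Matrix.diagonal μ := by
    ext i j
    rw [entry_transpose_mul_mul]
    have := lorentz_sum_sum (partialAt N x) (partialAt Y x) (L i) (L j)
    rw [← differential_eq_sum, ← differential_eq_sum, heig, lorentz_smul_right, hort] at this
    refine this.symm.trans ?_
    rw [Matrix.diagonal_apply]
    split_ifs with hij
    · subst hij; ring
    · ring
  have hd2 : (Matrix.diagonal fun i => μ i ^ 2) * Matrix.diagonal (fun i => (μ i ^ 2)⁻¹) = 1 := by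
    rw [Matrix.diagonal_mul_diagonal, ← Matrix.diagonal_one]
    congr 1
    funext i
    have := (hμ i).ne'
    field_simp
  -- `Sᵀ g S = diag(μ²)` makes `Q = g S diag(μ⁻²)` an inverse of `Sᵀ`. Hence `g⁻¹ = S diag(μ⁻²) Sᵀ`,
  -- and `h g⁻¹ = Q diag(μ⁻¹) Sᵀ` is already diagonalized.
  have hTS : S.transpose * (g * S * Matrix.diagonal (fun i => (μ i ^ 2)⁻¹)) = 1 := by
    rw [← Matrix.mul_assoc, ← Matrix.mul_assoc, hgS, hd2]
  set Q := g * S * Matrix.diagonal (fun i => (μ i ^ 2)⁻¹) with hQ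
  have hQT : Q * S.transpose = 1 := mul_eq_one_comm.1 hTS
  have hQTS : S * Q.transpose = 1 := by
    have := congrArg Matrix.transpose hQT
    simpa [Matrix.transpose_mul] using this
  have hginv : g⁻¹ = S * Matrix.diagonal (fun i => (μ i ^ 2)⁻¹) * S.transpose := by
    apply Matrix.inv_eq_right_inv
    rw [← Matrix.mul_assoc, ← Matrix.mul_assoc]
    exact hQT
  have hW : weingarten Y N x = Q * Matrix.diagonal (fun i => (μ i)⁻¹) * S.transpose := by
    have hhS' : h * S = Q * Matrix.diagonal μ := by
      rw [← hhS, ← Matrix.mul_assoc, ← Matrix.mul_assoc, hQT, Matrix.one_mul]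
    rw [weingarten, ← hg, ← hh, hginv, ← Matrix.mul_assoc, ← Matrix.mul_assoc, hhS',
      Matrix.mul_assoc Q, Matrix.diagonal_mul_diagonal]
    congr 3
    funext i
    have := (hμ i).ne'
    field_simp
  exact exists_perm_eigenvalueVector hQT hW

end Differential

/-! ## Time dependent maps in a chart -/

section Chart

variable {n : ℕ} {M : Type*} [TopologicalSpace M] [ChartedSpace (EuclideanSpace ℝ (Fin n)) M]

/-- A time dependent map in the preferred chart at `x₀`. -/
def chartRep (Z : ℝ → M → Ambient n) (x₀ : M) : ℝ × EuclideanSpace ℝ (Fin n) → Ambient n :=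
  fun q => Z q.1 ((extChartAt (𝓡 n) x₀).symm q.2)

/-- The domain of `chartRep`. -/
def chartDomain (T : EReal) (x₀ : M) : Set (ℝ × EuclideanSpace ℝ (Fin n)) :=
  timeInterval T ×ˢ (extChartAt (𝓡 n) x₀).target

theorem convex_timeInterval (T : EReal) : Convex ℝ (timeInterval T) := by
  apply Set.OrdConnected.convex
  refine ⟨fun a ha b hb c hc => ⟨ha.1.trans hc.1, lt_of_le_of_lt ?_ hb.2⟩⟩
  exact_mod_cast hc.2

theorem isOpen_interior_times (T : EReal) : IsOpen {t : ℝ | 0 < t ∧ (t : EReal) < T} :=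
  (isOpen_lt continuous_const continuous_id).inter
    (isOpen_lt continuous_coe_real_ereal continuous_const)

theorem interior_times_subset (T : EReal) : {t : ℝ | 0 < t ∧ (t : EReal) < T} ⊆ timeInterval T :=
  fun _ ht => And.intro (le_of_lt ht.1) ht.2

/-- At `t = 0` only one-sided time derivatives exist; unique differentiability makes derivatives
within the time interval well defined and continuous up to that time. -/
theorem uniqueDiffOn_timeInterval {T : EReal} (hT : 0 < T) : UniqueDiffOn ℝ (timeInterval T) := by
  refine uniqueDiffOn_convex (convex_timeInterval T) ?_
  obtain ⟨s, hs0, hsT⟩ := EReal.lt_iff_exists_real_btwn.1 hT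
  exact ⟨s, interior_maximal (interior_times_subset T) (isOpen_interior_times T)
    (And.intro (by exact_mod_cast hs0) hsT)⟩

theorem uniqueDiffOn_chartDomain {T : EReal} (hT : 0 < T) (x₀ : M) :
    UniqueDiffOn ℝ (chartDomain (n := n) T x₀) :=
  (uniqueDiffOn_timeInterval hT).prod (isOpen_extChartAt_target x₀).uniqueDiffOn

variable [IsManifold (𝓡 n) ∞ M] {T : EReal} {Z : ℝ → M → Ambient n}

theorem contDiffOn_chartRep (hZ : ContMDiffOn (𝓘(ℝ, ℝ).prod (𝓡 n)) 𝓘(ℝ, Ambient n) ∞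
    (fun q : ℝ × M => Z q.1 q.2) (timeInterval T ×ˢ univ)) (x₀ : M) :
    ContDiffOn ℝ ∞ (chartRep Z x₀) (chartDomain T x₀) := by
  rw [← contMDiffOn_iff_contDiffOn, modelWithCornersSelf_prod, ← chartedSpaceSelf_prod]
  have h1 : ContMDiffOn (𝓘(ℝ, ℝ).prod 𝓘(ℝ, EuclideanSpace ℝ (Fin n))) (𝓘(ℝ, ℝ).prod (𝓡 n)) ∞
      (fun q : ℝ × EuclideanSpace ℝ (Fin n) => (q.1, (extChartAt (𝓡 n) x₀).symm q.2))
      (chartDomain T x₀) :=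
    contMDiffOn_fst.prodMk ((contMDiffOn_extChartAt_symm x₀).comp contMDiffOn_snd
      fun q hq => hq.2)
  exact hZ.comp h1 fun q hq => ⟨hq.1, mem_univ _⟩

omit [IsManifold (𝓡 n) ∞ M] in
theorem mdifferentiableAt_slice (hZ : ContMDiffOn (𝓘(ℝ, ℝ).prod (𝓡 n)) 𝓘(ℝ, Ambient n) ∞
    (fun q : ℝ × M => Z q.1 q.2) (timeInterval T ×ˢ univ)) {t : ℝ} (ht : t ∈ timeInterval T)
    (x : M) : MDifferentiableAt (𝓡 n) 𝓘(ℝ, Ambient n) (Z t) x := by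
  have h1 : ContMDiff (𝓡 n) (𝓘(ℝ, ℝ).prod (𝓡 n)) ∞ fun y : M => (t, y) :=
    contMDiff_const.prodMk contMDiff_id
  have h2 : ContMDiffOn (𝓡 n) 𝓘(ℝ, Ambient n) ∞ (Z t) univ :=
    hZ.comp h1.contMDiffOn fun y _ => ⟨ht, mem_univ _⟩
  exact (contMDiffOn_univ.1 h2).mdifferentiableAt (by simp)

/-- The derivative of the inverse of the preferred chart at `x₀`. -/
def chartFrame (x₀ : M) (z : EuclideanSpace ℝ (Fin n)) :
    EuclideanSpace ℝ (Fin n) →L[ℝ] EuclideanSpace ℝ (Fin n) :=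
  mfderiv 𝓘(ℝ, EuclideanSpace ℝ (Fin n)) (𝓡 n) (extChartAt (𝓡 n) x₀).symm z

theorem bijective_chartFrame (x₀ : M) {z : EuclideanSpace ℝ (Fin n)}
    (hz : z ∈ (extChartAt (𝓡 n) x₀).target) : Function.Bijective (chartFrame x₀ z) := by
  have := isInvertible_mfderivWithin_extChartAt_symm (I := 𝓡 n) hz
  rw [ModelWithCorners.range_eq_univ, mfderivWithin_univ] at this
  exact this.bijective

theorem hasFDerivAt_slice (hZ : ContMDiffOn (𝓘(ℝ, ℝ).prod (𝓡 n)) 𝓘(ℝ, Ambient n) ∞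
    (fun q : ℝ × M => Z q.1 q.2) (timeInterval T ×ˢ univ)) {t : ℝ} (ht : t ∈ timeInterval T)
    (x₀ : M) {z : EuclideanSpace ℝ (Fin n)} (hz : z ∈ (extChartAt (𝓡 n) x₀).target) :
    HasFDerivAt (fun z => Z t ((extChartAt (𝓡 n) x₀).symm z))
      ((differential (Z t) ((extChartAt (𝓡 n) x₀).symm z)).comp (chartFrame x₀ z)) z := by
  have h1 := (mdifferentiableAt_slice hZ ht ((extChartAt (𝓡 n) x₀).symm z)).hasMFDerivAt
  have h2 := mdifferentiableWithinAt_extChartAt_symm (I := 𝓡 n) hz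
  rw [ModelWithCorners.range_eq_univ, mdifferentiableWithinAt_univ] at h2
  exact (h1.comp z h2.hasMFDerivAt).hasFDerivAt

/-- The space-time derivative of a time dependent map in a chart, up to the initial time. -/
def chartDeriv (T : EReal) (Z : ℝ → M → Ambient n) (x₀ : M) (q : ℝ × EuclideanSpace ℝ (Fin n)) :
    ℝ × EuclideanSpace ℝ (Fin n) →L[ℝ] Ambient n :=
  fderivWithin ℝ (chartRep Z x₀) (chartDomain T x₀) q

/-- The chart target is open, so in spatial directions the derivative within the domain is the
ordinary one, also at `t = 0`. -/
theorem chartDeriv_space (hZ : ContMDiffOn (𝓘(ℝ, ℝ).prod (𝓡 n)) 𝓘(ℝ, Ambient n) ∞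
    (fun q : ℝ × M => Z q.1 q.2) (timeInterval T ×ˢ univ)) {x₀ : M}
    {q : ℝ × EuclideanSpace ℝ (Fin n)} (hq : q ∈ chartDomain T x₀)
    (v : EuclideanSpace ℝ (Fin n)) : chartDeriv T Z x₀ q (0, v)
      = differential (Z q.1) ((extChartAt (𝓡 n) x₀).symm q.2) (chartFrame x₀ q.2 v) := by
  have h1 := ((contDiffOn_chartRep hZ x₀).differentiableOn (by simp) q hq).hasFDerivWithinAt
  have h2 : HasFDerivWithinAt (fun z : EuclideanSpace ℝ (Fin n) => (q.1, z))
      (ContinuousLinearMap.inr ℝ ℝ (EuclideanSpace ℝ (Fin n))) (extChartAt (𝓡 n) x₀).target q.2 :=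
    (hasFDerivAt_prodMk_right q.1 q.2).hasFDerivWithinAt
  have h3 := h1.comp q.2 h2 fun z hz => mk_mem_prod hq.1 hz
  have h4 := h3.hasFDerivAt ((isOpen_extChartAt_target x₀).mem_nhds hq.2)
  have := h4.unique (hasFDerivAt_slice hZ hq.1 x₀ hq.2)
  exact DFunLike.congr_fun this v

theorem continuousOn_chartDeriv (hT : 0 < T)
    (hZ : ContMDiffOn (𝓘(ℝ, ℝ).prod (𝓡 n)) 𝓘(ℝ, Ambient n) ∞
      (fun q : ℝ × M => Z q.1 q.2) (timeInterval T ×ˢ univ)) (x₀ : M) :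
    ContinuousOn (chartDeriv T Z x₀) (chartDomain T x₀) :=
  (contDiffOn_chartRep hZ x₀).continuousOn_fderivWithin (uniqueDiffOn_chartDomain hT x₀) (by simp)

theorem chartDeriv_time (hT : 0 < T) (hZ : ContMDiffOn (𝓘(ℝ, ℝ).prod (𝓡 n)) 𝓘(ℝ, Ambient n) ∞
    (fun q : ℝ × M => Z q.1 q.2) (timeInterval T ×ˢ univ)) {x₀ : M}
    {q : ℝ × EuclideanSpace ℝ (Fin n)} (hq : q ∈ chartDomain T x₀) {w : Ambient n}
    (hw : HasDerivWithinAt (fun s => Z s ((extChartAt (𝓡 n) x₀).symm q.2)) w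
      (timeInterval T) q.1) : chartDeriv T Z x₀ q (1, 0) = w := by
  have h1 := ((contDiffOn_chartRep hZ x₀).differentiableOn (by simp) q hq).hasFDerivWithinAt
  have h2 : HasFDerivWithinAt (fun s : ℝ => (s, q.2))
      (ContinuousLinearMap.inl ℝ ℝ (EuclideanSpace ℝ (Fin n))) (timeInterval T) q.1 :=
    (hasFDerivAt_prodMk_left q.1 q.2).hasFDerivWithinAt
  have h3 := (h1.comp q.1 h2 fun s hs => mk_mem_prod hs hq.2).hasDerivWithinAt
  have := (uniqueDiffOn_timeInterval hT q.1 hq.1).eq_deriv _ h3 hw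
  simpa [chartDeriv] using this

/-- The interior of the domain of `chartRep`. -/
def chartInterior (T : EReal) (x₀ : M) : Set (ℝ × EuclideanSpace ℝ (Fin n)) :=
  {t : ℝ | 0 < t ∧ (t : EReal) < T} ×ˢ (extChartAt (𝓡 n) x₀).target

omit [IsManifold (𝓡 n) ∞ M] in
theorem isOpen_chartInterior (T : EReal) (x₀ : M) : IsOpen (chartInterior (n := n) T x₀) :=
  (isOpen_interior_times T).prod (isOpen_extChartAt_target x₀)

omit [IsManifold (𝓡 n) ∞ M] in
theorem chartInterior_subset (T : EReal) (x₀ : M) :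
    chartInterior (n := n) T x₀ ⊆ chartDomain T x₀ :=
  prod_mono (interior_times_subset T) subset_rfl

omit [IsManifold (𝓡 n) ∞ M] in
theorem dd_chartRep {x₀ : M} {q : ℝ × EuclideanSpace ℝ (Fin n)} (hq : q ∈ chartInterior T x₀)
    (v : ℝ × EuclideanSpace ℝ (Fin n)) : dd v (chartRep Z x₀) q = chartDeriv T Z x₀ q v := by
  have : chartDomain T x₀ ∈ 𝓝 q :=
    Filter.mem_of_superset ((isOpen_chartInterior T x₀).mem_nhds hq) (chartInterior_subset T x₀)
  rw [dd, chartDeriv, fderivWithin_of_mem_nhds this]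

end Chart

/-! ## The dual curvature function -/

section DualFunction

variable {n : ℕ} {f : (Fin n → ℝ) → ℝ}

theorem inv_mem_positiveCone {x : Fin n → ℝ} (hx : x ∈ positiveCone n) :
    (fun i => (x i)⁻¹) ∈ positiveCone n := fun i => inv_pos.2 (hx i)

/-- Monotonicity survives because the two inversions each reverse it: the chain rule produces two
minus signs. Computing the derivative along a coordinate line and comparing it with `fderiv` makes
this explicit. -/
theorem IsCurvatureFunction.isDualCurvatureFunction (hf : IsCurvatureFunction f)
    (hinv : IsInverseConcave f) : IsDualCurvatureFunction (dualFunction f) := by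
  have hpos : ∀ x ∈ positiveCone n, 0 < f fun i => (x i)⁻¹ := fun x hx =>
    hf.positive _ (inv_mem_positiveCone hx)
  refine ⟨hinv, fun σ x hx => ?_, fun x hx => inv_pos.2 (hpos x hx), ?_, fun x hx i => ?_⟩
  · have := hf.symmetric σ _ (inv_mem_positiveCone hx)
    simp only [dualFunction]
    rw [← this]
    rfl
  · have h1 : ContDiffOn ℝ ∞ (fun x : Fin n → ℝ => fun i => (x i)⁻¹) (positiveCone n) :=
      contDiffOn_pi.2 fun i => (contDiff_apply ℝ ℝ i).contDiffOn.inv fun x hx => (hx i).ne'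
    exact (hf.smooth.comp h1 fun x hx => inv_mem_positiveCone hx).inv fun x hx => (hpos x hx).ne'
  · have hy := inv_mem_positiveCone hx
    have hfd : HasFDerivAt f (fderiv ℝ f fun i => (x i)⁻¹) fun i => (x i)⁻¹ :=
      ((hf.smooth.contDiffAt (isOpen_positiveCone.mem_nhds hy)).differentiableAt
        (by simp)).hasFDerivAt
    have hline : HasDerivAt (fun s : ℝ => fun j => ((x + s • Pi.single i (1 : ℝ) : Fin n → ℝ) j)⁻¹)
        (-((x i ^ 2)⁻¹) • (Pi.single i 1 : Fin n → ℝ)) 0 := by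
      rw [hasDerivAt_pi]
      intro j
      have h1 : HasDerivAt (fun s : ℝ => (x + s • Pi.single i (1 : ℝ) : Fin n → ℝ) j)
          ((Pi.single i 1 : Fin n → ℝ) j) 0 := by
        simpa using ((hasDerivAt_id (0 : ℝ)).mul_const ((Pi.single i 1 : Fin n → ℝ) j)).const_add
          (x j)
      have h2 := h1.fun_inv (by simpa using (hx j).ne')
      refine h2.congr_deriv ?_
      by_cases hij : j = i
      · subst hij
        simp [neg_div]
      · simp [hij]
    have h0 : (fun j => ((x + (0 : ℝ) • Pi.single i (1 : ℝ) : Fin n → ℝ) j)⁻¹)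
        = fun j => (x j)⁻¹ := by simp
    have h3 : HasDerivAt (fun s : ℝ => dualFunction f (x + s • Pi.single i (1 : ℝ)))
        (-(fderiv ℝ f (fun i => (x i)⁻¹) (-((x i ^ 2)⁻¹) • (Pi.single i 1 : Fin n → ℝ)))
          / (f fun i => (x i)⁻¹) ^ 2) 0 := by
      have h4 := (h0.symm ▸ hfd).comp_hasDerivAt 0 hline
      have h5 := h4.fun_inv (by simpa [h0] using (hpos x hx).ne')
      simpa [dualFunction, Function.comp_def] using h5
    have hF : DifferentiableAt ℝ (dualFunction f) x := by
      have h1 : ContDiffOn ℝ ∞ (fun x : Fin n → ℝ => fun i => (x i)⁻¹) (positiveCone n) :=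
        contDiffOn_pi.2 fun i => (contDiff_apply ℝ ℝ i).contDiffOn.inv fun x hx => (hx i).ne'
      have h2 : ContDiffOn ℝ ∞ (dualFunction f) (positiveCone n) :=
        (hf.smooth.comp h1 fun x hx => inv_mem_positiveCone hx).inv fun x hx => (hpos x hx).ne'
      exact (h2.contDiffAt (isOpen_positiveCone.mem_nhds hx)).differentiableAt (by simp)
    have h6 : HasDerivAt (fun s : ℝ => dualFunction f (x + s • Pi.single i (1 : ℝ)))
        (fderiv ℝ (dualFunction f) x (Pi.single i 1)) 0 := by
      have h1 : HasDerivAt (fun s : ℝ => x + s • (Pi.single i (1 : ℝ) : Fin n → ℝ))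
          (Pi.single i 1) 0 := by
        simpa using ((hasDerivAt_id (0 : ℝ)).smul_const (Pi.single i (1 : ℝ))).const_add x
      have h2 : HasFDerivAt (dualFunction f) (fderiv ℝ (dualFunction f) x)
          (x + (0 : ℝ) • (Pi.single i (1 : ℝ) : Fin n → ℝ)) := by simpa using hF.hasFDerivAt
      exact h2.comp_hasDerivAt 0 h1
    rw [h6.unique h3, map_smul, smul_eq_mul, neg_mul, neg_neg]
    have := hf.increasing _ hy i
    have := hx i
    have := hpos x hx
    positivity

end DualFunction

/-! ## The flow in a chart -/

section FlowInChart

variable {n : ℕ} {M : Type*} [TopologicalSpace M] [ChartedSpace (EuclideanSpace ℝ (Fin n)) M]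
  {f : (Fin n → ℝ) → ℝ} {α : ℝ} {φ : ℝ → ℝ} {T : EReal} {X ν : ℝ → M → Ambient n}

theorem IsUnitNormal.lorentz_differential {Y N : M → Ambient n} (h : IsUnitNormal Y N) (x : M)
    (v : EuclideanSpace ℝ (Fin n)) : lorentz (N x) (differential Y x v) = 0 := by
  rw [differential_eq_sum, lorentz_sum_right]
  exact Finset.sum_eq_zero fun i _ => by rw [lorentz_smul_right, (h x).2 i, mul_zero]

/-- The normal velocity in a chart. -/
def chartSpeed (T : EReal) (X ν : ℝ → M → Ambient n) (x₀ : M)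
    (q : ℝ × EuclideanSpace ℝ (Fin n)) : ℝ :=
  lorentz (chartDeriv T X x₀ q (1, 0)) (chartRep ν x₀ q)

variable [IsManifold (𝓡 n) ∞ M]

theorem IsCurvatureFlow.chartDeriv_time_eq (hflow : IsCurvatureFlow f α φ T X ν) (hT : 0 < T)
    {x₀ : M} {q : ℝ × EuclideanSpace ℝ (Fin n)} (hq : q ∈ chartDomain T x₀) :
    chartDeriv T X x₀ q (1, 0) = (φ q.1 - f (principalCurvatures (X q.1) (ν q.1)
      ((extChartAt (𝓡 n) x₀).symm q.2)) ^ α) • chartRep ν x₀ q :=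
  chartDeriv_time hT hflow.smooth hq (hflow.evolution q.1 hq.1 _)

theorem IsCurvatureFlow.chartSpeed_eq (hflow : IsCurvatureFlow f α φ T X ν) (hT : 0 < T)
    {x₀ : M} {q : ℝ × EuclideanSpace ℝ (Fin n)} (hq : q ∈ chartDomain T x₀) :
    chartSpeed T X ν x₀ q = φ q.1 - f (principalCurvatures (X q.1) (ν q.1)
      ((extChartAt (𝓡 n) x₀).symm q.2)) ^ α := by
  rw [chartSpeed, hflow.chartDeriv_time_eq hT hq, lorentz_smul_left]
  have := (hflow.unit_normal q.1 hq.1 ((extChartAt (𝓡 n) x₀).symm q.2)).1.1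
  simp only [chartRep, this, mul_one]

/-- The speed is defined as `⟨∂ₜX, ν⟩`, so it is smooth without any regularity of `φ`, and without
knowing that `κ` lies in the cone. -/
theorem IsCurvatureFlow.isNormalMotion (hflow : IsCurvatureFlow f α φ T X ν) (hT : 0 < T)
    (x₀ : M) : IsNormalMotion (chartInterior T x₀) (chartRep X x₀) (chartRep ν x₀)
      (chartSpeed T X ν x₀) := by
  have hsub := chartInterior_subset (n := n) T x₀
  have hX := (contDiffOn_chartRep hflow.smooth x₀).mono hsub
  have hν := (contDiffOn_chartRep hflow.smooth_normal x₀).mono hsub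
  have hopen := isOpen_chartInterior (n := n) T x₀
  refine ⟨hopen, hX, hν, ?_, fun q hq => ?_, fun q hq => ?_, fun q hq => ?_, fun q hq v => ?_,
    fun q hq => ?_⟩
  · refine (contDiffOn_lorentz (contDiffOn_dd hopen hX (1, 0)) hν).congr fun q hq => ?_
    rw [chartSpeed, dd_chartRep hq]
  · exact (hflow.mem_hyperbolicSpace q.1 (hsub hq).1 _).1
  · exact (hflow.unit_normal q.1 (hsub hq).1 _).1.1
  · exact (hflow.unit_normal q.1 (hsub hq).1 _).1.2
  · rw [dd_chartRep hq, chartDeriv_space hflow.smooth (hsub hq)]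
    exact (hflow.unit_normal q.1 (hsub hq).1).lorentz_differential _ _
  · rw [dd_chartRep hq, hflow.chartSpeed_eq hT (hsub hq), hflow.chartDeriv_time_eq hT (hsub hq)]

/-- In a frame with positive eigenvalues `μ` the principal curvatures are a permutation of `1/μ`,
and `f(1/μ)^α = f_*(μ)^(-α)`. -/
theorem IsCurvatureFlow.isDualFlow (hflow : IsCurvatureFlow f α φ T X ν) (hT : 0 < T)
    (hf : IsCurvatureFunction f) (x₀ : M) :
    IsDualFlow (dualFunction f) α φ (chartInterior T x₀) (chartRep X x₀) (chartRep ν x₀)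
      (chartSpeed T X ν x₀) := by
  have hmotion := hflow.isNormalMotion hT x₀
  refine ⟨hmotion, fun q hq L μ hμ hL => ?_⟩
  have hq' := chartInterior_subset (n := n) T x₀ hq
  have heig := hmotion.dd_left_eq hq hL
  have hort := hL.orthonormal
  simp only [dd_chartRep hq, chartDeriv_space hflow.smooth hq',
    chartDeriv_space hflow.smooth_normal hq'] at heig hort
  obtain ⟨σ, hσ⟩ := exists_perm_principalCurvatures hμ hort heig
  have hy := inv_mem_positiveCone hμ
  rw [hflow.chartSpeed_eq hT hq', hσ, hf.symmetric σ _ hy, dualFunction,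
    Real.inv_rpow (hf.positive _ hy).le, Real.rpow_neg (hf.positive _ hy).le, inv_inv]

end FlowInChart

/-! ## The initial hypersurface -/

section Initial

variable {n : ℕ}

/-- The horoball is cut out by the null vector `p + w`. With `a = -⟨y, p⟩ ≥ 1` and `b = ⟨y, w⟩`,
lying in a ball of radius `s` says `a cosh s - b sinh s < cosh s`. This forces `b > 0`, and `sinh s
< cosh s` then gives `a - b < 1`. -/
theorem neg_lorentz_le_of_mem_horoball {p w y : Ambient n} (hp : p ∈ hyperbolicSpace n)
    (hy : y ∈ horoball p w) : -lorentz y (p + w) ≤ 1 := by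
  simp only [horoball, mem_iUnion] at hy
  obtain ⟨s, hs, hyH, hys⟩ := hy
  have hs : 0 < s := hs
  have h1 : -lorentz y (geodesic p w s) < Real.cosh s := by
    -- `Real.arcosh` inverts `cosh` only from `1` on; below `1` the bound is trivial.
    by_cases hx : 1 ≤ -lorentz y (geodesic p w s)
    · rw [← Real.cosh_arcosh hx]
      exact Real.cosh_lt_cosh.2 (by
        rw [abs_of_nonneg (Real.arcosh_nonneg hx), abs_of_pos hs]; exact hys)
    · exact (not_le.1 hx).trans_le (Real.one_le_cosh s)
  -- Reversed Cauchy-Schwarz for two points of the upper sheet.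
  have hA : 1 ≤ -lorentz y p := by
    have hcs := spatial_cauchy_schwarz y p
    rw [hyH.1, hp.1] at hcs
    have hy1 := spatial_nonneg y
    have hp1 := spatial_nonneg p
    rw [hyH.1] at hy1
    rw [hp.1] at hp1
    have hy2 : 1 ≤ y 0 := by nlinarith [hyH.2]
    have hp2 : 1 ≤ p 0 := by nlinarith [hp.2]
    have hyp : 1 ≤ y 0 * p 0 := by nlinarith
    have : (lorentz y p + y 0 * p 0) ^ 2 ≤ (y 0 * p 0 - 1) ^ 2 := by
      nlinarith [sq_nonneg (y 0 - p 0)]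
    have := abs_le_of_sq_le_sq' this (by linarith)
    linarith [this.2]
  simp only [geodesic, lorentz_add_right, lorentz_smul_right] at h1 ⊢
  have hc := Real.cosh_pos s
  have hsh := Real.sinh_pos_iff.2 hs
  have hlt := Real.sinh_lt_cosh s
  have hB : 0 < lorentz y w := by
    by_contra hneg
    push Not at hneg
    nlinarith
  have : Real.cosh s * (-lorentz y p - lorentz y w - 1) < 0 := by nlinarith
  nlinarith

theorem tendsto_geodesic (p v : Ambient n) :
    Filter.Tendsto (geodesic p v) (𝓝[>] 0) (𝓝 p) := by
  have : Continuous (geodesic p v) := by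
    unfold geodesic
    fun_prop
  have h := this.tendsto 0
  simp only [geodesic, Real.cosh_zero, Real.sinh_zero, one_smul, zero_smul, add_zero] at h
  exact h.mono_left nhdsWithin_le_nhds

theorem eventually_geodesic_mem {p v : Ambient n} (hp : p ∈ hyperbolicSpace n)
    (hv : IsUnitTangent p v) : ∀ᶠ s in 𝓝[>] (0 : ℝ), geodesic p v s ∈ hyperbolicSpace n := by
  have h0 : Filter.Tendsto (fun s => geodesic p v s 0) (𝓝[>] 0) (𝓝 (p 0)) :=
    ((timeCoord n).continuous.tendsto p).comp (tendsto_geodesic p v)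
  filter_upwards [h0.eventually_const_lt hp.2] with s hs
  refine ⟨?_, hs⟩
  simp only [geodesic, lorentz_add_left, lorentz_add_right, lorentz_smul_left, lorentz_smul_right,
    hp.1, hv.1, hv.2, lorentz_comm p v]
  nlinarith [Real.cosh_sq s]

theorem PointsOutward.mem_closure {Ω : Set (Ambient n)} {p v : Ambient n}
    (h : PointsOutward Ω p v) : p ∈ closure Ω := by
  obtain ⟨ε, hε, hs⟩ := h
  refine mem_closure_of_tendsto (tendsto_geodesic p (-v)) ?_
  filter_upwards [Ioo_mem_nhdsGT hε] with s hs' using (hs s hs').1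

theorem PointsOutward.mem_hypBoundary {Ω : Set (Ambient n)} {p v : Ambient n}
    (h : PointsOutward Ω p v) (hp : p ∈ hyperbolicSpace n) (hv : IsUnitTangent p v) :
    p ∈ hypBoundary Ω := by
  refine ⟨h.mem_closure, ?_⟩
  obtain ⟨ε, hε, hs⟩ := h
  refine mem_closure_of_tendsto (tendsto_geodesic p v) ?_
  filter_upwards [Ioo_mem_nhdsGT hε, eventually_geodesic_mem hp hv] with s hs' hH
  exact ⟨hH, (hs s hs').2⟩

/-- A linear immersion with tangential image admits a Lorentz-orthonormal frame. -/
theorem exists_isLorentzFrame {p ν : Ambient n} (hp : lorentz p p = -1) (hν : IsUnitTangent p ν)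
    {D : EuclideanSpace ℝ (Fin n) →L[ℝ] Ambient n} (hinj : Function.Injective D)
    (h1 : ∀ v, lorentz (D v) p = 0) (h2 : ∀ v, lorentz (D v) ν = 0) :
    ∃ L : Fin n → EuclideanSpace ℝ (Fin n), IsLorentzFrame p ν fun i => D (L i) := by
  have hD : ∀ c : Fin n → ℝ, D (WithLp.toLp 2 c)
      = ∑ k, c k • D (EuclideanSpace.single k 1) := fun c => by
    have hv : WithLp.toLp 2 c = ∑ k, c k • EuclideanSpace.single k (1 : ℝ) := by
      ext j
      simp [Finset.sum_apply, Pi.single_apply]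
    rw [hv, map_sum]
    simp only [map_smul]
  set g : Matrix (Fin n) (Fin n) ℝ := Matrix.of fun i j =>
    lorentz (D (EuclideanSpace.single i 1)) (D (EuclideanSpace.single j 1)) with hg
  obtain ⟨S, -, hS, -⟩ := exists_simultaneous_diagonalization (g := g) (h := 0)
    (by ext i j; simp [hg, lorentz_comm])
    (fun c hc => by
      rw [← lorentz_sum_sum, ← hD]
      refine lorentz_self_pos hp (h1 _) fun h0 => hc ?_
      have := hinj (h0.trans (map_zero D).symm)
      funext j
      simpa using congrArg (fun z : EuclideanSpace ℝ (Fin n) => z j) this)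
    (by simp)
  refine ⟨fun i => WithLp.toLp 2 fun k => S k i, hp, hν.1, hν.2, fun i => h1 _, fun i => h2 _,
    fun i j => ?_⟩
  have := entry_transpose_mul_mul S g i j
  rw [hS, Matrix.one_apply] at this
  rw [this, hD, hD, lorentz_sum_sum]

variable {M : Type*} [TopologicalSpace M] [ChartedSpace (EuclideanSpace ℝ (Fin n)) M]
  [IsManifold (𝓡 n) ∞ M] {f : (Fin n → ℝ) → ℝ} {α : ℝ} {φ : ℝ → ℝ} {T : EReal}
  {X ν : ℝ → M → Ambient n}

theorem contDiffOn_slice {Z : ℝ → M → Ambient n}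
    (hZ : ContMDiffOn (𝓘(ℝ, ℝ).prod (𝓡 n)) 𝓘(ℝ, Ambient n) ∞
    (fun q : ℝ × M => Z q.1 q.2) (timeInterval T ×ˢ univ)) {t : ℝ} (ht : t ∈ timeInterval T)
    (x₀ : M) : ContDiffOn ℝ ∞ (fun z => Z t ((extChartAt (𝓡 n) x₀).symm z))
      (extChartAt (𝓡 n) x₀).target :=
  (contDiffOn_chartRep hZ x₀).comp (contDiff_const.prodMk contDiff_id).contDiffOn
    fun _ hz => mk_mem_prod ht hz

/-- Second order comparison of a hypersurface of the flow with a level set of a linear form which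
supports it at `x`. -/
theorem IsCurvatureFlow.second_order_touching (hflow : IsCurvatureFlow f α φ T X ν) {t : ℝ}
    (ht : t ∈ timeInterval T) {x : M} {c : Ambient n}
    (hmin : ∀ y, lorentz (X t x) c ≤ lorentz (X t y) c) (v : EuclideanSpace ℝ (Fin n)) :
    lorentz (differential (X t) x v) c = 0 ∧ ∃ a : Ambient n,
      lorentz (X t x) a = -lorentz (differential (X t) x v) (differential (X t) x v) ∧
      lorentz (ν t x) a = -lorentz (differential (ν t) x v) (differential (X t) x v) ∧
      0 ≤ lorentz a c := by
  set e := extChartAt (𝓡 n) x with he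
  set Y := fun z => X t (e.symm z) with hY
  set N := fun z => ν t (e.symm z) with hN
  have hopen : IsOpen e.target := isOpen_extChartAt_target x
  have hYs : ContDiffOn ℝ ∞ Y e.target := contDiffOn_slice hflow.smooth ht x
  have hNs : ContDiffOn ℝ ∞ N e.target := contDiffOn_slice hflow.smooth_normal ht x
  set z := e x with hz
  have hzt : z ∈ e.target := mem_extChartAt_target x
  have hzx : e.symm z = x := extChartAt_to_inv x
  obtain ⟨w, hw⟩ := (bijective_chartFrame (n := n) x hzt).2 v
  have hYd : ∀ y ∈ e.target, ∀ u, dd u Y y = differential (X t) (e.symm y) (chartFrame x y u) :=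
    fun y hy u => by
      rw [dd, (hasFDerivAt_slice hflow.smooth ht x hy).fderiv]; rfl
  have hNd : ∀ y ∈ e.target, ∀ u, dd u N y = differential (ν t) (e.symm y) (chartFrame x y u) :=
    fun y hy u => by
      rw [dd, (hasFDerivAt_slice hflow.smooth_normal ht x hy).fderiv]; rfl
  have hYv : dd w Y z = differential (X t) x v := by rw [hYd z hzt, hw, hzx]
  have hNv : dd w N z = differential (ν t) x v := by rw [hNd z hzt, hw, hzx]
  have hYY : EqOn (fun y => lorentz (Y y) (Y y)) (fun _ => -1) e.target := fun y _ =>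
    (hflow.mem_hyperbolicSpace t ht _).1
  have hNY : EqOn (fun y => lorentz (N y) (dd w Y y)) (fun _ => 0) e.target := fun y hy => by
    simp only [hYd y hy]
    exact (hflow.unit_normal t ht).lorentz_differential _ _
  have hYdY : EqOn (fun y => lorentz (Y y) (dd w Y y)) (fun _ => 0) e.target := fun y hy => by
    have h1 := dd_congr hopen hYY w hy
    rw [dd_lorentz_on hopen hYs hYs w hy, dd_const] at h1
    simp only [lorentz_comm (dd w Y y)] at h1 ⊢
    linarith
  have hYs' := contDiffOn_dd hopen hYs w
  -- Differentiating `⟨Y, ∂_w Y⟩ = 0` and `⟨N, ∂_w Y⟩ = 0` once more gives the products of `∂_w∂_w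
  -- Y`, the vector `a` of the statement, with `Y` and `N`.
  have e1 := dd_congr hopen hYdY w hzt
  rw [dd_lorentz_on hopen hYs hYs' w hzt, dd_const] at e1
  have e2 := dd_congr hopen hNY w hzt
  rw [dd_lorentz_on hopen hNs hYs' w hzt, dd_const] at e2
  simp only [hYv, hNv] at e1 e2
  have hfs : ContDiffOn ℝ ∞ (fun y => lorentz (Y y) c - lorentz (Y z) c) e.target :=
    (contDiffOn_lorentz hYs contDiffOn_const).sub contDiffOn_const
  have htest := dd_dd_nonneg_of_cubic_bound hopen hfs hzt (v := w) (by simp) (C := 0)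
    (Filter.Eventually.of_forall fun s => by
      simp only [zero_mul, neg_zero, sub_nonneg]
      have := hmin (e.symm (z + s • w))
      simpa only [hY, hzx] using this)
  have hd1 : ∀ {G : EuclideanSpace ℝ (Fin n) → Ambient n}, ContDiffOn ℝ ∞ G e.target →
      ∀ k : ℝ, EqOn (dd w fun y => lorentz (G y) c - k) (fun y => lorentz (dd w G y) c) e.target :=
    fun {G} hG k y hy => by
      rw [dd_sub (differentiableAt_of_smoothOn hopen (contDiffOn_lorentz hG contDiffOn_const) hy)
        (differentiableAt_const _), dd_const, sub_zero,
        dd_lorentz_on hopen hG contDiffOn_const w hy]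
      simp [dd_const]
  rw [hd1 hYs _ hzt, dd_congr hopen (hd1 hYs _) w hzt] at htest
  have h2 := hd1 hYs' 0 hzt
  simp only [sub_zero] at h2
  rw [h2] at htest
  simp only [hYv] at htest
  have hYz : Y z = X t x := by simp only [hY, hzx]
  have hNz : N z = ν t x := by simp only [hN, hzx]
  refine ⟨htest.1, dd w (dd w Y) z, ?_, ?_, htest.2⟩
  · rw [← hYz]; linarith
  · rw [← hNz]; linarith

theorem zero_mem_timeInterval (hT : 0 < T) : (0 : ℝ) ∈ timeInterval T :=
  And.intro le_rfl (by exact_mod_cast hT)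

theorem IsCurvatureFlow.lorentz_differential_left (hflow : IsCurvatureFlow f α φ T X ν)
    {t : ℝ} (ht : t ∈ timeInterval T) (x : M) (v : EuclideanSpace ℝ (Fin n)) :
    lorentz (differential (X t) x v) (X t x) = 0 := by
  have hopen : IsOpen (extChartAt (𝓡 n) x).target := isOpen_extChartAt_target x
  have hYs : ContDiffOn ℝ ∞ (fun z => X t ((extChartAt (𝓡 n) x).symm z))
    (extChartAt (𝓡 n) x).target := contDiffOn_slice hflow.smooth ht x
  have hz := mem_extChartAt_target (I := 𝓡 n) x
  obtain ⟨w, hw⟩ := (bijective_chartFrame (n := n) x hz).2 v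
  have hYd : dd w (fun z => X t ((extChartAt (𝓡 n) x).symm z)) (extChartAt (𝓡 n) x x)
      = differential (X t) x v := by
    rw [dd, (hasFDerivAt_slice hflow.smooth ht x hz).fderiv]
    conv_rhs => rw [← hw]
    simp only [extChartAt_to_inv]
    rfl
  have h1 := dd_congr hopen (f := fun z => lorentz (X t ((extChartAt (𝓡 n) x).symm z))
    (X t ((extChartAt (𝓡 n) x).symm z))) (g := fun _ => -1)
    (fun y _ => (hflow.mem_hyperbolicSpace t ht _).1) w hz
  rw [dd_lorentz_on hopen hYs hYs w hz, dd_const] at h1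
  simp only [hYd, extChartAt_to_inv] at h1
  rw [lorentz_comm (X t x)] at h1
  linarith

theorem IsCurvatureFlow.exists_isLorentzFrame (hflow : IsCurvatureFlow f α φ T X ν)
    {t : ℝ} (ht : t ∈ timeInterval T) (x : M) :
    ∃ L : Fin n → EuclideanSpace ℝ (Fin n),
      IsLorentzFrame (X t x) (ν t x) fun i => differential (X t) x (L i) :=
  HypFlow.exists_isLorentzFrame (hflow.mem_hyperbolicSpace t ht x).1 (hflow.unit_normal t ht x).1
    (hflow.immersion t ht x) (hflow.lorentz_differential_left ht x)
    fun v => by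
      rw [lorentz_comm]
      exact (hflow.unit_normal t ht).lorentz_differential x v

/-- The initial hypersurface has principal curvatures at least `1`. -/
theorem IsCurvatureFlow.initial_pinching (hflow : IsCurvatureFlow f α φ T X ν) (hT : 0 < T)
    (hconvex : IsHConvexHypersurface (X 0)) (x : M) (v : EuclideanSpace ℝ (Fin n)) :
    lorentz (differential (X 0) x v) (differential (X 0) x v)
      ≤ lorentz (differential (ν 0) x v) (differential (X 0) x v) := by
  have h0 := zero_mem_timeInterval hT
  set Ω := enclosedDomain (range (X 0)) with hΩ
  set p := X 0 x with hp
  have hpH := hflow.mem_hyperbolicSpace 0 h0 x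
  have hν := (hflow.unit_normal 0 h0 x).1
  have hout := hflow.outward_zero x
  obtain ⟨w, hw, hsub⟩ := hconvex p (hout.mem_hypBoundary hpH hν)
  -- The horoball condition is a closed linear inequality, so it passes to the closure of the
  -- domain, which contains `M_0`. Equality at `p` makes `x` a minimum of the linear form.
  have hle : ∀ y ∈ closure Ω, -lorentz y (p + w) ≤ 1 := by
    intro y hy
    have hcl : IsClosed {y : Ambient n | -lorentz y (p + w) ≤ 1} := by
      have : Continuous fun y : Ambient n => -lorentz y (p + w) := by
        have h : Continuous fun y : Ambient n => lorentz y (p + w) :=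
          ((lorentzL n).flip (p + w)).continuous.congr fun y => by
            rw [ContinuousLinearMap.flip_apply, lorentzL_apply]
        exact h.neg
      exact isClosed_le this continuous_const
    exact closure_minimal (fun y hy => neg_lorentz_le_of_mem_horoball hpH (hsub hy)) hcl hy
  have hpw : lorentz p (p + w) = -1 := by
    rw [lorentz_add_right, hpH.1, lorentz_comm p w, hw.2, add_zero]
  have hmin : ∀ y, lorentz (X 0 x) (p + w) ≤ lorentz (X 0 y) (p + w) := fun y => by
    have := hle _ (hflow.outward_zero y).mem_closure
    rw [← hp, hpw]
    linarith
  -- The inward geodesic stays in the horoball: `cosh s + sinh s ⟨ν, w⟩ ≤ 1`, and `cosh s > 1`.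
  have hneg : lorentz (ν 0 x) w < 0 := by
    obtain ⟨ε, hε, hs⟩ := hout
    have h1 := hle _ (subset_closure (hs (ε / 2) ⟨by linarith, by linarith⟩).1)
    have hνw : lorentz (ν 0 x) (p + w) = lorentz (ν 0 x) w := by
      rw [lorentz_add_right, hν.2, zero_add]
    rw [geodesic, lorentz_add_left, lorentz_smul_left, lorentz_smul_left, lorentz_neg_left, ← hp,
      hpw, hνw] at h1
    have h2 := Real.one_lt_cosh.2 (show ε / 2 ≠ 0 by positivity)
    have h3 := Real.sinh_pos_iff.2 (show 0 < ε / 2 by positivity)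
    by_contra hcon
    push Not at hcon
    nlinarith [mul_nonneg h3.le hcon]
  -- The first order condition makes `w` normal to the hypersurface, hence `w = ±ν`, and the sign
  -- was just found.
  have hwν : w = -ν 0 x := by
    obtain ⟨L, hL⟩ := hflow.exists_isLorentzFrame h0 x
    have hz : ∀ i, lorentz w (differential (X 0) x (L i)) = 0 := fun i => by
      have := (hflow.second_order_touching h0 hmin (L i)).1
      rw [lorentz_add_right, hp, hL.tangent_left, zero_add] at this
      rw [lorentz_comm]; exact this
    have h1 := hL.eq_sum w
    simp only [hz, zero_smul, Finset.sum_const_zero, add_zero] at h1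
    rw [← hp, hw.2, neg_zero, zero_smul, zero_add] at h1
    have h2 := hw.1
    rw [h1] at h2
    simp only [lorentz_smul_left, lorentz_smul_right, hν.1, mul_one] at h2
    rw [lorentz_comm] at hneg
    have h3 : lorentz w (ν 0 x) = -1 := by
      rcases mul_self_eq_one_iff.1 h2 with h | h
      · linarith
      · exact h
    rw [h3, neg_one_smul] at h1
    exact h1
  -- With `w = -ν` the second order condition `⟨a, p - ν⟩ ≥ 0` reads `-g + h ≥ 0`.
  obtain ⟨-, a, ha1, ha2, ha3⟩ := hflow.second_order_touching h0 hmin v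
  rw [hwν, lorentz_add_right, lorentz_neg_right, lorentz_comm a, lorentz_comm a, hp, ha1, ha2] at ha3
  linarith

/-- At a point of the initial hypersurface furthest away from the origin all principal curvatures
are bigger than `1`. -/
theorem IsCurvatureFlow.exists_initial_strict [CompactSpace M] [Nonempty M]
    (hflow : IsCurvatureFlow f α φ T X ν) (hT : 0 < T) (hconvex : IsHConvexHypersurface (X 0)) :
    ∃ x : M, ∀ v ≠ 0, lorentz (differential (X 0) x v) (differential (X 0) x v)
      < lorentz (differential (ν 0) x v) (differential (X 0) x v) := by
  have h0 := zero_mem_timeInterval hT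
  obtain ⟨x, -, hx⟩ := isCompact_univ.exists_isMaxOn univ_nonempty
    ((timeCoord n).continuous.comp hflow.embedding_zero.continuous).continuousOn
  set c : Ambient n := EuclideanSpace.single 0 1 with hc
  have hcoord : ∀ y : Ambient n, lorentz y c = -y 0 := fun y => by
    simp [lorentz, hc]
  have hmin : ∀ y, lorentz (X 0 x) c ≤ lorentz (X 0 y) c := fun y => by
    rw [hcoord, hcoord]
    exact neg_le_neg (hx (mem_univ y))
  refine ⟨x, fun v hv => ?_⟩
  obtain ⟨L, hL⟩ := hflow.exists_isLorentzFrame h0 x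
  have hz : ∀ i, lorentz c (differential (X 0) x (L i)) = 0 := fun i => by
    rw [lorentz_comm]; exact (hflow.second_order_touching h0 hmin (L i)).1
  obtain ⟨-, a, ha1, ha2, ha3⟩ := hflow.second_order_touching h0 hmin v
  have hcc := hL.lorentz_eq c c
  rw [hL.lorentz_eq a c] at ha3
  simp only [hz, mul_zero, Finset.sum_const_zero, add_zero] at ha3 hcc
  rw [lorentz_comm a, lorentz_comm a, ha1, ha2] at ha3
  simp only [lorentz_comm c, hcoord] at hcc ha3
  have hc0 : c 0 = 1 := by simp [hc]
  rw [hc0] at hcc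
  have hpH := hflow.mem_hyperbolicSpace 0 h0 x
  have hle := hflow.initial_pinching hT hconvex x v
  have hg : 0 < lorentz (differential (X 0) x v) (differential (X 0) x v) :=
    lorentz_self_pos hpH.1 (hflow.lorentz_differential_left h0 x v) fun h =>
      hv (hflow.immersion 0 h0 x (h.trans (map_zero _).symm))
  set g := lorentz (differential (X 0) x v) (differential (X 0) x v)
  set h := lorentz (differential (ν 0) x v) (differential (X 0) x v)
  have hp0 := hpH.2
  -- At the highest point `e₀` is a combination of `X` and `ν` alone, so `X₀² = 1 + ν₀²`, and
  -- touching gives `h ν₀ ≥ g X₀`. If `h = g` this yields `ν₀ ≥ X₀ > 0`, a contradiction; `h ≥ g` is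
  -- already known.
  by_contra hcon
  have hgh : h = g := le_antisymm (not_lt.1 hcon) hle
  rw [hgh] at ha3
  have h1 : X 0 x 0 ≤ ν 0 x 0 := by
    have : 0 ≤ g * (ν 0 x 0 - X 0 x 0) := by linarith
    linarith [nonneg_of_mul_nonneg_right this hg]
  nlinarith

end Initial

/-! ## First times -/

section FirstTime

variable {W : Type*} [TopologicalSpace W]

/-- If a property is open relative to a compact set of space-time and fails somewhere, then it fails
for a first time. -/
theorem exists_first_failure {S : Set (ℝ × W)} (hS : IsCompact S) (hS' : IsClosed S)
    {P : ℝ × W → Prop} (hP : ∀ q ∈ S, P q → ∀ᶠ q' in 𝓝[S] q, P q') (hne : ∃ q ∈ S, ¬P q) :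
    ∃ q ∈ S, ¬P q ∧ ∀ q' ∈ S, q'.1 < q.1 → P q' := by
  have hclosed : IsClosed {q | q ∈ S ∧ ¬P q} := by
    rw [← isOpen_compl_iff, isOpen_iff_mem_nhds]
    intro q hq
    by_cases hqS : q ∈ S
    · have hPq : P q := by
        by_contra h
        exact hq (And.intro hqS h)
      filter_upwards [eventually_nhdsWithin_iff.1 (hP q hqS hPq)] with q' hq' hcon
      exact hcon.2 (hq' hcon.1)
    · filter_upwards [hS'.isOpen_compl.mem_nhds hqS] with q' hq' hcon
      exact hq' hcon.1
  obtain ⟨q, hq, hmin⟩ := (hS.of_isClosed_subset hclosed fun q hq => hq.1).exists_isMinOn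
    (let ⟨q, h1, h2⟩ := hne; ⟨q, And.intro h1 h2⟩) continuous_fst.continuousOn
  refine ⟨q, hq.1, hq.2, fun q' hq' hlt => ?_⟩
  by_contra hcon
  exact absurd (hmin (And.intro hq' hcon)) (not_le.2 hlt)

/-- Positive definiteness of a continuous family of quadratic forms is an open condition. -/
theorem eventually_posDef {E : Type*} [NormedAddCommGroup E] [NormedSpace ℝ E] [ProperSpace E]
    {D : Set W} {Q : W → E → ℝ} (hQ : ContinuousOn (fun p : W × E => Q p.1 p.2) (D ×ˢ univ))
    (hhom : ∀ q ∈ D, ∀ (r : ℝ) v, Q q (r • v) = r ^ 2 * Q q v) {q₀ : W} (hq₀ : q₀ ∈ D)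
    (hpos : ∀ v ≠ 0, 0 < Q q₀ v) : ∀ᶠ q in 𝓝[D] q₀, ∀ v ≠ 0, 0 < Q q v := by
  -- By homogeneity the unit sphere suffices, and its compactness makes the neighbourhood uniform in
  -- `v`.
  have h1 : ∀ᶠ q in 𝓝 q₀, ∀ v ∈ Metric.sphere (0 : E) 1, q ∈ D → 0 < Q q v := by
    refine (isCompact_sphere (0 : E) 1).eventually_forall_of_forall_eventually
      (P := fun q v => q ∈ D → 0 < Q q v) fun v hv => ?_
    have hv0 : v ≠ 0 := by
      rintro rfl
      simp at hv
    have h2 := (hQ (q₀, v) (mk_mem_prod hq₀ (mem_univ v))).eventually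
      (lt_mem_nhds (hpos v hv0))
    filter_upwards [eventually_nhdsWithin_iff.1 h2] with z hz hzD
    exact hz (mk_mem_prod hzD (mem_univ _))
  filter_upwards [mem_nhdsWithin_of_mem_nhds h1, self_mem_nhdsWithin] with q hq hqD v hv
  have hv' : 0 < ‖v‖ := norm_pos_iff.2 hv
  have h3 := hq (‖v‖⁻¹ • v) (by simp [norm_smul, hv'.ne']) hqD
  rw [hhom q hqD] at h3
  exact pos_of_mul_pos_right h3 (by positivity)

end FirstTime

/-! ## The fundamental forms along the flow -/

section Forms

variable {n : ℕ} {M : Type*} [TopologicalSpace M] [ChartedSpace (EuclideanSpace ℝ (Fin n)) M]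

/-- The quadratic form `v ↦ ⟨dA(v), dB(v)⟩` on the tangent space at `x` at time `t`. -/
def pairing (A B : ℝ → M → Ambient n) (t : ℝ) (x : M) (v : EuclideanSpace ℝ (Fin n)) : ℝ :=
  lorentz (differential (A t) x v) (differential (B t) x v)

theorem pairing_smul (A B : ℝ → M → Ambient n) (t : ℝ) (x : M) (r : ℝ)
    (v : EuclideanSpace ℝ (Fin n)) : pairing A B t x (r • v) = r ^ 2 * pairing A B t x v := by
  simp only [pairing, map_smul, lorentz_smul_left, lorentz_smul_right]
  ring

theorem _root_.ContinuousOn.lorentz {W : Type*} [TopologicalSpace W] {D : Set W}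
    {A B : W → Ambient n} (hA : ContinuousOn A D) (hB : ContinuousOn B D) :
    ContinuousOn (fun q => lorentz (A q) (B q)) D := by
  have := ((lorentzL n).continuous.comp_continuousOn hA).clm_apply hB
  exact this.congr fun q _ => (lorentzL_apply _ _).symm

/-- `pairing` in a chart. -/
def chartPairing (T : EReal) (A B : ℝ → M → Ambient n) (x₀ : M)
    (q : ℝ × EuclideanSpace ℝ (Fin n)) (v : EuclideanSpace ℝ (Fin n)) : ℝ :=
  lorentz (chartDeriv T A x₀ q (0, v)) (chartDeriv T B x₀ q (0, v))

theorem chartPairing_smul (T : EReal) (A B : ℝ → M → Ambient n) (x₀ : M)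
    (q : ℝ × EuclideanSpace ℝ (Fin n)) (r : ℝ) (v : EuclideanSpace ℝ (Fin n)) :
    chartPairing T A B x₀ q (r • v) = r ^ 2 * chartPairing T A B x₀ q v := by
  have : ((0 : ℝ), r • v) = r • ((0 : ℝ), v) := by simp
  simp only [chartPairing, this, map_smul, lorentz_smul_left, lorentz_smul_right]
  ring

variable [IsManifold (𝓡 n) ∞ M] {f : (Fin n → ℝ) → ℝ} {α : ℝ} {φ : ℝ → ℝ} {T : EReal}
  {X ν : ℝ → M → Ambient n}

theorem continuousOn_chartPairing {A B : ℝ → M → Ambient n} (hT : 0 < T)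
    (hA : ContMDiffOn (𝓘(ℝ, ℝ).prod (𝓡 n)) 𝓘(ℝ, Ambient n) ∞
      (fun q : ℝ × M => A q.1 q.2) (timeInterval T ×ˢ univ))
    (hB : ContMDiffOn (𝓘(ℝ, ℝ).prod (𝓡 n)) 𝓘(ℝ, Ambient n) ∞
      (fun q : ℝ × M => B q.1 q.2) (timeInterval T ×ˢ univ)) (x₀ : M) :
    ContinuousOn (fun p : (ℝ × EuclideanSpace ℝ (Fin n)) × EuclideanSpace ℝ (Fin n) =>
      chartPairing T A B x₀ p.1 p.2) (chartDomain T x₀ ×ˢ univ) := by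
  have hv : ContinuousOn (fun p : (ℝ × EuclideanSpace ℝ (Fin n)) × EuclideanSpace ℝ (Fin n) =>
      ((0 : ℝ), p.2)) (chartDomain T x₀ ×ˢ univ) :=
    (continuous_const.prodMk continuous_snd).continuousOn
  have h : ∀ {Z : ℝ → M → Ambient n}, ContMDiffOn (𝓘(ℝ, ℝ).prod (𝓡 n)) 𝓘(ℝ, Ambient n) ∞
      (fun q : ℝ × M => Z q.1 q.2) (timeInterval T ×ˢ univ) →
      ContinuousOn (fun p : (ℝ × EuclideanSpace ℝ (Fin n)) × EuclideanSpace ℝ (Fin n) =>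
        chartDeriv T Z x₀ p.1 (0, p.2)) (chartDomain T x₀ ×ˢ univ) := fun {Z} hZ =>
    ((continuousOn_chartDeriv hT hZ x₀).comp continuousOn_fst fun p hp => hp.1).clm_apply hv
  exact (h hA).lorentz (h hB)

theorem chartPairing_eq {A B : ℝ → M → Ambient n}
    (hA : ContMDiffOn (𝓘(ℝ, ℝ).prod (𝓡 n)) 𝓘(ℝ, Ambient n) ∞
      (fun q : ℝ × M => A q.1 q.2) (timeInterval T ×ˢ univ))
    (hB : ContMDiffOn (𝓘(ℝ, ℝ).prod (𝓡 n)) 𝓘(ℝ, Ambient n) ∞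
      (fun q : ℝ × M => B q.1 q.2) (timeInterval T ×ˢ univ)) {x₀ : M}
    {q : ℝ × EuclideanSpace ℝ (Fin n)} (hq : q ∈ chartDomain T x₀)
    (v : EuclideanSpace ℝ (Fin n)) : chartPairing T A B x₀ q v
      = pairing A B q.1 ((extChartAt (𝓡 n) x₀).symm q.2) (chartFrame x₀ q.2 v) := by
  rw [chartPairing, chartDeriv_space hA hq, chartDeriv_space hB hq, pairing]

omit [IsManifold (𝓡 n) ∞ M] in
theorem tendsto_chart (t : ℝ) (x₀ : M) :
    Filter.Tendsto (fun q : ℝ × M => (q.1, extChartAt (𝓡 n) x₀ q.2))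
      (𝓝[timeInterval T ×ˢ univ] (t, x₀)) (𝓝[chartDomain T x₀] (t, extChartAt (𝓡 n) x₀ x₀)) := by
  refine tendsto_nhdsWithin_iff.2 ⟨?_, ?_⟩
  · refine Filter.Tendsto.mono_left ?_ nhdsWithin_le_nhds
    exact (continuousAt_fst.prodMk ((continuousAt_extChartAt (I := 𝓡 n) x₀).comp
      (x := (t, x₀)) continuousAt_snd))
  · have h1 : ∀ᶠ q : ℝ × M in 𝓝 (t, x₀), q.2 ∈ (extChartAt (𝓡 n) x₀).source :=
      continuousAt_snd.eventually (extChartAt_source_mem_nhds (I := 𝓡 n) x₀)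
    filter_upwards [self_mem_nhdsWithin, mem_nhdsWithin_of_mem_nhds h1] with q hq hq'
    exact mk_mem_prod hq.1 ((extChartAt (𝓡 n) x₀).map_source hq')

omit [IsManifold (𝓡 n) ∞ M] in
theorem eventually_chart_symm (t : ℝ) (x₀ : M) :
    ∀ᶠ q : ℝ × M in 𝓝[timeInterval T ×ˢ univ] (t, x₀),
      (extChartAt (𝓡 n) x₀).symm (extChartAt (𝓡 n) x₀ q.2) = q.2 ∧
      extChartAt (𝓡 n) x₀ q.2 ∈ (extChartAt (𝓡 n) x₀).target := by
  have h1 : ∀ᶠ q : ℝ × M in 𝓝 (t, x₀), q.2 ∈ (extChartAt (𝓡 n) x₀).source :=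
    continuousAt_snd.eventually (extChartAt_source_mem_nhds (I := 𝓡 n) x₀)
  filter_upwards [mem_nhdsWithin_of_mem_nhds h1] with q hq
  exact ⟨(extChartAt (𝓡 n) x₀).left_inv hq, (extChartAt (𝓡 n) x₀).map_source hq⟩

/-- Positive definiteness of linear combinations of the fundamental forms is an open condition. -/
theorem eventually_pairing_pos (hT : 0 < T) (hflow : IsCurvatureFlow f α φ T X ν) {c d : ℝ → ℝ}
    (hc : Continuous c) (hd : Continuous d) {t : ℝ} (ht : t ∈ timeInterval T) {x : M}
    (hpos : ∀ v ≠ 0, 0 < c t * pairing X X t x v + d t * pairing ν X t x v) :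
    ∀ᶠ q : ℝ × M in 𝓝[timeInterval T ×ˢ univ] (t, x),
      ∀ v ≠ 0, 0 < c q.1 * pairing X X q.1 q.2 v + d q.1 * pairing ν X q.1 q.2 v := by
  set e := extChartAt (𝓡 n) x with he
  have hq₀ : (t, e x) ∈ chartDomain T x := mk_mem_prod ht (mem_extChartAt_target x)
  have hcont : ContinuousOn
      (fun p : (ℝ × EuclideanSpace ℝ (Fin n)) × EuclideanSpace ℝ (Fin n) =>
        c p.1.1 * chartPairing T X X x p.1 p.2 + d p.1.1 * chartPairing T ν X x p.1 p.2)
      (chartDomain T x ×ˢ univ) :=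
    ((hc.comp (continuous_fst.comp continuous_fst)).continuousOn.mul
      (continuousOn_chartPairing hT hflow.smooth hflow.smooth x)).add
    ((hd.comp (continuous_fst.comp continuous_fst)).continuousOn.mul
      (continuousOn_chartPairing hT hflow.smooth_normal hflow.smooth x))
  have key : ∀ {q : ℝ × EuclideanSpace ℝ (Fin n)}, q ∈ chartDomain T x →
      ((∀ v ≠ 0, 0 < c q.1 * chartPairing T X X x q v + d q.1 * chartPairing T ν X x q v) ↔
        ∀ v ≠ 0, 0 < c q.1 * pairing X X q.1 (e.symm q.2) v
          + d q.1 * pairing ν X q.1 (e.symm q.2) v) := by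
    intro q hq
    have hbij := bijective_chartFrame (n := n) x hq.2
    simp only [chartPairing_eq hflow.smooth hflow.smooth hq,
      chartPairing_eq hflow.smooth_normal hflow.smooth hq]
    constructor
    · intro h v hv
      obtain ⟨w, rfl⟩ := hbij.2 v
      exact h w fun hw => hv (by rw [hw, map_zero])
    · intro h v hv
      exact h _ fun hw => hv (hbij.1 (hw.trans (map_zero _).symm))
  have h1 := eventually_posDef (Q := fun q v =>
      c q.1 * chartPairing T X X x q v + d q.1 * chartPairing T ν X x q v) hcont (fun q _ r v => by
    simp only [chartPairing_smul]; ring) hq₀ ((key hq₀).2 (by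
      simpa only [he, extChartAt_to_inv] using hpos))
  filter_upwards [(tendsto_chart t x).eventually h1, eventually_chart_symm (n := n) t x,
    self_mem_nhdsWithin] with q h2 h3 h4
  have h5 := (key (q := (q.1, e q.2)) (mk_mem_prod h4.1 h3.2)).1 h2
  have h6 : e.symm (e q.2) = q.2 := h3.1
  simpa only [h6] using h5

omit [IsManifold (𝓡 n) ∞ M] in
theorem continuousOn_of_chart {G : ℝ × M → ℝ}
    (hG : ∀ x₀ : M, ContinuousOn (fun q : ℝ × EuclideanSpace ℝ (Fin n) =>
      G (q.1, (extChartAt (𝓡 n) x₀).symm q.2)) (chartDomain T x₀)) :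
    ContinuousOn G (timeInterval T ×ˢ univ) := by
  rintro ⟨t, x⟩ hq
  have h1 := (hG x (t, extChartAt (𝓡 n) x x) (mk_mem_prod hq.1 (mem_extChartAt_target x))).tendsto
  have h2 := h1.comp (tendsto_chart t x)
  simp only [extChartAt_to_inv] at h2
  refine h2.congr' ?_
  filter_upwards [eventually_chart_symm (n := n) t x] with q hq'
  simp only [Function.comp_apply, hq'.1]

/-- Neither `φ` nor `f ∘ κ` need be continuous separately; the difference is, being `⟨∂ₜX, ν⟩`. -/
theorem IsCurvatureFlow.continuousOn_speed (hflow : IsCurvatureFlow f α φ T X ν) (hT : 0 < T) :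
    ContinuousOn (fun q : ℝ × M => φ q.1 - f (principalCurvatures (X q.1) (ν q.1) q.2) ^ α)
      (timeInterval T ×ˢ univ) := by
  refine continuousOn_of_chart (n := n) fun x₀ => ?_
  have h1 : ContinuousOn (chartSpeed T X ν x₀) (chartDomain T x₀) :=
    ((continuousOn_chartDeriv hT hflow.smooth x₀).clm_apply continuousOn_const).lorentz
      (contDiffOn_chartRep hflow.smooth_normal x₀).continuousOn
  exact h1.congr fun q hq => (hflow.chartSpeed_eq hT hq).symm

theorem IsCurvatureFlow.continuousOn_pairing_time (hflow : IsCurvatureFlow f α φ T X ν)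
    (hT : 0 < T) (x : M) (v : EuclideanSpace ℝ (Fin n)) :
    ContinuousOn (fun t => pairing X X t x v) (timeInterval T) ∧
    ContinuousOn (fun t => pairing ν X t x v) (timeInterval T) := by
  obtain ⟨w, hw⟩ := (bijective_chartFrame (n := n) x (mem_extChartAt_target x)).2 v
  have h : ∀ {A : ℝ → M → Ambient n}, ContMDiffOn (𝓘(ℝ, ℝ).prod (𝓡 n)) 𝓘(ℝ, Ambient n) ∞
      (fun q : ℝ × M => A q.1 q.2) (timeInterval T ×ˢ univ) →
      ContinuousOn (fun t => pairing A X t x v) (timeInterval T) := fun {A} hA => by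
    have h1 : ContinuousOn (fun t : ℝ => (((t, extChartAt (𝓡 n) x x), w) :
        (ℝ × EuclideanSpace ℝ (Fin n)) × EuclideanSpace ℝ (Fin n))) (timeInterval T) := by
      fun_prop
    refine ((continuousOn_chartPairing hT hA hflow.smooth x).comp h1 fun t ht =>
      mk_mem_prod (mk_mem_prod ht (mem_extChartAt_target x)) (mem_univ _)).congr fun t ht => ?_
    simp only [Function.comp_apply]
    rw [chartPairing_eq hA hflow.smooth (mk_mem_prod ht (mem_extChartAt_target x)), hw,
      extChartAt_to_inv]
  exact ⟨h hflow.smooth, h hflow.smooth_normal⟩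

theorem IsCurvatureFlow.pairing_self_pos (hflow : IsCurvatureFlow f α φ T X ν) {t : ℝ}
    (ht : t ∈ timeInterval T) (x : M) {v : EuclideanSpace ℝ (Fin n)} (hv : v ≠ 0) :
    0 < pairing X X t x v :=
  lorentz_self_pos (hflow.mem_hyperbolicSpace t ht x).1 (hflow.lorentz_differential_left ht x v)
    fun h => hv (hflow.immersion t ht x (h.trans (map_zero _).symm))

/-- The principal curvatures are bounded above on compact time intervals. -/
theorem IsCurvatureFlow.exists_curvature_bound [CompactSpace M]
    (hflow : IsCurvatureFlow f α φ T X ν) (hT : 0 < T) {t₁ : ℝ} (ht₁ : t₁ ∈ timeInterval T) :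
    ∃ C : ℝ, 1 ≤ C ∧ ∀ t ∈ Icc 0 t₁, ∀ x v, pairing ν X t x v ≤ C * pairing X X t x v := by
  have hsub : Icc 0 t₁ ×ˢ (univ : Set M) ⊆ timeInterval T ×ˢ univ :=
    prod_mono (fun t ht => And.intro ht.1 (lt_of_le_of_lt (by exact_mod_cast ht.2) ht₁.2))
      subset_rfl
  suffices h : ∃ C : ℝ, 1 ≤ C ∧ ∀ q ∈ Icc 0 t₁ ×ˢ (univ : Set M), ∀ v ≠ 0,
      pairing ν X q.1 q.2 v < C * pairing X X q.1 q.2 v by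
    obtain ⟨C, hC, h⟩ := h
    refine ⟨C, hC, fun t ht x v => ?_⟩
    by_cases hv : v = 0
    · simp [hv, pairing]
    · exact (h (t, x) (mk_mem_prod ht (mem_univ x)) v hv).le
  have hcomp : IsCompact (Icc 0 t₁ ×ˢ (univ : Set M)) := isCompact_Icc.prod isCompact_univ
  have hmono : ∀ {C C' : ℝ} {q : ℝ × M}, q ∈ timeInterval T ×ˢ (univ : Set M) → C ≤ C' →
      (∀ v ≠ 0, pairing ν X q.1 q.2 v < C * pairing X X q.1 q.2 v) →
      ∀ v ≠ 0, pairing ν X q.1 q.2 v < C' * pairing X X q.1 q.2 v :=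
    fun {C C' q} hq hC h v hv => (h v hv).trans_le
      (mul_le_mul_of_nonneg_right hC (hflow.pairing_self_pos hq.1 _ hv).le)
  -- Locally the bound comes from the maximum of the quotient of the two forms on the unit sphere at
  -- one point, and openness of positive definiteness extends it to a neighbourhood.
  refine hcomp.induction_on (p := fun S => ∃ C : ℝ, 1 ≤ C ∧ ∀ q ∈ S ∩ (timeInterval T ×ˢ univ),
    ∀ v ≠ 0, pairing ν X q.1 q.2 v < C * pairing X X q.1 q.2 v) ⟨1, le_rfl, by simp⟩
    (fun S S' hS ⟨C, hC, h⟩ => ⟨C, hC, fun q hq => h q ⟨hS hq.1, hq.2⟩⟩)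
    (fun S S' ⟨C, hC, h⟩ ⟨C', hC', h'⟩ => ⟨max C C', le_max_of_le_left hC, fun q hq => ?_⟩)
    (fun q hq => ?_) |>.imp fun C h => ⟨h.1, fun q hq => h.2 q ⟨hq, hsub hq⟩⟩
  · rcases hq.1 with hqS | hqS
    · exact hmono hq.2 (le_max_left _ _) (h q ⟨hqS, hq.2⟩)
    · exact hmono hq.2 (le_max_right _ _) (h' q ⟨hqS, hq.2⟩)
  · obtain ⟨t, x⟩ := q
    have ht := (hsub hq).1
    have hcont : ∀ A : ℝ → M → Ambient n, Continuous fun v => pairing A X t x v := fun A => by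
      have := ((differential (A t) x).continuous.continuousOn (s := univ)).lorentz
        (differential (X t) x).continuous.continuousOn
      exact continuousOn_univ.1 this
    have hbdd : BddAbove ((fun v => pairing ν X t x v / pairing X X t x v) ''
        Metric.sphere (0 : EuclideanSpace ℝ (Fin n)) 1) := by
      refine (isCompact_sphere _ _).bddAbove_image
        ((hcont ν).continuousOn.div (hcont X).continuousOn fun v hv => ?_)
      exact (hflow.pairing_self_pos ht x (by rintro rfl; simp at hv)).ne'
    obtain ⟨C, hC⟩ := hbdd
    have hlt : ∀ v ≠ 0, 0 < (max 1 (C + 1)) * pairing X X t x v + (-1) * pairing ν X t x v := by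
      intro v hv
      have hv' : 0 < ‖v‖ := norm_pos_iff.2 hv
      have hg := hflow.pairing_self_pos ht x hv
      have h1 : pairing ν X t x v / pairing X X t x v ≤ C := by
        have := hC (mem_image_of_mem _
          (show ‖v‖⁻¹ • v ∈ Metric.sphere (0 : EuclideanSpace ℝ (Fin n)) 1 by
            simp [norm_smul, hv'.ne']))
        simp only [pairing_smul] at this
        rwa [mul_div_mul_left _ _ (by positivity)] at this
      rw [div_le_iff₀ hg] at h1
      nlinarith [le_max_right 1 (C + 1)]
    have := eventually_pairing_pos hT hflow (c := fun _ => max 1 (C + 1)) (d := fun _ => -1)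
      continuous_const continuous_const ht hlt
    refine ⟨_, mem_nhdsWithin_of_mem_nhds (eventually_nhdsWithin_iff.1 this), max 1 (C + 1),
      le_max_left _ _, fun q hq v hv => ?_⟩
    have := hq.1 hq.2 v hv
    linarith

end Forms

/-! ## Preservation of weak h-convexity -/

section PrincipalFrames

variable {n : ℕ} {F : (Fin n → ℝ) → ℝ} {α : ℝ}

theorem IsDualCurvatureFunction.continuousOn_linearizedCoeff (hF : IsDualCurvatureFunction F)
    (k : Fin n) : ContinuousOn (fun lam => linearizedCoeff F α lam k) (positiveCone n) := by
  have h1 : ContinuousOn (fun lam => F lam ^ (-α - 1)) (positiveCone n) :=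
    hF.smooth.continuousOn.rpow_const fun x hx => Or.inl (hF.positive x hx).ne'
  have h2 : ContinuousOn (fun lam => fderiv ℝ F lam (Pi.single k 1)) (positiveCone n) :=
    (hF.smooth.continuousOn_fderiv_of_isOpen isOpen_positiveCone (by simp)).clm_apply
      continuousOn_const
  exact (continuousOn_const.mul h1).mul h2

/-- On compact boxes in the positive cone the linearized operator is uniformly elliptic. -/
theorem IsDualCurvatureFunction.exists_linearizedCoeff_bounds (hF : IsDualCurvatureFunction F)
    (hα : 0 < α) {a b : ℝ} (ha : 0 < a) : ∃ c C : ℝ, 0 < c ∧ 0 < C ∧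
      ∀ lam : Fin n → ℝ, (∀ k, a ≤ lam k ∧ lam k ≤ b) → ∀ k,
        c ≤ linearizedCoeff F α lam k ∧ linearizedCoeff F α lam k ≤ C := by
  have hK : IsCompact (Icc (fun _ => a) (fun _ => b) : Set (Fin n → ℝ)) := isCompact_Icc
  have hsub : (Icc (fun _ => a) (fun _ => b) : Set (Fin n → ℝ)) ⊆ positiveCone n :=
    fun x hx i => ha.trans_le (hx.1 i)
  have h : ∀ k, ∃ c C : ℝ, 0 < c ∧ 0 < C ∧
      ∀ lam ∈ (Icc (fun _ => a) (fun _ => b) : Set (Fin n → ℝ)),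
        c ≤ linearizedCoeff F α lam k ∧ linearizedCoeff F α lam k ≤ C := by
    intro k
    have hcont := (hF.continuousOn_linearizedCoeff (α := α) k).mono hsub
    rcases (Icc (fun _ => a) (fun _ => b) : Set (Fin n → ℝ)).eq_empty_or_nonempty with he | hne
    · exact ⟨1, 1, one_pos, one_pos, by simp [he]⟩
    · obtain ⟨x, hx, hmin⟩ := hK.exists_isMinOn hne hcont
      obtain ⟨y, hy, hmax⟩ := hK.exists_isMaxOn hne hcont
      exact ⟨_, _, linearizedCoeff_pos hF hα (hsub hx) k, linearizedCoeff_pos hF hα (hsub hy) k,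
        fun lam hlam => ⟨hmin hlam, hmax hlam⟩⟩
  choose c C hc hC hcC using h
  rcases isEmpty_or_nonempty (Fin n) with hn | hn
  · exact ⟨1, 1, one_pos, one_pos, fun _ _ k => hn.elim k⟩
  obtain ⟨i, hi⟩ := Finite.exists_min c
  obtain ⟨j, hj⟩ := Finite.exists_max C
  refine ⟨c i, C j, hc i, hC j, fun lam hlam k => ?_⟩
  have := hcC k lam ⟨fun k => (hlam k).1, fun k => (hlam k).2⟩
  exact ⟨(hi k).trans this.1, this.2.trans (hj k)⟩

variable {U : Set (ℝ × EuclideanSpace ℝ (Fin n))}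
  {Y N : ℝ × EuclideanSpace ℝ (Fin n) → Ambient n} {σ : ℝ × EuclideanSpace ℝ (Fin n) → ℝ}
  {p : ℝ × EuclideanSpace ℝ (Fin n)} {L : Fin n → EuclideanSpace ℝ (Fin n)} {lam : Fin n → ℝ}

theorem IsNormalMotion.lorentz_left_left (H : IsNormalMotion U Y N σ) (hp : p ∈ U)
    (hL : IsPrincipalFrame Y N p L lam) (i : Fin n) :
    lorentz (dd (0, L i) Y p) (dd (0, L i) Y p) = lam i ^ 2 := by
  rw [H.dd_left_eq hp hL, lorentz_smul_left, lorentz_smul_right, hL.orthonormal]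
  simp [sq]

theorem IsNormalMotion.exists_coeff_left (H : IsNormalMotion U Y N σ) (hp : p ∈ U)
    (hL : IsPrincipalFrame Y N p L lam) (v : EuclideanSpace ℝ (Fin n)) :
    ∃ c : Fin n → ℝ, v = ∑ i, c i • L i ∧
      lorentz (dd (0, v) N p) (dd (0, v) Y p) = ∑ i, lam i * c i ^ 2 ∧
      lorentz (dd (0, v) Y p) (dd (0, v) Y p) = ∑ i, lam i ^ 2 * c i ^ 2 := by
  obtain ⟨c, hv, -, h⟩ := hL.exists_coeff v
  refine ⟨c, hv, h, ?_⟩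
  conv_lhs => rw [hv]
  rw [sum_dir, lorentz_sum_left]
  simp only [lorentz_sum_right, lorentz_smul_left, lorentz_smul_right, H.dd_left_eq hp hL,
    hL.orthonormal]
  simp only [mul_ite, mul_zero, mul_one, Finset.sum_ite_eq, Finset.mem_univ, if_true]
  exact Finset.sum_congr rfl fun i _ => by ring

/-- In the frame, `m` times the second form minus the first form is `∑ (m - λ_j) λ_j c_j²`. This is
positive on `v₀ ≠ 0` if every `λ_j < m`. -/
theorem IsNormalMotion.exists_eq_of_left (H : IsNormalMotion U Y N σ) (hp : p ∈ U)
    (hL : IsPrincipalFrame Y N p L lam) (hlam : lam ∈ positiveCone n) {m : ℝ}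
    (hle : ∀ k, lam k ≤ m) {v₀ : EuclideanSpace ℝ (Fin n)} (hv₀ : v₀ ≠ 0)
    (heq : m * lorentz (dd (0, v₀) N p) (dd (0, v₀) Y p)
      ≤ lorentz (dd (0, v₀) Y p) (dd (0, v₀) Y p)) : ∃ i, lam i = m := by
  obtain ⟨c, hc, h1, h2⟩ := H.exists_coeff_left hp hL v₀
  rw [h1, h2, Finset.mul_sum] at heq
  by_contra hne
  push Not at hne
  have hlt : ∀ i, lam i < m := fun i => lt_of_le_of_ne (hle i) (hne i)
  have hex : ∃ i, c i ≠ 0 := by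
    by_contra h0
    push Not at h0
    exact hv₀ (by rw [hc]; simp [h0])
  obtain ⟨i, hi⟩ := hex
  have key : ∀ j, m * (lam j * c j ^ 2) - lam j ^ 2 * c j ^ 2 = (m - lam j) * (lam j * c j ^ 2) :=
    fun j => by ring
  refine absurd heq (not_le.2 (Finset.sum_lt_sum (fun j _ => ?_) ⟨i, Finset.mem_univ i, ?_⟩))
  · have := mul_nonneg (sub_nonneg.2 (hle j)) (mul_nonneg (hlam j).le (sq_nonneg (c j)))
    linarith [key j]
  · have := mul_pos (sub_pos.2 (hlt i)) (mul_pos (hlam i) (by positivity : 0 < c i ^ 2))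
    linarith [key i]

/-- A lower bound for the second fundamental form in terms of the first yields an upper bound in
terms of the third. -/
theorem IsNormalMotion.lorentz_le_of_left_le (H : IsNormalMotion U Y N σ) (hp : p ∈ U) {m : ℝ}
    (v : EuclideanSpace ℝ (Fin n))
    (hpos : 0 < lorentz (dd (0, v) N p) (dd (0, v) Y p))
    (hle : lorentz (dd (0, v) Y p) (dd (0, v) Y p)
      ≤ m * lorentz (dd (0, v) N p) (dd (0, v) Y p)) :
    lorentz (dd (0, v) N p) (dd (0, v) Y p) ≤ m * lorentz (dd (0, v) N p) (dd (0, v) N p) := by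
  have hN := H.cotangent hp v
  -- Cauchy-Schwarz bounds the square of the second form by the product of the first and the third.
  -- Inserting the hypothesis on the first form leaves one positive factor of the second form to
  -- divide by.
  have h1 := lorentz_sq_le (H.timelike p hp) hN (H.lorentz_dd_left_self hp (0, v))
  have h2 := lorentz_self_nonneg (H.timelike p hp) hN
  refine le_of_mul_le_mul_right ?_ hpos
  nlinarith [mul_le_mul_of_nonneg_left hle h2]

theorem dd_time {φ : ℝ → ℝ} {φ' : ℝ} {E : Type*} [NormedAddCommGroup E] [NormedSpace ℝ E]
    {q : ℝ × E} (h : HasDerivAt φ φ' q.1) (a : ℝ) (v : E) :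
    dd (a, v) (fun q : ℝ × E => φ q.1) q = a * φ' := by
  have h1 : HasFDerivAt (fun q : ℝ × E => φ q.1) _ q :=
    h.hasFDerivAt.comp q (ContinuousLinearMap.fst ℝ ℝ E).hasFDerivAt
  rw [dd, h1.fderiv]
  simp

end PrincipalFrames

section Weak

variable {n : ℕ} {M : Type*} [TopologicalSpace M] [ChartedSpace (EuclideanSpace ℝ (Fin n)) M]
  [IsManifold (𝓡 n) ∞ M] {f : (Fin n → ℝ) → ℝ} {α : ℝ} {φ : ℝ → ℝ} {T : EReal}
  {X ν : ℝ → M → Ambient n}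

theorem lorentz_dd_eq_pairing {A B : ℝ → M → Ambient n}
    (hA : ContMDiffOn (𝓘(ℝ, ℝ).prod (𝓡 n)) 𝓘(ℝ, Ambient n) ∞
      (fun q : ℝ × M => A q.1 q.2) (timeInterval T ×ˢ univ))
    (hB : ContMDiffOn (𝓘(ℝ, ℝ).prod (𝓡 n)) 𝓘(ℝ, Ambient n) ∞
      (fun q : ℝ × M => B q.1 q.2) (timeInterval T ×ˢ univ)) {x₀ : M}
    {q : ℝ × EuclideanSpace ℝ (Fin n)} (hq : q ∈ chartInterior T x₀)
    (v : EuclideanSpace ℝ (Fin n)) :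
    lorentz (dd (0, v) (chartRep A x₀) q) (dd (0, v) (chartRep B x₀) q)
      = pairing A B q.1 ((extChartAt (𝓡 n) x₀).symm q.2) (chartFrame x₀ q.2 v) := by
  rw [← chartPairing_eq hA hB (chartInterior_subset T x₀ hq), chartPairing, dd_chartRep hq,
    dd_chartRep hq]

/-- The zero-order terms are controlled linearly as `λ_i` decreases to `1`. If `λ_i λ_k ≤ 1` the
`k`-th term is at most `0`. Otherwise `λ_k > 1/λ_i` gives `λ_i - λ_k ≤ λ_i² - 1`, while the other
factor is at most `3`. -/
theorem pinching_algebra {n : ℕ} {c : Fin n → ℝ} {lam : Fin n → ℝ} {C B s : ℝ} {i : Fin n}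
    (hlam : lam ∈ positiveCone n) (hc : ∀ k, 0 ≤ c k ∧ c k ≤ C) (hle : ∀ k, lam k ≤ lam i)
    (h1 : 1 ≤ lam i) (h2 : lam i ≤ 2) (hs : -B ≤ s) :
    ∑ k, c k * ((lam i - lam k) * (lam i * lam k - 1)) + s * (1 - lam i ^ 2)
      ≤ (3 * n * C + B) * (lam i ^ 2 - 1) := by
  have hy : 0 ≤ lam i ^ 2 - 1 := by nlinarith
  have hterm : ∀ k, c k * ((lam i - lam k) * (lam i * lam k - 1)) ≤ C * (3 * (lam i ^ 2 - 1)) := by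
    intro k
    have hk := hlam k
    have hC : 0 ≤ C := (hc k).1.trans (hc k).2
    rcases le_or_gt (lam i * lam k) 1 with h | h
    · have : c k * ((lam i - lam k) * (lam i * lam k - 1)) ≤ 0 :=
        mul_nonpos_of_nonneg_of_nonpos (hc k).1
          (mul_nonpos_of_nonneg_of_nonpos (sub_nonneg.2 (hle k)) (by linarith))
      have : 0 ≤ C * (3 * (lam i ^ 2 - 1)) := by positivity
      linarith
    · have h3 : lam i - lam k ≤ lam i ^ 2 - 1 := by nlinarith
      have h4 : lam i * lam k - 1 ≤ 3 := by nlinarith [hle k]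
      have h5 : (lam i - lam k) * (lam i * lam k - 1) ≤ 3 * (lam i ^ 2 - 1) := by
        nlinarith [mul_le_mul h3 h4 (by linarith) hy]
      exact mul_le_mul (hc k).2 h5
        (mul_nonneg (sub_nonneg.2 (hle k)) (by linarith)) hC
  have hsum : ∑ k, c k * ((lam i - lam k) * (lam i * lam k - 1))
      ≤ n * (C * (3 * (lam i ^ 2 - 1))) := by
    refine (Finset.sum_le_sum fun k _ => hterm k).trans_eq ?_
    simp
  nlinarith [mul_le_mul_of_nonneg_right hs hy]

/-- The barrier keeps `κ > 1/(1 + m exp(βt))`. It is phrased with the first and second forms, which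
makes sense before positivity of `κ` is known. The rate `β` does not depend on `m`, so that `m` can
later tend to `0`. -/
theorem IsCurvatureFlow.exists_pinching_rate [CompactSpace M]
    (hflow : IsCurvatureFlow f α φ T X ν) (hT : 0 < T) (hf : IsCurvatureFunction f)
    (hinv : IsInverseConcave f) (hα : 0 < α) (hconvex : IsHConvexHypersurface (X 0)) {t₁ : ℝ}
    (ht₁ : t₁ ∈ timeInterval T) : ∃ β : ℝ, ∀ m : ℝ, 0 < m → m * Real.exp (β * t₁) ≤ 1 →
      ∀ t ∈ Icc 0 t₁, ∀ x, ∀ v ≠ 0,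
        0 < (-1) * pairing X X t x v + (1 + m * Real.exp (β * t)) * pairing ν X t x v := by
  have hF := hf.isDualCurvatureFunction hinv
  have htimes : Icc 0 t₁ ⊆ timeInterval T := fun t ht =>
    And.intro ht.1 (lt_of_le_of_lt (by exact_mod_cast ht.2) ht₁.2)
  have hcompact : IsCompact (Icc 0 t₁ ×ˢ (univ : Set M)) := isCompact_Icc.prod isCompact_univ
  obtain ⟨Λ, hΛ1, hΛ⟩ := hflow.exists_curvature_bound hT ht₁
  have hΛ0 : 0 < Λ := by linarith
  obtain ⟨c₀, C, -, hC0, hC⟩ := hF.exists_linearizedCoeff_bounds hα (a := Λ⁻¹) (b := 2)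
    (inv_pos.2 hΛ0)
  obtain ⟨B, hB⟩ : ∃ B : ℝ, ∀ q ∈ Icc 0 t₁ ×ˢ (univ : Set M),
      -B ≤ φ q.1 - f (principalCurvatures (X q.1) (ν q.1) q.2) ^ α := by
    obtain ⟨b, hb⟩ := hcompact.bddBelow_image
      ((hflow.continuousOn_speed hT).mono (prod_mono htimes subset_rfl))
    exact ⟨-b, fun q hq => by rw [neg_neg]; exact hb (mem_image_of_mem _ hq)⟩
  set R := 3 * n * C + |B| with hR
  have hR0 : 0 ≤ R := by positivity
  -- With `y = m exp(βt) ≤ 1` the zero-order terms are at most `R((1 + y)² - 1) ≤ 3Ry`, whereas the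
  -- barrier grows at rate `βy`.
  set β := 3 * R + 1 with hβ
  refine ⟨β, fun m hm hm1 => ?_⟩
  by_contra hcon
  push Not at hcon
  obtain ⟨t', ht', x', v', hv', hfail⟩ := hcon
  have hmexp : Continuous fun t => 1 + m * Real.exp (β * t) := by fun_prop
  obtain ⟨⟨t, x⟩, hq, hbad, hfirst⟩ := exists_first_failure hcompact
    (isClosed_Icc.prod isClosed_univ)
    (P := fun q : ℝ × M => ∀ v ≠ 0, 0 < (-1) * pairing X X q.1 q.2 v
      + (1 + m * Real.exp (β * q.1)) * pairing ν X q.1 q.2 v)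
    (fun q hq h => (eventually_pairing_pos hT hflow (c := fun _ => -1) continuous_const hmexp
      (htimes hq.1) h).filter_mono (nhdsWithin_mono _ (prod_mono htimes subset_rfl)))
    ⟨(t', x'), mk_mem_prod ht' (mem_univ _), fun h => absurd (h v' hv') (not_lt.2 hfail)⟩
  have ht : t ∈ Icc 0 t₁ := hq.1
  simp only at hbad hfirst
  push Not at hbad
  obtain ⟨v₀, hv₀, hv₀le⟩ := hbad
  have ht0 : 0 < t := by
    refine lt_of_le_of_ne ht.1 fun h0 => ?_
    subst h0
    have h1 : pairing X X 0 x v₀ ≤ pairing ν X 0 x v₀ := hflow.initial_pinching hT hconvex x v₀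
    have h2 := hflow.pairing_self_pos (htimes ht) x hv₀
    have h3 : 0 < m * Real.exp (β * 0) := by positivity
    nlinarith
  -- Strict inequality holds before the first failure; at the failure time its weak form follows by
  -- continuity in time.
  have hA : ∀ s ∈ Ioc 0 t, ∀ y v,
      pairing X X s y v ≤ (1 + m * Real.exp (β * s)) * pairing ν X s y v := by
    intro s hs y v
    by_cases hv : v = 0
    · simp [hv, pairing]
    rcases hs.2.lt_or_eq with hlt | rfl
    · have := hfirst (s, y) (mk_mem_prod ⟨hs.1.le, hs.2.trans ht.2⟩ (mem_univ _)) hlt v hv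
      simp only at this
      linarith
    · have hsub : Ioo 0 s ⊆ timeInterval T := fun r hr => htimes ⟨hr.1.le, hr.2.le.trans ht.2⟩
      obtain ⟨hc1, hc2⟩ := hflow.continuousOn_pairing_time hT y v
      refine ContinuousWithinAt.closure_le (s := Ioo 0 s)
        (f := fun s => pairing X X s y v)
        (g := fun s => (1 + m * Real.exp (β * s)) * pairing ν X s y v) ?_
        ((hc1 s (htimes ht)).mono hsub)
        (hmexp.continuousWithinAt.mul ((hc2 s (htimes ht)).mono hsub)) fun r hr => ?_
      · rw [closure_Ioo hs.1.ne]
        exact ⟨hs.1.le, le_rfl⟩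
      · have := hfirst (r, y) (mk_mem_prod ⟨hr.1.le, hr.2.le.trans ht.2⟩ (mem_univ _)) hr.2 v hv
        simp only at this
        linarith
  set z := extChartAt (𝓡 n) x x with hz
  have hzx : (extChartAt (𝓡 n) x).symm z = x := extChartAt_to_inv x
  have hzt : z ∈ (extChartAt (𝓡 n) x).target := mem_extChartAt_target x
  have H := hflow.isDualFlow hT hf x
  have hp : (t, z) ∈ chartInterior T x := mk_mem_prod (And.intro ht0 (htimes ht).2) hzt
  have hYY : ∀ q ∈ chartInterior (n := n) T x, ∀ v, _ := fun q hq v =>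
    lorentz_dd_eq_pairing hflow.smooth hflow.smooth hq v
  have hNY : ∀ q ∈ chartInterior (n := n) T x, ∀ v, _ := fun q hq v =>
    lorentz_dd_eq_pairing hflow.smooth_normal hflow.smooth hq v
  have hpos : ∀ q ∈ chartInterior (n := n) T x, q.1 ≤ t → ∀ v ≠ 0,
      0 < lorentz (dd (0, v) (chartRep ν x) q) (dd (0, v) (chartRep X x) q) := by
    intro q hq hqt v hv
    rw [hNY q hq]
    have hw : chartFrame x q.2 v ≠ 0 := fun h =>
      hv ((bijective_chartFrame (n := n) x hq.2).1 (h.trans (map_zero _).symm))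
    have h1 := hA q.1 ⟨hq.1.1, hqt⟩ ((extChartAt (𝓡 n) x).symm q.2) (chartFrame x q.2 v)
    have h2 := hflow.pairing_self_pos (chartInterior_subset T x hq).1
      ((extChartAt (𝓡 n) x).symm q.2) hw
    exact pos_of_mul_pos_right (h2.trans_le h1) (by positivity)
  obtain ⟨L, lam, hlam, hL⟩ := H.exists_principalFrame hp (hpos _ hp le_rfl)
  set μ : ℝ × EuclideanSpace ℝ (Fin n) → ℝ := fun q => 1 + m * Real.exp (β * q.1) with hμ
  have hμs : ContDiff ℝ ∞ μ := by
    have : ContDiff ℝ ∞ fun s : ℝ => 1 + m * Real.exp (β * s) := by fun_prop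
    exact this.comp contDiff_fst
  have hcontact : ∀ q ∈ chartInterior (n := n) T x, q.1 ≤ t → ∀ v,
      lorentz (dd (0, v) (chartRep ν x) q) (dd (0, v) (chartRep X x) q)
        ≤ μ q * lorentz (dd (0, v) (chartRep ν x) q) (dd (0, v) (chartRep ν x) q) := by
    intro q hq hqt v
    by_cases hv : v = 0
    · subst hv
      have : ((0 : ℝ), (0 : EuclideanSpace ℝ (Fin n))) = 0 := rfl
      simp [this, dd]
    · refine H.lorentz_le_of_left_le hq v (hpos q hq hqt v hv) ?_
      rw [hYY q hq, hNY q hq]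
      exact hA q.1 ⟨hq.1.1, hqt⟩ _ _
  have hle := hL.le_of_le (hcontact _ hp le_rfl)
  obtain ⟨w₀, hw₀⟩ := (bijective_chartFrame (n := n) x hzt).2 v₀
  obtain ⟨i, hi⟩ := H.exists_eq_of_left hp hL hlam hle (v₀ := w₀)
    (by rintro rfl; exact hv₀ (by rw [← hw₀, map_zero])) (by
      rw [hYY _ hp, hNY _ hp]
      simp only [hzx, hw₀]
      linarith)
  have hmain := H.contact_inequality hF hα hp hlam hL
    (fun q hq hqt => hpos q hq hqt.le) hμs.contDiffOn hcontact hi.symm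
  have hderiv : ∀ s : ℝ, HasDerivAt (fun s => 1 + m * Real.exp (β * s))
      (m * (Real.exp (β * s) * β)) s := fun s => by
    simpa using (((hasDerivAt_id s).const_mul β).exp.const_mul m).const_add 1
  have hspace : ∀ v, dd (0, v) μ = fun _ => 0 := fun v => by
    funext q
    exact (dd_time (hderiv q.1) 0 v).trans (zero_mul _)
  have htime : dd (1, 0) μ (t, z) = 1 * (m * (Real.exp (β * t) * β)) :=
    dd_time (q := (t, z)) (hderiv t) 1 0
  rw [htime] at hmain
  simp only [hspace, dd_const, mul_zero, zero_mul, zero_div, Finset.sum_const_zero, sub_zero,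
    zero_add, one_mul] at hmain
  have hy0 : 0 < m * Real.exp (β * t) := by positivity
  have hy1 : m * Real.exp (β * t) ≤ 1 := by
    refine le_trans (mul_le_mul_of_nonneg_left (Real.exp_le_exp.2 ?_) hm.le) hm1
    exact mul_le_mul_of_nonneg_left ht.2 (by positivity)
  have hi' : lam i = 1 + m * Real.exp (β * t) := hi
  -- On `L_k` the second form is `λ_k` and the first is `λ_k²`, so the curvature bound `Λ` gives
  -- `λ_k ≥ 1/Λ`.
  have hbox : ∀ k, Λ⁻¹ ≤ lam k ∧ lam k ≤ 2 := by
    intro k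
    constructor
    · have h1 := hL.diagonal k k
      have h2 := H.lorentz_left_left hp hL k
      rw [if_pos rfl, hNY _ hp] at h1
      rw [hYY _ hp] at h2
      have h3 := hΛ t ht ((extChartAt (𝓡 n) x).symm z) (chartFrame x z (L k))
      simp only at h1 h2
      rw [h1, h2] at h3
      have hk := hlam k
      rw [inv_le_iff_one_le_mul₀' hΛ0]
      by_contra hlt
      nlinarith
    · exact (hle k).trans (by simp only [hμ]; linarith)
  have hspeed : -|B| ≤ chartSpeed T X ν x (t, z) := by
    rw [hflow.chartSpeed_eq hT (chartInterior_subset T x hp)]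
    exact (neg_le_neg (le_abs_self B)).trans (hB (t, _) (mk_mem_prod ht (mem_univ _)))
  have halg := pinching_algebra (c := fun k => linearizedCoeff (dualFunction f) α lam k) (C := C)
    hlam (fun k => ⟨(linearizedCoeff_pos hF hα hlam k).le, (hC lam hbox k).2⟩)
    (fun k => hi ▸ hle k) (by linarith) (hbox i).2 hspeed
  have hfin := hmain.trans halg
  rw [← hR, hi'] at hfin
  have : R * ((1 + m * Real.exp (β * t)) ^ 2 - 1) ≤ R * (3 * (m * Real.exp (β * t))) :=
    mul_le_mul_of_nonneg_left (by nlinarith) hR0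
  nlinarith

/-- Weak h-convexity is preserved by the flow. -/
theorem IsCurvatureFlow.pairing_le [CompactSpace M]
    (hflow : IsCurvatureFlow f α φ T X ν) (hT : 0 < T) (hf : IsCurvatureFunction f)
    (hinv : IsInverseConcave f) (hα : 0 < α) (hconvex : IsHConvexHypersurface (X 0)) {t : ℝ}
    (ht : t ∈ timeInterval T) (x : M) (v : EuclideanSpace ℝ (Fin n)) :
    pairing X X t x v ≤ pairing ν X t x v := by
  by_cases hv : v = 0
  · simp [hv, pairing]
  obtain ⟨β, hβ⟩ := hflow.exists_pinching_rate hT hf hinv hα hconvex ht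
  have key : ∀ ε : ℝ, 0 < ε → ε ≤ 1 → pairing X X t x v < (1 + ε) * pairing ν X t x v := by
    intro ε hε hε1
    have hexp : ε * Real.exp (-(β * t)) * Real.exp (β * t) = ε := by
      rw [mul_assoc, ← Real.exp_add, neg_add_cancel, Real.exp_zero, mul_one]
    have := hβ (ε * Real.exp (-(β * t))) (by positivity) (by rw [hexp]; exact hε1) t
      ⟨ht.1, le_rfl⟩ x v hv
    rw [hexp] at this
    linarith
  have hg := hflow.pairing_self_pos ht x hv
  have h1 := key 1 one_pos le_rfl
  set g := pairing X X t x v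
  set h := pairing ν X t x v
  have hh : 0 < h := by linarith
  by_contra hcon
  push Not at hcon
  have h2 := key (min 1 ((g - h) / h)) (lt_min one_pos (div_pos (by linarith) hh)) (min_le_left _ _)
  have h3 : min 1 ((g - h) / h) * h ≤ g - h :=
    (mul_le_mul_of_nonneg_right (min_le_right _ _) hh.le).trans_eq (div_mul_cancel₀ _ hh.ne')
  linarith

end Weak

/-! ## Uniform bounds for principal frames -/

section Bounds

theorem exists_posDef_lower_bound {W E : Type*} [TopologicalSpace W] [NormedAddCommGroup E]
    [NormedSpace ℝ E] [ProperSpace E] {K : Set W} (hK : IsCompact K) {Q : W → E → ℝ}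
    (hQ : ContinuousOn (fun p : W × E => Q p.1 p.2) (K ×ˢ univ))
    (hhom : ∀ q ∈ K, ∀ (r : ℝ) v, Q q (r • v) = r ^ 2 * Q q v)
    (hpos : ∀ q ∈ K, ∀ v ≠ 0, 0 < Q q v) : ∃ c : ℝ, 0 < c ∧ ∀ q ∈ K, ∀ v, c * ‖v‖ ^ 2 ≤ Q q v := by
  have key : ∃ c : ℝ, 0 < c ∧ ∀ p ∈ K ×ˢ Metric.sphere (0 : E) 1, c ≤ Q p.1 p.2 := by
    rcases (K ×ˢ Metric.sphere (0 : E) 1).eq_empty_or_nonempty with he | hne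
    · exact ⟨1, one_pos, by simp [he]⟩
    · obtain ⟨p, hp, hmin⟩ := (hK.prod (isCompact_sphere (0 : E) 1)).exists_isMinOn hne
        (hQ.mono (prod_mono subset_rfl (subset_univ _)))
      refine ⟨Q p.1 p.2, hpos p.1 hp.1 p.2 ?_, fun q hq => hmin hq⟩
      intro h
      have := hp.2
      rw [h] at this
      simp at this
  obtain ⟨c, hc, h⟩ := key
  refine ⟨c, hc, fun q hq v => ?_⟩
  by_cases hv : v = 0
  · have h0 := hhom q hq 0 v
    rw [zero_smul, zero_pow two_ne_zero, zero_mul] at h0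
    rw [hv, h0, norm_zero, zero_pow two_ne_zero, mul_zero]
  · have hv' : 0 < ‖v‖ := norm_pos_iff.2 hv
    have h1 := h (q, ‖v‖⁻¹ • v) (mk_mem_prod hq (by simp [norm_smul, hv'.ne']))
    simp only [hhom q hq] at h1
    rw [inv_pow, ← div_eq_inv_mul, le_div_iff₀ (by positivity)] at h1
    exact h1

variable {E W : Type*} [NormedAddCommGroup E] [NormedSpace ℝ E] [NormedAddCommGroup W]
  [NormedSpace ℝ W]

theorem norm_dd_le (v : E) (f : E → W) (p : E) : ‖dd v f p‖ ≤ ‖fderiv ℝ f p‖ * ‖v‖ :=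
  (fderiv ℝ f p).le_opNorm v

theorem norm_dd_dd_le {U : Set E} (hU : IsOpen U) {f : E → W} (hf : ContDiffOn ℝ ∞ f U) {p : E}
    (hp : p ∈ U) (v : E) : ‖dd v (dd v f) p‖ ≤ ‖fderiv ℝ (fderiv ℝ f) p‖ * ‖v‖ ^ 2 := by
  have h1 : ContDiffOn ℝ ∞ (fderiv ℝ f) U := hf.fderiv_of_isOpen hU (by simp)
  have h2 : HasFDerivAt (fderiv ℝ f) (fderiv ℝ (fderiv ℝ f) p) p :=
    ((h1.contDiffAt (hU.mem_nhds hp)).differentiableAt (by simp)).hasFDerivAt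
  have h3 : dd v (dd v f) p = fderiv ℝ (fderiv ℝ f) p v v := by
    have h4 : HasFDerivAt (fun q => fderiv ℝ f q v) _ p :=
      (ContinuousLinearMap.apply ℝ W v).hasFDerivAt.comp p h2
    change fderiv ℝ (fun q => fderiv ℝ f q v) p v = _
    rw [h4.fderiv]
    rfl
  rw [h3, sq, ← mul_assoc]
  exact (fderiv ℝ (fderiv ℝ f) p).le_opNorm₂ v v

end Bounds

/-! ### Ellipticity and coefficient bounds on compact sets. -/

section FrameBounds

variable {n : ℕ} {F : (Fin n → ℝ) → ℝ} {α : ℝ} {Φ : ℝ → ℝ}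
  {U : Set (ℝ × EuclideanSpace ℝ (Fin n))}
  {Y N : ℝ × EuclideanSpace ℝ (Fin n) → Ambient n} {σ : ℝ × EuclideanSpace ℝ (Fin n) → ℝ}

theorem continuousOn_lorentz_dd {A B : ℝ × EuclideanSpace ℝ (Fin n) → Ambient n} (hU : IsOpen U)
    (hA : ContDiffOn ℝ ∞ A U) (hB : ContDiffOn ℝ ∞ B U) :
    ContinuousOn (fun p : (ℝ × EuclideanSpace ℝ (Fin n)) × EuclideanSpace ℝ (Fin n) =>
      lorentz (dd (0, p.2) A p.1) (dd (0, p.2) B p.1)) (U ×ˢ univ) := by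
  have hv : ContinuousOn (fun p : (ℝ × EuclideanSpace ℝ (Fin n)) × EuclideanSpace ℝ (Fin n) =>
      ((0 : ℝ), p.2)) (U ×ˢ univ) :=
    (continuous_const.prodMk continuous_snd).continuousOn
  have h : ∀ {Z : ℝ × EuclideanSpace ℝ (Fin n) → Ambient n}, ContDiffOn ℝ ∞ Z U →
      ContinuousOn (fun p : (ℝ × EuclideanSpace ℝ (Fin n)) × EuclideanSpace ℝ (Fin n) =>
        dd (0, p.2) Z p.1) (U ×ˢ univ) := fun {Z} hZ =>
    ((hZ.continuousOn_fderiv_of_isOpen hU (by simp)).comp continuousOn_fst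
      fun p hp => hp.1).clm_apply hv
  exact (h hA).lorentz (h hB)

theorem lorentz_dd_smul (A B : ℝ × EuclideanSpace ℝ (Fin n) → Ambient n)
    (q : ℝ × EuclideanSpace ℝ (Fin n)) (r : ℝ) (v : EuclideanSpace ℝ (Fin n)) :
    lorentz (dd (0, r • v) A q) (dd (0, r • v) B q)
      = r ^ 2 * lorentz (dd (0, v) A q) (dd (0, v) B q) := by
  have : ((0 : ℝ), r • v) = r • ((0 : ℝ), v) := by simp
  simp only [this, dd, map_smul, lorentz_smul_left, lorentz_smul_right]
  ring

theorem IsNormalMotion.exists_form_bounds (H : IsNormalMotion U Y N σ)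
    {K : Set (ℝ × EuclideanSpace ℝ (Fin n))} (hK : IsCompact K) (hKU : K ⊆ U)
    (hpos : ∀ q ∈ U, ∀ v ≠ 0, 0 < lorentz (dd (0, v) N q) (dd (0, v) Y q)) :
    ∃ c C : ℝ, 0 < c ∧ 0 < C ∧ ∀ q ∈ K, ∀ v,
      c * ‖v‖ ^ 2 ≤ lorentz (dd (0, v) N q) (dd (0, v) Y q) ∧
      lorentz (dd (0, v) N q) (dd (0, v) N q) ≤ C * ‖v‖ ^ 2 := by
  obtain ⟨c, hc, h1⟩ := exists_posDef_lower_bound hK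
    (Q := fun q v => lorentz (dd (0, v) N q) (dd (0, v) Y q))
    ((continuousOn_lorentz_dd H.isOpen H.smooth_right H.smooth_left).mono
      (prod_mono hKU subset_rfl)) (fun q _ r v => lorentz_dd_smul _ _ _ _ _)
    fun q hq => hpos q (hKU hq)
  obtain ⟨C, hC⟩ := hK.exists_bound_of_continuousOn
    ((H.smooth_right.continuousOn_fderiv_of_isOpen H.isOpen (by simp)).mono hKU)
  refine ⟨c, 3 * C ^ 2 + 1, hc, by positivity, fun q hq v => ⟨h1 q hq v, ?_⟩⟩
  have h2 := norm_dd_le ((0 : ℝ), v) N q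
  rw [Prod.norm_mk, norm_zero, max_eq_right (norm_nonneg v)] at h2
  have h3 := h2.trans (mul_le_mul_of_nonneg_right (hC q hq) (norm_nonneg v))
  have h4 := (le_abs_self _).trans (abs_lorentz_le (dd (0, v) N q) (dd (0, v) N q))
  have h5 := mul_le_mul h3 h3 (norm_nonneg _) ((norm_nonneg _).trans h3)
  nlinarith [sq_nonneg ‖v‖]

/-- Uniform bounds for the coefficients of the linearized flow in principal frames. -/
theorem IsDualFlow.exists_frame_bounds (H : IsDualFlow F α Φ U Y N σ)
    (hF : IsDualCurvatureFunction F) (hα : 0 < α) {K : Set (ℝ × EuclideanSpace ℝ (Fin n))}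
    (hK : IsCompact K) (hKU : K ⊆ U)
    (hpos : ∀ q ∈ U, ∀ v ≠ 0, 0 < lorentz (dd (0, v) N q) (dd (0, v) Y q))
    (hle : ∀ q ∈ U, ∀ v, lorentz (dd (0, v) N q) (dd (0, v) Y q)
      ≤ lorentz (dd (0, v) N q) (dd (0, v) N q)) :
    ∃ c A : ℝ, 0 < c ∧ 0 < A ∧ ∀ p ∈ K, ∀ (L : Fin n → EuclideanSpace ℝ (Fin n)) lam,
      IsPrincipalFrame Y N p L lam →
      (∀ k, c ≤ linearizedCoeff F α lam k ∧ linearizedCoeff F α lam k ≤ A ∧ ‖L k‖ ≤ A) ∧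
      (∀ u, c * ‖u‖ ^ 2 ≤ ∑ k, inner ℝ u (L k) ^ 2) ∧
      (∀ k j, |lorentz (dd (0, L k) (dd (0, L k) N) p) (dd (0, L j) N p)| ≤ A) ∧
      (∀ j, |dd (0, L j) σ p / lam j| ≤ A) ∧ |σ p| ≤ A := by
  obtain ⟨c₁, C₁, hc₁, hC₁, hform⟩ := H.exists_form_bounds hK hKU hpos
  obtain ⟨c₂, C₂, hc₂, hC₂, hcoeff⟩ := hF.exists_linearizedCoeff_bounds hα (a := c₁ / C₁) (b := 1)
    (by positivity)
  obtain ⟨C₃, hC₃⟩ := hK.exists_bound_of_continuousOn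
    ((H.smooth_right.continuousOn_fderiv_of_isOpen H.isOpen (by simp)).mono hKU)
  obtain ⟨C₄, hC₄⟩ := hK.exists_bound_of_continuousOn
    (((H.smooth_right.fderiv_of_isOpen H.isOpen (m := ∞) (by simp)).continuousOn_fderiv_of_isOpen
      H.isOpen (by simp)).mono hKU)
  obtain ⟨C₅, hC₅⟩ := hK.exists_bound_of_continuousOn
    ((H.smooth_speed.continuousOn_fderiv_of_isOpen H.isOpen (by simp)).mono hKU)
  obtain ⟨C₆, hC₆⟩ := hK.exists_bound_of_continuousOn (H.smooth_speed.continuousOn.mono hKU)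
  -- `c₁ ‖L_k‖²` is at most the second form on `L_k`, which is at most the third, equal to `1`.
  set ℓ := Real.sqrt (1 / c₁) with hℓ
  have hℓ0 : 0 ≤ ℓ := Real.sqrt_nonneg _
  set A := C₂ + ℓ + 3 * ((|C₄| * ℓ ^ 2) * (|C₃| * ℓ)) + (|C₅| * ℓ) / (c₁ / C₁) + |C₆| with hA
  have hb1 : 0 ≤ 3 * ((|C₄| * ℓ ^ 2) * (|C₃| * ℓ)) := by positivity
  have hb2 : 0 ≤ (|C₅| * ℓ) / (c₁ / C₁) := by positivity
  have hb3 := abs_nonneg C₆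
  refine ⟨min c₂ (1 / C₁), A, lt_min hc₂ (by positivity), by linarith, fun p hp L lam hL => ?_⟩
  have hNN : ∀ k, lorentz (dd (0, L k) N p) (dd (0, L k) N p) = 1 := fun k => by
    simpa using hL.orthonormal k k
  have hNY : ∀ k, lorentz (dd (0, L k) N p) (dd (0, L k) Y p) = lam k := fun k => by
    simpa using hL.diagonal k k
  have hLk : ∀ k, ‖L k‖ ≤ ℓ := fun k => by
    refine Real.le_sqrt_of_sq_le ?_
    rw [le_div_iff₀ hc₁, mul_comm]
    exact ((hform p hp (L k)).1.trans (hle p (hKU hp) (L k))).trans_eq (hNN k)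
  have hlam1 : ∀ k, lam k ≤ 1 := fun k => by
    have := hle p (hKU hp) (L k)
    rwa [hNN, hNY] at this
  have hlam2 : ∀ k, c₁ / C₁ ≤ lam k := fun k => by
    have h1 := (hform p hp (L k)).1
    have h2 := (hform p hp (L k)).2
    rw [hNY] at h1
    rw [hNN] at h2
    rw [div_le_iff₀ hC₁]
    nlinarith
  have hnorm : ∀ k, ‖((0 : ℝ), L k)‖ ≤ ℓ := fun k => by
    rw [Prod.norm_mk, norm_zero, max_eq_right (norm_nonneg _)]
    exact hLk k
  refine ⟨fun k => ?_, fun u => ?_, fun k j => ?_, fun j => ?_, ?_⟩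
  · have := hcoeff lam (fun k => ⟨hlam2 k, hlam1 k⟩) k
    exact ⟨(min_le_left _ _).trans this.1, by linarith [this.2], by linarith [hLk k]⟩
  · obtain ⟨a, hu, ha, -⟩ := hL.exists_coeff u
    have h1 := (hform p hp u).2
    rw [ha] at h1
    -- With `u = ∑ a_i L_i`, Cauchy-Schwarz gives `‖u‖⁴ ≤ (∑ a_i²)(∑ ⟨u, L_i⟩²)`, and `∑ a_i²` is
    -- the third form on `u`, at most `C₁ ‖u‖²`.
    have h2 : ‖u‖ ^ 2 = ∑ i, a i * inner ℝ u (L i) := by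
      rw [← real_inner_self_eq_norm_sq]
      conv_lhs => rw [hu, sum_inner]
      rw [← hu]
      exact Finset.sum_congr rfl fun i _ => by rw [real_inner_smul_left, real_inner_comm]
    have h3 := Finset.sum_mul_sq_le_sq_mul_sq Finset.univ a fun i => inner ℝ u (L i)
    rw [← h2] at h3
    have hS : 0 ≤ ∑ i, inner ℝ u (L i) ^ 2 := Finset.sum_nonneg fun i _ => sq_nonneg _
    refine (mul_le_mul_of_nonneg_right (min_le_right _ _) (sq_nonneg _)).trans ?_
    rw [one_div, ← div_eq_inv_mul, div_le_iff₀ hC₁]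
    by_cases hu0 : ‖u‖ ^ 2 = 0
    · rw [hu0]; positivity
    · have hu1 : 0 < ‖u‖ ^ 2 := lt_of_le_of_ne (sq_nonneg _) (Ne.symm hu0)
      refine le_of_mul_le_mul_left ?_ hu1
      nlinarith [mul_le_mul_of_nonneg_right h1 hS]
  · have h1 := (norm_dd_dd_le H.isOpen H.smooth_right (hKU hp) ((0 : ℝ), L k))
    have h2 : ‖dd (0, L k) (dd (0, L k) N) p‖ ≤ |C₄| * ℓ ^ 2 :=
      h1.trans (mul_le_mul ((hC₄ p hp).trans (le_abs_self _))
        (pow_le_pow_left₀ (norm_nonneg _) (hnorm k) 2) (by positivity) (abs_nonneg _))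
    have h3 : ‖dd (0, L j) N p‖ ≤ |C₃| * ℓ := (norm_dd_le _ _ _).trans
      (mul_le_mul ((hC₃ p hp).trans (le_abs_self _)) (hnorm j) (norm_nonneg _) (abs_nonneg _))
    have h4 := (abs_lorentz_le _ _).trans (mul_le_mul_of_nonneg_left
      (mul_le_mul h2 h3 (norm_nonneg _) (by positivity)) (by norm_num : (0 : ℝ) ≤ 3))
    linarith
  · have h3 : ‖dd (0, L j) σ p‖ ≤ |C₅| * ℓ := (norm_dd_le _ _ _).trans
      (mul_le_mul ((hC₅ p hp).trans (le_abs_self _)) (hnorm j) (norm_nonneg _) (abs_nonneg _))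
    have hc : 0 < c₁ / C₁ := by positivity
    rw [abs_div, abs_of_pos (hc.trans_le (hlam2 j))]
    have := div_le_div₀ (by positivity) h3 hc (hlam2 j)
    rw [Real.norm_eq_abs] at this
    linarith
  · have := (hC₆ p hp).trans (le_abs_self _)
    rw [Real.norm_eq_abs] at this
    linarith

end FrameBounds

/-! ## The strong maximum principle -/

section Barrier

variable {E : Type*} [NormedAddCommGroup E] [InnerProductSpace ℝ E]

/-- A paraboloid with radius growing linearly from time `s` on. -/
def paraboloid (s c k : ℝ) (y : E) (q : ℝ × E) : ℝ := c + k * (q.1 - s) - ‖q.2 - y‖ ^ 2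

/-- A barrier supported on a paraboloid, with amplitude decaying exponentially in time. -/
def barrier (s c k : ℝ) (y : E) (ε κ μ : ℝ) (q : ℝ × E) : ℝ :=
  1 + μ - ε * Real.exp (-(κ * (q.1 - s))) * paraboloid s c k y q ^ 2

variable {s c k : ℝ} {y : E} {ε κ μ : ℝ}

theorem contDiff_paraboloid : ContDiff ℝ ∞ (paraboloid s c k y) := by
  have : ContDiff ℝ ∞ fun q : ℝ × E => ‖q.2 - y‖ ^ 2 :=
    (contDiff_snd.sub contDiff_const).norm_sq ℝ
  unfold paraboloid
  fun_prop

theorem contDiff_barrier : ContDiff ℝ ∞ (barrier s c k y ε κ μ) := by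
  have := contDiff_paraboloid (s := s) (c := c) (k := k) (y := y)
  unfold barrier
  fun_prop

theorem dd_eq_of_hasDerivAt {f : ℝ × E → ℝ} (hf : ContDiff ℝ ∞ f) {q v : ℝ × E} {f' : ℝ}
    (h : HasDerivAt (fun r : ℝ => f (q + r • v)) f' 0) : dd v f q = f' := by
  have h1 := hasDerivAt_line isOpen_univ hf.contDiffOn (p := q) (v := v) (s := 0) (mem_univ _)
  simpa using h1.unique h

theorem norm_line_sq (x v : E) (r : ℝ) :
    ‖x + r • v - y‖ ^ 2 = ‖x - y‖ ^ 2 + 2 * r * inner ℝ (x - y) v + r ^ 2 * ‖v‖ ^ 2 := by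
  rw [add_sub_right_comm, norm_add_sq_real, real_inner_smul_right, norm_smul, mul_pow,
    Real.norm_eq_abs, sq_abs]
  ring

theorem hasDerivAt_paraboloid_line (q : ℝ × E) (v : E) :
    HasDerivAt (fun r : ℝ => paraboloid s c k y (q + r • ((0 : ℝ), v)))
      (-2 * inner ℝ (q.2 - y) v) 0 := by
  have h : (fun r : ℝ => paraboloid s c k y (q + r • ((0 : ℝ), v))) = fun r : ℝ =>
      paraboloid s c k y q - (2 * inner ℝ (q.2 - y) v * r + ‖v‖ ^ 2 * r ^ 2) := by
    funext r
    simp only [paraboloid, Prod.fst_add, Prod.smul_fst, smul_zero, add_zero, Prod.snd_add,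
      Prod.smul_snd, norm_line_sq]
    ring
  rw [h]
  have h1 := (((hasDerivAt_id (0 : ℝ)).const_mul (2 * inner ℝ (q.2 - y) v)).fun_add
    (((hasDerivAt_id (0 : ℝ)).fun_pow 2).const_mul (‖v‖ ^ 2))).const_sub (paraboloid s c k y q)
  refine h1.congr_deriv ?_
  simp

theorem dd_barrier_space (v : E) : dd (0, v) (barrier s c k y ε κ μ) = fun q =>
    4 * (ε * Real.exp (-(κ * (q.1 - s)))) * paraboloid s c k y q * inner ℝ (q.2 - y) v := by
  funext q
  refine dd_eq_of_hasDerivAt contDiff_barrier ?_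
  have h1 := ((hasDerivAt_paraboloid_line (s := s) (c := c) (k := k) (y := y) q v).fun_pow
    2).const_mul (ε * Real.exp (-(κ * (q.1 - s)))) |>.const_sub (1 + μ)
  have h2 : (fun r : ℝ => barrier s c k y ε κ μ (q + r • ((0 : ℝ), v))) = fun r : ℝ =>
      1 + μ - ε * Real.exp (-(κ * (q.1 - s))) * paraboloid s c k y (q + r • ((0 : ℝ), v)) ^ 2 := by
    funext r
    simp [barrier]
  rw [h2]
  refine h1.congr_deriv ?_
  simp
  ring

/-- The term `-2⟨x - y, v⟩²` does not carry the factor `w`, the paraboloid function. It provides the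
good sign where `w` is small and the zeroth-order decay is too weak. -/
theorem dd_dd_barrier_space (v : E) (q : ℝ × E) :
    dd (0, v) (dd (0, v) (barrier s c k y ε κ μ)) q = 4 * (ε * Real.exp (-(κ * (q.1 - s)))) *
      (-2 * inner ℝ (q.2 - y) v ^ 2 + paraboloid s c k y q * ‖v‖ ^ 2) := by
  have hs : ContDiff ℝ ∞ (dd (0, v) (barrier s c k y ε κ μ)) :=
    contDiffOn_univ.1 (contDiffOn_dd isOpen_univ contDiff_barrier.contDiffOn _)
  refine dd_eq_of_hasDerivAt hs ?_
  have h2 : (fun r : ℝ => dd (0, v) (barrier s c k y ε κ μ) (q + r • ((0 : ℝ), v))) = fun r : ℝ =>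
      4 * (ε * Real.exp (-(κ * (q.1 - s)))) * (paraboloid s c k y (q + r • ((0 : ℝ), v)) *
        (inner ℝ (q.2 - y) v + ‖v‖ ^ 2 * r)) := by
    funext r
    rw [dd_barrier_space]
    simp only [Prod.fst_add, Prod.smul_fst, smul_zero, add_zero, Prod.snd_add, Prod.smul_snd]
    rw [add_sub_right_comm, inner_add_left, real_inner_smul_left, real_inner_self_eq_norm_sq]
    ring
  rw [h2]
  have h1 := ((hasDerivAt_paraboloid_line (s := s) (c := c) (k := k) (y := y) q v).fun_mul
    (((hasDerivAt_id (0 : ℝ)).const_mul (‖v‖ ^ 2)).const_add (inner ℝ (q.2 - y) v))).const_mul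
    (4 * (ε * Real.exp (-(κ * (q.1 - s)))))
  refine h1.congr_deriv ?_
  simp only [id, mul_zero, add_zero, zero_smul, mul_one]
  ring

theorem dd_barrier_time (q : ℝ × E) : dd (1, 0) (barrier s c k y ε κ μ) q =
    ε * Real.exp (-(κ * (q.1 - s))) *
      (κ * paraboloid s c k y q ^ 2 - 2 * k * paraboloid s c k y q) := by
  refine dd_eq_of_hasDerivAt contDiff_barrier ?_
  have h2 : (fun r : ℝ => barrier s c k y ε κ μ (q + r • ((1 : ℝ), (0 : E)))) = fun r : ℝ =>
      1 + μ - ε * Real.exp (-(κ * (q.1 - s)) + -κ * r) * (paraboloid s c k y q + k * r) ^ 2 := by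
    funext r
    simp only [barrier, paraboloid, Prod.fst_add, Prod.smul_fst, smul_eq_mul, mul_one,
      Prod.snd_add, Prod.smul_snd, smul_zero, add_zero]
    ring_nf
  rw [h2]
  have h1 := ((((((hasDerivAt_id (0 : ℝ)).const_mul (-κ)).const_add (-(κ * (q.1 - s)))).exp.const_mul
    ε).fun_mul ((((hasDerivAt_id (0 : ℝ)).const_mul k).const_add
      (paraboloid s c k y q)).fun_pow 2))).const_sub (1 + μ)
  refine h1.congr_deriv ?_
  simp
  ring

end Barrier

/-- The differential inequality satisfied by the barrier at a contact point determines a quadratic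
inequality for the paraboloid. -/
theorem barrier_algebra {n : ℕ} {G b l P d lam : Fin n → ℝ} {Γ : Fin n → Fin n → ℝ}
    {c A a w r κ k S ρ : ℝ} {i : Fin n} (hc : 0 < c) (hA : 0 < A) (ha : 0 < a) (hw : 0 < w)
    (hr : 0 ≤ r)
    (hG : ∀ j, c ≤ G j ∧ G j ≤ A) (hb : ∀ j, |b j| ≤ r * A) (hl : ∀ j, l j ≤ A)
    (hl0 : ∀ j, 0 ≤ l j)
    (hbsum : c * ρ ≤ ∑ j, b j ^ 2) (hΓ : ∀ k j, |Γ k j| ≤ A) (hP : ∀ j, P j ≤ 0)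
    (hτ : ∀ j, |d j / lam j| ≤ A) (hS : |S| ≤ A) (hlam0 : 0 < lam i) (hlam1 : lam i ≤ 1)
    (hlam : 1 - lam i ≤ a * w ^ 2)
    (h : a * (κ * w ^ 2 - 2 * k * w) ≤ ∑ j, G j * (4 * a * (-2 * b j ^ 2 + w * l j ^ 2)
      - ∑ m, Γ j m * (4 * a * w * b m) + P j) + S * (1 - lam i ^ 2)
      - ∑ j, 4 * a * w * b j * d j / lam j) :
    (κ - 2 * A) * w ^ 2 + 8 * c ^ 2 * ρ
      ≤ (2 * k + n * (A * (4 * A ^ 2 + n * (A * (4 * (r * A))))) + n * (4 * (r * A) * A)) * w := by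
  -- Every term carries the amplitude `a`. Ellipticity turns `-8 b_j²` into the good term, and the
  -- remaining second and first order contributions are `O(w)`.
  have h1 : ∀ j, G j * (4 * a * (-2 * b j ^ 2 + w * l j ^ 2) - ∑ m, Γ j m * (4 * a * w * b m) + P j)
      ≤ a * (-8 * c * b j ^ 2 + w * (A * (4 * A ^ 2 + n * (A * (4 * (r * A)))))) := by
    intro j
    have hG0 : 0 < G j := hc.trans_le (hG j).1
    have e1 : -∑ m, Γ j m * (4 * a * w * b m) ≤ a * w * (n * (A * (4 * (r * A)))) := by
      rw [← Finset.sum_neg_distrib]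
      have : ∀ m ∈ Finset.univ, -(Γ j m * (4 * a * w * b m)) ≤ a * w * (A * (4 * (r * A))) := by
        intro m _
        have e2 : |Γ j m * b m| ≤ A * (r * A) := by
          rw [abs_mul]
          exact mul_le_mul (hΓ j m) (hb m) (abs_nonneg _) hA.le
        have e3 := mul_le_mul_of_nonneg_left ((neg_le_abs _).trans e2)
          (by positivity : 0 ≤ 4 * (a * w))
        linarith
      refine (Finset.sum_le_sum this).trans_eq ?_
      simp
      ring
    have e4 : l j ^ 2 ≤ A ^ 2 := pow_le_pow_left₀ (hl0 j) (hl j) 2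
    have e5 : 4 * a * (-2 * b j ^ 2 + w * l j ^ 2) - ∑ m, Γ j m * (4 * a * w * b m) + P j
        ≤ a * (-8 * b j ^ 2 + w * (4 * A ^ 2 + n * (A * (4 * (r * A))))) := by
      have := mul_le_mul_of_nonneg_left e4 (by positivity : 0 ≤ 4 * (a * w))
      linarith [hP j]
    have e6 := mul_le_mul_of_nonneg_left e5 hG0.le
    have e7 : G j * (w * (4 * A ^ 2 + n * (A * (4 * (r * A)))))
        ≤ A * (w * (4 * A ^ 2 + n * (A * (4 * (r * A))))) :=
      mul_le_mul_of_nonneg_right (hG j).2 (by positivity)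
    have e8 : c * b j ^ 2 ≤ G j * b j ^ 2 := mul_le_mul_of_nonneg_right (hG j).1 (sq_nonneg _)
    have e9 := mul_le_mul_of_nonneg_left (add_le_add e7 (mul_le_mul_of_nonneg_left e8
      (by norm_num : (0 : ℝ) ≤ 8))) ha.le
    linarith
  have h2 : -∑ j, 4 * a * w * b j * d j / lam j ≤ a * w * (n * (4 * (r * A) * A)) := by
    rw [← Finset.sum_neg_distrib]
    have : ∀ j ∈ Finset.univ, -(4 * a * w * b j * d j / lam j) ≤ a * w * (4 * (r * A) * A) := by
      intro j _
      have e2 : |b j * (d j / lam j)| ≤ r * A * A := by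
        rw [abs_mul]
        exact mul_le_mul (hb j) (hτ j) (abs_nonneg _) (by positivity)
      have e3 := mul_le_mul_of_nonneg_left ((neg_le_abs _).trans e2)
        (by positivity : 0 ≤ 4 * (a * w))
      have e4 : 4 * a * w * b j * d j / lam j = 4 * (a * w) * (b j * (d j / lam j)) := by ring
      linarith
    refine (Finset.sum_le_sum this).trans_eq ?_
    simp
    ring
  -- `1 - λ_i² ≤ 2(1 - λ_i) ≤ 2 a w²`, so the zero-order term is absorbed by the decay rate `κ`.
  have h3 : S * (1 - lam i ^ 2) ≤ a * (2 * A * w ^ 2) := by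
    have e1 : 0 ≤ 1 - lam i ^ 2 := by nlinarith
    have e2 : 1 - lam i ^ 2 ≤ 2 * (a * w ^ 2) := by nlinarith
    calc S * (1 - lam i ^ 2) ≤ A * (1 - lam i ^ 2) :=
          mul_le_mul_of_nonneg_right ((le_abs_self S).trans hS) e1
      _ ≤ A * (2 * (a * w ^ 2)) := mul_le_mul_of_nonneg_left e2 hA.le
      _ = _ := by ring
  have h4 := Finset.sum_le_sum fun j (_ : j ∈ Finset.univ) => h1 j
  rw [← Finset.mul_sum, Finset.sum_add_distrib, ← Finset.mul_sum] at h4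
  simp only [Finset.sum_const, Finset.card_univ, Fintype.card_fin, nsmul_eq_mul] at h4
  have h5 := mul_le_mul_of_nonneg_left hbsum (by positivity : 0 ≤ 8 * c)
  have h6 := mul_le_mul_of_nonneg_left h5 ha.le
  refine le_of_mul_le_mul_left ?_ ha
  linarith

/-! ### Propagation of strict pinching. -/

section Propagation

variable {n : ℕ} {F : (Fin n → ℝ) → ℝ} {α : ℝ} {Φ : ℝ → ℝ}
  {U : Set (ℝ × EuclideanSpace ℝ (Fin n))}
  {Y N : ℝ × EuclideanSpace ℝ (Fin n) → Ambient n} {σ : ℝ × EuclideanSpace ℝ (Fin n) → ℝ}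

set_option maxHeartbeats 1000000 in
/-- Strict pinching on a small ball spreads to larger balls at later times. -/
theorem IsDualFlow.strict_of_strict (H : IsDualFlow F α Φ U Y N σ)
    (hF : IsDualCurvatureFunction F) (hα : 0 < α)
    (hpos : ∀ q ∈ U, ∀ v ≠ 0, 0 < lorentz (dd (0, v) N q) (dd (0, v) Y q))
    (hle : ∀ q ∈ U, ∀ v, lorentz (dd (0, v) N q) (dd (0, v) Y q)
      ≤ lorentz (dd (0, v) N q) (dd (0, v) N q)) {s t₀ η R : ℝ} {y : EuclideanSpace ℝ (Fin n)}
    (hst : s < t₀) (hη : 0 < η) (hηR : η < R) (hK : Icc s t₀ ×ˢ Metric.closedBall y R ⊆ U)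
    (hstrict : ∀ x ∈ Metric.closedBall y η, ∀ v ≠ 0,
      lorentz (dd (0, v) N (s, x)) (dd (0, v) Y (s, x))
        < lorentz (dd (0, v) N (s, x)) (dd (0, v) N (s, x))) :
    ∀ x ∈ Metric.ball y R, ∀ v ≠ 0,
      lorentz (dd (0, v) N (t₀, x)) (dd (0, v) Y (t₀, x))
        < lorentz (dd (0, v) N (t₀, x)) (dd (0, v) N (t₀, x)) := by
  have hR : 0 < R := hη.trans hηR
  set K := Icc s t₀ ×ˢ Metric.closedBall y R with hKdef
  have hKc : IsCompact K := isCompact_Icc.prod (isCompact_closedBall y R)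
  obtain ⟨c, A, hc, hA, hframe⟩ := H.exists_frame_bounds hF hα hKc hK hpos hle
  obtain ⟨c', C, -, hC, hform⟩ := H.exists_form_bounds hKc hK hpos
  have hgcont := continuousOn_lorentz_dd H.isOpen H.smooth_right H.smooth_right
  have hhcont := continuousOn_lorentz_dd H.isOpen H.smooth_right H.smooth_left
  have hsub : ({s} : Set ℝ) ×ˢ Metric.closedBall y η ⊆ K :=
    prod_mono (singleton_subset_iff.2 ⟨le_rfl, hst.le⟩) (Metric.closedBall_subset_closedBall hηR.le)
  obtain ⟨δ, hδ, hδle⟩ := exists_posDef_lower_bound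
    (isCompact_singleton.prod (isCompact_closedBall y η))
    (Q := fun q v => lorentz (dd (0, v) N q) (dd (0, v) N q)
      - lorentz (dd (0, v) N q) (dd (0, v) Y q))
    ((hgcont.sub hhcont).mono (prod_mono (hsub.trans hK) subset_rfl))
    (fun q _ r v => by rw [lorentz_dd_smul, lorentz_dd_smul]; ring)
    (fun q hq v hv => by
      have h1 : q = (s, q.2) := Prod.ext hq.1 rfl
      rw [h1]
      exact sub_pos.2 (hstrict q.2 hq.2 v hv))
  -- At time `s` one has `w ≤ η²` inside the paraboloid, and `ε η⁴ = δ/C` keeps the barrier above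
  -- the forms there.
  set ε := δ / (C * η ^ 4) with hε
  have hε0 : 0 < ε := by positivity
  -- The squared radius `η² + k(t - s)` grows from `η²` to `R²` between `s` and `t₀`.
  set k := (R ^ 2 - η ^ 2) / (t₀ - s) with hk
  have hk0 : 0 < k := div_pos (by nlinarith) (by linarith)
  have hkt : k * (t₀ - s) = R ^ 2 - η ^ 2 := div_mul_cancel₀ _ (by linarith)
  set D := 2 * k + n * (A * (4 * A ^ 2 + n * (A * (4 * (R * A))))) + n * (4 * (R * A) * A)
    + 8 * c ^ 2 with hD
  have hD0 : 0 < D := by positivity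
  -- Here `κ` is the decay rate of the barrier; it makes the quadratic inequality for `w` at a
  -- contact point have negative discriminant.
  set κ := 2 * A + D ^ 2 / (8 * c ^ 2 * η ^ 2) with hκ
  set w : ℝ × EuclideanSpace ℝ (Fin n) → ℝ := paraboloid s (η ^ 2) k y with hw
  have hwc : Continuous w := contDiff_paraboloid.continuous
  set S : Set (ℝ × EuclideanSpace ℝ (Fin n)) := {q | q.1 ∈ Icc s t₀ ∧ 0 ≤ w q} with hS
  have hSK : S ⊆ K := by
    rintro q ⟨hq1, hq2⟩
    refine mk_mem_prod hq1 ?_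
    rw [Metric.mem_closedBall, dist_eq_norm]
    refine (sq_le_sq₀ (norm_nonneg _) hR.le).1 ?_
    have : k * (q.1 - s) ≤ k * (t₀ - s) := mul_le_mul_of_nonneg_left (by linarith [hq1.2]) hk0.le
    have hq3 : 0 ≤ η ^ 2 + k * (q.1 - s) - ‖q.2 - y‖ ^ 2 := hq2
    linarith
  have hSclosed : IsClosed S :=
    (isClosed_Icc.preimage continuous_fst).inter (isClosed_le continuous_const hwc)
  have hScompact : IsCompact S := hKc.of_isClosed_subset hSclosed hSK
  have hgpos : ∀ q ∈ U, ∀ v ≠ 0, 0 < lorentz (dd (0, v) N q) (dd (0, v) N q) := fun q hq v hv =>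
    (hpos q hq v hv).trans_le (hle q hq v)
  -- The margin `μ` keeps contact away from the lateral boundary `w = 0`, where the barrier is `1 +
  -- μ`, and makes the initial inequality strict.
  have key : ∀ μ > 0, ∀ q ∈ S, ∀ v ≠ 0, 0 < barrier s (η ^ 2) k y ε κ μ q *
      lorentz (dd (0, v) N q) (dd (0, v) N q) - lorentz (dd (0, v) N q) (dd (0, v) Y q) := by
    intro μ hμ
    by_contra hcon
    set m : ℝ × EuclideanSpace ℝ (Fin n) → ℝ := barrier s (η ^ 2) k y ε κ μ with hm
    have hmc : Continuous m := contDiff_barrier.continuous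
    obtain ⟨p, hpS, hbad, hfirst⟩ := exists_first_failure hScompact hSclosed
      (P := fun q => ∀ v ≠ 0, 0 < m q * lorentz (dd (0, v) N q) (dd (0, v) N q)
        - lorentz (dd (0, v) N q) (dd (0, v) Y q))
      (fun q hq h => (eventually_posDef (D := U)
        (Q := fun q v => m q * lorentz (dd (0, v) N q) (dd (0, v) N q)
          - lorentz (dd (0, v) N q) (dd (0, v) Y q))
        (((hmc.comp continuous_fst).continuousOn.mul hgcont).sub hhcont)
        (fun q _ r v => by rw [lorentz_dd_smul, lorentz_dd_smul]; ring) (hK (hSK hq))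
        h).filter_mono (nhdsWithin_mono _ (hSK.trans hK)))
      (by
        by_contra hno
        push Not at hno
        exact hcon hno)
    push Not at hbad
    obtain ⟨v₀, hv₀, hv₀le⟩ := hbad
    have hpU : p ∈ U := hK (hSK hpS)
    have hp1 : p.1 ∈ Icc s t₀ := hpS.1
    have hg₀ := hgpos p hpU v₀ hv₀
    set a := ε * Real.exp (-(κ * (p.1 - s))) with ha
    have ha0 : 0 < a := by positivity
    have hmp : m p = 1 + μ - a * w p ^ 2 := rfl
    have hmp1 : m p ≤ 1 := by
      by_contra hlt
      push Not at hlt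
      linarith [hle p hpU v₀, mul_pos (sub_pos.2 hlt) hg₀]
    have hwp : 0 < w p := by
      refine lt_of_le_of_ne hpS.2 fun h0 => ?_
      rw [hmp, ← h0] at hmp1
      linarith [(by ring : a * (0 : ℝ) ^ 2 = 0)]
    have hps : s < p.1 := by
      refine lt_of_le_of_ne hp1.1 fun h0 => ?_
      have hwp' : w p = η ^ 2 - ‖p.2 - y‖ ^ 2 := by
        simp only [hw, paraboloid, ← h0, sub_self, mul_zero, add_zero]
      have hball : p.2 ∈ Metric.closedBall y η := by
        rw [Metric.mem_closedBall, dist_eq_norm]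
        exact (sq_le_sq₀ (norm_nonneg _) hη.le).1 (by linarith)
      have h1 := hδle p (mk_mem_prod h0.symm hball) v₀
      have h2 := (hform p (hSK hpS) v₀).2
      have h3 : w p ≤ η ^ 2 := by rw [hwp']; linarith [sq_nonneg ‖p.2 - y‖]
      have h4 : a = ε := by rw [ha, ← h0]; simp
      have h5 : ε * w p ^ 2 ≤ δ / C := by
        have : w p ^ 2 ≤ (η ^ 2) ^ 2 := pow_le_pow_left₀ hwp.le h3 2
        calc ε * w p ^ 2 ≤ ε * (η ^ 2) ^ 2 := mul_le_mul_of_nonneg_left this hε0.le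
          _ = δ / C := by rw [hε]; field_simp
      have h6 : δ / C * lorentz (dd (0, v₀) N p) (dd (0, v₀) N p) ≤ δ * ‖v₀‖ ^ 2 := by
        rw [div_mul_eq_mul_div, div_le_iff₀ hC]
        linarith [mul_le_mul_of_nonneg_left h2 hδ.le]
      rw [hmp, h4] at hv₀le
      linarith [mul_le_mul_of_nonneg_right h5 hg₀.le, mul_pos hμ hg₀]
    -- The barrier bounds the eigenvalues only inside the paraboloid and after time `s`; contact
    -- occurs in this open set, so the local contact inequality applies on it.
    set U' : Set (ℝ × EuclideanSpace ℝ (Fin n)) := U ∩ {q | s < q.1 ∧ 0 < w q} with hU'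
    have hU'open : IsOpen U' := H.isOpen.inter
      ((isOpen_lt continuous_const continuous_fst).inter (isOpen_lt continuous_const hwc))
    have hpU' : p ∈ U' := And.intro hpU (And.intro hps hwp)
    have H' : IsDualFlow F α Φ U' Y N σ := H.comp contDiff_id hU'open fun q hq => hq.1
    have hcontact : ∀ q ∈ U', q.1 ≤ p.1 → ∀ v, lorentz (dd (0, v) N q) (dd (0, v) Y q)
        ≤ m q * lorentz (dd (0, v) N q) (dd (0, v) N q) := by
      intro q hq hqp v
      by_cases hv : v = 0
      · have : ((0 : ℝ), (0 : EuclideanSpace ℝ (Fin n))) = 0 := rfl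
        simp [hv, this, dd]
      rcases hqp.lt_or_eq with hlt | heq
      · exact (sub_pos.1 (hfirst q (And.intro ⟨hq.2.1.le, hqp.trans hp1.2⟩ hq.2.2.le) hlt v hv)).le
      · have hline : Continuous fun r : ℝ => (r, q.2) := by fun_prop
        have hline' : ContinuousAt (fun r : ℝ => ((r, q.2), v)) q.1 := by fun_prop
        have hnhds : U ×ˢ univ ∈ 𝓝 ((q.1, q.2), v) :=
          prod_mem_nhds (H.isOpen.mem_nhds hq.1) Filter.univ_mem
        have hg := (hgcont.continuousAt hnhds).comp_of_eq hline' rfl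
        have hh := (hhcont.continuousAt hnhds).comp_of_eq hline' rfl
        have hev : ∀ᶠ r in 𝓝[<] q.1, (r, q.2) ∈ U' :=
          (hline.continuousAt.eventually (hU'open.mem_nhds hq)).filter_mono nhdsWithin_le_nhds
        refine le_of_tendsto_of_tendsto (b := 𝓝[<] q.1) (hh.mono_left nhdsWithin_le_nhds)
          (((hmc.comp hline).continuousAt.mul hg).mono_left nhdsWithin_le_nhds) ?_
        filter_upwards [hev, self_mem_nhdsWithin] with r hr hrq
        have hrq' : r < q.1 := hrq
        exact (sub_pos.1 (hfirst (r, q.2) (And.intro ⟨hr.2.1.le, (hrq'.le.trans hqp).trans hp1.2⟩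
          hr.2.2.le) (hrq'.trans_eq heq) v hv)).le
    obtain ⟨L, lam, hlam, hL⟩ := H.exists_principalFrame hpU (hpos p hpU)
    obtain ⟨i, hi⟩ := hL.exists_eq (hcontact p hpU' le_rfl) hv₀ (by linarith)
    have hmain := H'.contact_inequality hF hα hpU' hlam hL
      (fun q hq _ => hpos q hq.1) contDiff_barrier.contDiffOn hcontact hi.symm
    obtain ⟨hf1, hf2, hf3, hf4, hf5⟩ := hframe p (hSK hpS) L lam hL
    have hlami : lam i ≤ 1 := hi ▸ hmp1
    have hlek := hL.le_of_le (hcontact p hpU' le_rfl)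
    have hu : ‖p.2 - y‖ ≤ R := by
      have := (hSK hpS).2
      rwa [Metric.mem_closedBall, dist_eq_norm] at this
    -- Weak pinching gives `λ_j ≤ λ_i ≤ 1`, so the commutator terms have the favourable sign.
    have hP : ∀ j, (lam i - lam j) * (lam i * lam j - 1) ≤ 0 := fun j => by
      have h1 : lam j ≤ lam i := hi ▸ hlek j
      have h2 := hlam j
      have h3 := hlam i
      exact mul_nonpos_of_nonneg_of_nonpos (by linarith)
        (by linarith [mul_le_one₀ hlami h2.le (h1.trans hlami)])
    rw [dd_barrier_time] at hmain
    simp only [dd_dd_barrier_space] at hmain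
    simp only [dd_barrier_space] at hmain
    have hfin := barrier_algebra (b := fun j => inner ℝ (p.2 - y) (L j)) (l := fun j => ‖L j‖)
      (ρ := ‖p.2 - y‖ ^ 2) hc hA ha0 hwp hR.le
      (fun j => ⟨(hf1 j).1, (hf1 j).2.1⟩)
      (fun j => (abs_real_inner_le_norm _ _).trans
        (mul_le_mul hu (hf1 j).2.2 (norm_nonneg _) hR.le))
      (fun j => (hf1 j).2.2) (fun j => norm_nonneg _) (hf2 _) hf3 hP hf4 hf5 (hlam i) hlami
      (by rw [hi, hmp]; linarith) hmain
    -- `w` and `‖x - y‖²` cannot both be small. Thus the gradient term gives a positive constant up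
    -- to a multiple of `w`, which is absorbed in `D`.
    have hρ : η ^ 2 ≤ ‖p.2 - y‖ ^ 2 + w p := by
      have h1 : w p = η ^ 2 + k * (p.1 - s) - ‖p.2 - y‖ ^ 2 := rfl
      have h2 : 0 ≤ k * (p.1 - s) := mul_nonneg hk0.le (by linarith)
      linarith
    set Δ := 8 * c ^ 2 * η ^ 2 with hΔ
    have hΔ0 : 0 < Δ := by positivity
    have hquad : (κ - 2 * A) * w p ^ 2 + Δ ≤ D * w p := by
      have := mul_le_mul_of_nonneg_left hρ (by positivity : 0 ≤ 8 * c ^ 2)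
      rw [hD]
      linarith
    -- Multiplied by `Δ`, the inequality becomes `(D w - Δ/2)² + 3Δ²/4 ≤ 0`, which is impossible.
    have hκ' : κ - 2 * A = D ^ 2 / Δ := by rw [hκ]; ring
    rw [hκ', div_mul_eq_mul_div, div_add' _ _ _ hΔ0.ne', div_le_iff₀ hΔ0] at hquad
    linarith [sq_nonneg (D * w p - Δ / 2), mul_pos hΔ0 hΔ0]
  intro x hx v hv
  have hwx : 0 < w (t₀, x) := by
    rw [Metric.mem_ball, dist_eq_norm] at hx
    have h1 : w (t₀, x) = η ^ 2 + k * (t₀ - s) - ‖x - y‖ ^ 2 := rfl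
    rw [h1, hkt]
    have := (sq_lt_sq₀ (norm_nonneg _) hR.le).2 hx
    linarith
  have hxS : (t₀, x) ∈ S := And.intro ⟨hst.le, le_rfl⟩ hwx.le
  set a := ε * Real.exp (-(κ * (t₀ - s))) with ha
  have haw : 0 < a * w (t₀, x) ^ 2 := by positivity
  -- This choice of `μ` makes the barrier equal to `1` at the target point.
  have h1 := key (a * w (t₀, x) ^ 2) haw (t₀, x) hxS v hv
  have h2 : barrier s (η ^ 2) k y ε κ (a * w (t₀, x) ^ 2) (t₀, x) = 1 := by
    simp only [barrier, ← ha, ← hw]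
    ring
  rw [h2, one_mul] at h1
  linarith

end Propagation

/-! ## Strict h-convexity at positive times -/

section Strict

variable {n : ℕ} {M : Type*} [TopologicalSpace M] [ChartedSpace (EuclideanSpace ℝ (Fin n)) M]
  {f : (Fin n → ℝ) → ℝ} {α : ℝ} {φ : ℝ → ℝ} {T : EReal} {X ν : ℝ → M → Ambient n}

/-- The second fundamental form is strictly smaller than the third, that is, all principal
curvatures are bigger than `1`. -/
def IsStrictlyPinchedAt (X ν : ℝ → M → Ambient n) (t : ℝ) (x : M) : Prop :=
  ∀ v ≠ 0, pairing ν X t x v < pairing ν ν t x v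

variable [IsManifold (𝓡 n) ∞ M]

theorem isStrictlyPinchedAt_chart (hflow : IsCurvatureFlow f α φ T X ν) {x₀ : M}
    {q : ℝ × EuclideanSpace ℝ (Fin n)} (hq : q ∈ chartInterior T x₀) :
    IsStrictlyPinchedAt X ν q.1 ((extChartAt (𝓡 n) x₀).symm q.2) ↔
      ∀ v ≠ 0, lorentz (dd (0, v) (chartRep ν x₀) q) (dd (0, v) (chartRep X x₀) q)
        < lorentz (dd (0, v) (chartRep ν x₀) q) (dd (0, v) (chartRep ν x₀) q) := by
  have hbij := bijective_chartFrame (n := n) x₀ hq.2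
  simp only [lorentz_dd_eq_pairing hflow.smooth_normal hflow.smooth hq,
    lorentz_dd_eq_pairing hflow.smooth_normal hflow.smooth_normal hq]
  constructor
  · intro h v hv
    exact h _ fun hw => hv (hbij.1 (hw.trans (map_zero _).symm))
  · intro h v hv
    obtain ⟨w, rfl⟩ := hbij.2 v
    exact h w fun hw => hv (by rw [hw, map_zero])

/-- By Cauchy-Schwarz the second form squared is at most the first times the third. If the first is
below the second, the second is therefore below the third. -/
theorem IsCurvatureFlow.isStrictlyPinchedAt_of_lt (hflow : IsCurvatureFlow f α φ T X ν)
    (hT : 0 < T) {t : ℝ} (ht : t ∈ timeInterval T) (ht0 : 0 < t) {x : M}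
    (h : ∀ v ≠ 0, pairing X X t x v < pairing ν X t x v) : IsStrictlyPinchedAt X ν t x := by
  have hp : (t, extChartAt (𝓡 n) x x) ∈ chartInterior T x :=
    mk_mem_prod (And.intro ht0 ht.2) (mem_extChartAt_target x)
  have H := hflow.isNormalMotion hT x
  have hiff := isStrictlyPinchedAt_chart hflow hp
  simp only [extChartAt_to_inv] at hiff
  refine hiff.2 fun v hv => ?_
  have hw : chartFrame x (extChartAt (𝓡 n) x x) v ≠ 0 := fun h0 =>
    hv ((bijective_chartFrame (n := n) x hp.2).1 (h0.trans (map_zero _).symm))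
  have h1 := h _ hw
  have h2 := hflow.pairing_self_pos ht x hw
  have h3 := lorentz_dd_eq_pairing hflow.smooth hflow.smooth hp v
  have h4 := lorentz_dd_eq_pairing hflow.smooth_normal hflow.smooth hp v
  simp only [extChartAt_to_inv] at h3 h4
  rw [← h3] at h1 h2
  rw [← h4] at h1
  have h5 := lorentz_sq_le (H.timelike _ hp) (H.cotangent hp v) (H.lorentz_dd_left_self hp (0, v))
  have h6 := h2.trans h1
  have h7 := lorentz_self_nonneg (H.timelike _ hp) (H.cotangent hp v)
  by_contra hcon
  push Not at hcon
  nlinarith [mul_le_mul_of_nonneg_right hcon h2.le]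

/-- Around every point strict pinching spreads instantaneously. -/
theorem IsCurvatureFlow.exists_nhds_spread [CompactSpace M]
    (hflow : IsCurvatureFlow f α φ T X ν) (hT : 0 < T) (hf : IsCurvatureFunction f)
    (hinv : IsInverseConcave f) (hα : 0 < α) (hconvex : IsHConvexHypersurface (X 0)) (x₀ : M) :
    ∃ O ∈ 𝓝 x₀, ∀ s t : ℝ, 0 < s → s < t → t ∈ timeInterval T → ∀ y ∈ O,
      IsStrictlyPinchedAt X ν s y → ∀ x ∈ O, IsStrictlyPinchedAt X ν t x := by
  set e := extChartAt (𝓡 n) x₀ with he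
  obtain ⟨r, hr, hball⟩ := Metric.nhds_basis_closedBall.mem_iff.1
    ((isOpen_extChartAt_target (I := 𝓡 n) x₀).mem_nhds (mem_extChartAt_target (I := 𝓡 n) x₀))
  have H := hflow.isDualFlow hT hf x₀
  have hpos : ∀ q ∈ chartInterior (n := n) T x₀, ∀ v ≠ 0,
      0 < lorentz (dd (0, v) (chartRep ν x₀) q) (dd (0, v) (chartRep X x₀) q) := by
    intro q hq v hv
    have hw : chartFrame x₀ q.2 v ≠ 0 := fun h =>
      hv ((bijective_chartFrame (n := n) x₀ hq.2).1 (h.trans (map_zero _).symm))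
    have hqt := (chartInterior_subset T x₀ hq).1
    rw [lorentz_dd_eq_pairing hflow.smooth_normal hflow.smooth hq]
    exact (hflow.pairing_self_pos hqt _ hw).trans_le
      (hflow.pairing_le hT hf hinv hα hconvex hqt _ _)
  have hle : ∀ q ∈ chartInterior (n := n) T x₀, ∀ v,
      lorentz (dd (0, v) (chartRep ν x₀) q) (dd (0, v) (chartRep X x₀) q)
        ≤ lorentz (dd (0, v) (chartRep ν x₀) q) (dd (0, v) (chartRep ν x₀) q) := by
    intro q hq v
    by_cases hv : v = 0
    · have : ((0 : ℝ), (0 : EuclideanSpace ℝ (Fin n))) = 0 := rfl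
      simp [hv, this, dd]
    · have := H.lorentz_le_of_left_le hq v (hpos q hq v hv) (m := 1) (by
        rw [one_mul, lorentz_dd_eq_pairing hflow.smooth hflow.smooth hq,
          lorentz_dd_eq_pairing hflow.smooth_normal hflow.smooth hq]
        exact hflow.pairing_le hT hf hinv hα hconvex (chartInterior_subset T x₀ hq).1 _ _)
      rwa [one_mul] at this
  -- Two points of the `r/3` ball are less than `2r/3` apart, and the closed ball of radius `2r/3`
  -- about either stays in the chart ball of radius `r`.
  refine ⟨e.source ∩ e ⁻¹' Metric.ball (e x₀) (r / 3), Filter.inter_mem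
    (extChartAt_source_mem_nhds x₀) ((continuousAt_extChartAt x₀).preimage_mem_nhds
      (Metric.ball_mem_nhds _ (by positivity))), fun s t hs hst ht y hy hstrict x hx => ?_⟩
  have hmem : ∀ τ ∈ Icc s t, ∀ z ∈ e.target, (τ, z) ∈ chartInterior (n := n) T x₀ :=
    fun τ hτ z hz => mk_mem_prod (And.intro (hs.trans_le hτ.1)
      (lt_of_le_of_lt (by exact_mod_cast hτ.2) ht.2)) hz
  have hsub : Metric.closedBall (e y) (2 * r / 3) ⊆ e.target := by
    refine Subset.trans (Metric.closedBall_subset_closedBall' ?_) hball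
    have : dist (e y) (e x₀) < r / 3 := hy.2
    linarith
  have hyt : e y ∈ e.target := e.map_source hy.1
  have hsy := hmem s ⟨le_rfl, hst.le⟩ (e y) hyt
  have hyy : e.symm (e y) = y := e.left_inv hy.1
  have hxx : e.symm (e x) = x := e.left_inv hx.1
  have h1 := (isStrictlyPinchedAt_chart hflow hsy).1 (by simpa only [← he, hyy] using hstrict)
  have h2 := eventually_posDef
    (Q := fun q v => lorentz (dd (0, v) (chartRep ν x₀) q) (dd (0, v) (chartRep ν x₀) q)
      - lorentz (dd (0, v) (chartRep ν x₀) q) (dd (0, v) (chartRep X x₀) q))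
    ((continuousOn_lorentz_dd H.isOpen H.smooth_right H.smooth_right).sub
      (continuousOn_lorentz_dd H.isOpen H.smooth_right H.smooth_left))
    (fun q _ r v => by rw [lorentz_dd_smul, lorentz_dd_smul]; ring) hsy
    fun v hv => sub_pos.2 (h1 v hv)
  rw [H.isOpen.nhdsWithin_eq hsy] at h2
  have h3 : ContinuousAt (fun z : EuclideanSpace ℝ (Fin n) => (s, z)) (e y) := by fun_prop
  obtain ⟨η, hη, hηball⟩ := Metric.nhds_basis_closedBall.mem_iff.1 (h3.eventually h2)
  have h4 := H.strict_of_strict (hf.isDualCurvatureFunction hinv) hα hpos hle hst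
    (η := min η (r / 3)) (R := 2 * r / 3) (y := e y) (lt_min hη (by positivity))
    ((min_le_right _ _).trans_lt (by linarith))
    (fun q hq => hmem q.1 hq.1 q.2 (hsub hq.2))
    (fun z hz v hv => sub_pos.1
      (hηball (Metric.closedBall_subset_closedBall (min_le_left _ _) hz) v hv))
    (e x) (by
      have h5 : dist (e x) (e x₀) < r / 3 := hx.2
      have h6 : dist (e y) (e x₀) < r / 3 := hy.2
      have h7 := dist_triangle_right (e x) (e y) (e x₀)
      rw [Metric.mem_ball]
      linarith)
  have h8 := (isStrictlyPinchedAt_chart hflow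
    (hmem t ⟨hst.le, le_rfl⟩ (e x) (e.map_source hx.1))).2 h4
  simpa only [← he, hxx] using h8

/-- The set of points strictly pinched at all positive times is open, closed and nonempty. Local
spreading costs only a positive amount of time, so strictness at `t/2` always suffices for time `t`.
-/
theorem IsCurvatureFlow.isStrictlyPinchedAt [CompactSpace M] [ConnectedSpace M]
    (hflow : IsCurvatureFlow f α φ T X ν) (hT : 0 < T) (hf : IsCurvatureFunction f)
    (hinv : IsInverseConcave f) (hα : 0 < α) (hconvex : IsHConvexHypersurface (X 0)) {t : ℝ}
    (ht : t ∈ timeInterval T) (ht0 : 0 < t) (x : M) : IsStrictlyPinchedAt X ν t x := by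
  set A : Set M := {x | ∀ t ∈ timeInterval T, 0 < t → IsStrictlyPinchedAt X ν t x} with hA
  have htime : ∀ {s t : ℝ}, t ∈ timeInterval T → 0 ≤ s → s ≤ t → s ∈ timeInterval T :=
    fun ht hs hst => And.intro hs (lt_of_le_of_lt (by exact_mod_cast hst) ht.2)
  have hspread := hflow.exists_nhds_spread hT hf hinv hα hconvex
  have hopen : IsOpen A := by
    refine isOpen_iff_mem_nhds.2 fun x hx => ?_
    obtain ⟨O, hO, h⟩ := hspread x
    exact Filter.mem_of_superset hO fun y hy t ht ht0 => h (t / 2) t (by linarith) (by linarith) ht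
      x (mem_of_mem_nhds hO) (hx (t / 2) (htime ht (by linarith) (by linarith)) (by linarith)) y hy
  have hclosed : IsClosed A := by
    refine isClosed_of_closure_subset fun x hx t ht ht0 => ?_
    obtain ⟨O, hO, h⟩ := hspread x
    obtain ⟨y, hyO, hyA⟩ := mem_closure_iff_nhds.1 hx O hO
    exact h (t / 2) t (by linarith) (by linarith) ht y hyO
      (hyA (t / 2) (htime ht (by linarith) (by linarith)) (by linarith)) x (mem_of_mem_nhds hO)
  -- Strictness at the furthest point of `M_0` persists for short times by openness, and then
  -- spreads from such a time `s` to any later `t`.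
  have hne : A.Nonempty := by
    obtain ⟨x₁, hx₁⟩ := hflow.exists_initial_strict hT hconvex
    refine ⟨x₁, fun t ht ht0 => ?_⟩
    obtain ⟨O, hO, h⟩ := hspread x₁
    have h1 := eventually_pairing_pos hT hflow (c := fun _ => -1) (d := fun _ => 1)
      continuous_const continuous_const (zero_mem_timeInterval hT) (x := x₁)
      (fun v hv => by
        have h2 : pairing X X 0 x₁ v < pairing ν X 0 x₁ v := hx₁ v hv
        linarith)
    have h2 : ContinuousAt (fun s : ℝ => (s, x₁)) 0 := by fun_prop
    have h3 := (h2.eventually (eventually_nhdsWithin_iff.1 h1)).filter_mono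
      (nhdsWithin_le_nhds (s := Ioi 0))
    obtain ⟨s, hs, hs0⟩ := (h3.and (Ioo_mem_nhdsGT ht0)).exists
    have hst := htime ht hs0.1.le hs0.2.le
    refine h s t hs0.1 hs0.2 ht x₁ (mem_of_mem_nhds hO) ?_ x₁ (mem_of_mem_nhds hO)
    refine hflow.isStrictlyPinchedAt_of_lt hT hst hs0.1 fun v hv => ?_
    have := hs (mk_mem_prod hst (mem_univ _)) v hv
    simp only at this
    linarith
  have := (IsClopen.eq_univ ⟨hclosed, hopen⟩ hne) ▸ mem_univ x
  exact this t ht ht0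

/-- Strict pinching makes the relative eigenvalues less than `1` in a principal frame; the principal
curvatures are their inverses. -/
theorem IsCurvatureFlow.isStrictlyHConvex [CompactSpace M] [ConnectedSpace M]
    (hflow : IsCurvatureFlow f α φ T X ν) (hT : 0 < T) (hf : IsCurvatureFunction f)
    (hinv : IsInverseConcave f) (hα : 0 < α) (hconvex : IsHConvexHypersurface (X 0)) {t : ℝ}
    (ht : t ∈ timeInterval T) (ht0 : 0 < t) : IsStrictlyHConvex (X t) (ν t) := by
  intro x i
  have hp : (t, extChartAt (𝓡 n) x x) ∈ chartInterior T x :=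
    mk_mem_prod (And.intro ht0 ht.2) (mem_extChartAt_target x)
  have hp' := chartInterior_subset (n := n) T x hp
  have H := hflow.isNormalMotion hT x
  have hstrict := (isStrictlyPinchedAt_chart hflow hp).1
    (hflow.isStrictlyPinchedAt hT hf hinv hα hconvex ht ht0 _)
  have hpos : ∀ v ≠ 0, 0 < lorentz (dd (0, v) (chartRep ν x) (t, extChartAt (𝓡 n) x x))
      (dd (0, v) (chartRep X x) (t, extChartAt (𝓡 n) x x)) := fun v hv => by
    have hw : chartFrame x (extChartAt (𝓡 n) x x) v ≠ 0 := fun h =>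
      hv ((bijective_chartFrame (n := n) x hp.2).1 (h.trans (map_zero _).symm))
    rw [lorentz_dd_eq_pairing hflow.smooth_normal hflow.smooth hp]
    exact (hflow.pairing_self_pos ht _ hw).trans_le
      (hflow.pairing_le hT hf hinv hα hconvex ht _ _)
  obtain ⟨L, lam, hlam, hL⟩ := H.exists_principalFrame hp hpos
  have hlt : ∀ k, lam k < 1 := fun k => by
    have hk : L k ≠ 0 := fun h0 => hL.linearIndependent.ne_zero k h0
    have := hstrict (L k) hk
    rw [hL.diagonal, hL.orthonormal] at this
    simpa using this
  have heig := H.dd_left_eq hp hL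
  have hort := hL.orthonormal
  simp only [dd_chartRep hp, chartDeriv_space hflow.smooth hp',
    chartDeriv_space hflow.smooth_normal hp'] at heig hort
  obtain ⟨σ, hσ⟩ := exists_perm_principalCurvatures hlam hort heig
  simp only [extChartAt_to_inv] at hσ
  rw [hσ]
  exact (one_lt_inv₀ (hlam _)).2 (hlt _)

end Strict

end HypFlow

end

theorem theorem3p2 {n : ℕ} (hn : 1 ≤ n) {M : Type*} [TopologicalSpace M]
    [ChartedSpace (EuclideanSpace ℝ (Fin n)) M] [IsManifold (𝓡 n) ∞ M]
    [CompactSpace M] [ConnectedSpace M]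
    (f : (Fin n → ℝ) → ℝ) (hf : HypFlow.IsCurvatureFunction f)
    (hf_inv : HypFlow.IsInverseConcave f) (α : ℝ) (hα : 0 < α)
    (φ : ℝ → ℝ) (T : EReal) (hT : 0 < T) (X ν : ℝ → M → HypFlow.Ambient n)
    (hflow : HypFlow.IsCurvatureFlow f α φ T X ν)
    (hconvex : HypFlow.IsHConvexHypersurface (X 0)) :
    ∀ t ∈ HypFlow.timeInterval T, 0 < t → HypFlow.IsStrictlyHConvex (X t) (ν t) := by
  exact fun t ht ht0 => hflow.isStrictlyHConvex hT hf hf_inv hα hconvex ht ht0
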